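/- Let $0\le\tau<1$ and $N\ge 2$, and let $G=\frac{1}{\sqrt{2N}}\left(\sqrt{1+\tau}\,H+\sqrt{1-\tau}\,A\right)$ be the $N\times N$ real Elliptic Ginibre matrix: $H$ is symmetric with independent entries $H_{ij}\sim\mathcal N_{\mathbb R}(0,1+\delta_{ij})$ for $i\ge j$, $A$ is antisymmetric with i.i.d. entries $A_{ij}\sim\mathcal N_{\mathbb R}(0,1)$ for $i>j$, and $H$, $A$ are independent. If $\lambda$ is an eigenvalue of $G$ with $\mathrm{Im}\,\lambda>0$, let $b\ge c>0$ be the off-diagonal parameters of its $2\times2$ block in the incomplete real Schur decomposition $$G=O\begin{pmatrix}\begin{matrix}x&b\\-c&x\end{matrix}&W\\0&A_1\end{pmatrix}O^{\top},\qquad O\in O_N(\mathbb R),\quad \lambda=x+i\sqrt{bc}.$$ (Almost surely all eigenvalues are simple, and then $(b,c)$ is determined by $G$ and $\lambda$.) Let $\mathcal M_N$ be the intensity measure of the point process of triples $(\lambda,b,c)$, i.e. $\mathcal M_N(B)=\mathbb E\,\#\{(\lambda,b,c)\in B\}$, where $\lambda$ runs over the eigenvalues of $G$ in the open upper half-plane.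 It is a well-defined finite measure, and Lebesgue measure on the open upper half-plane is absolutely continuous with respect to its $\lambda$-marginal. A conditional law given $\lambda$ is understood as a disintegration of $\mathcal M_N$ with respect to this marginal. Then, conditionally on $\lambda=x+iy/\sqrt N$ with $x\in\mathbb R$, $y>0$, the random variable $\delta=\sqrt N(b-c)$ has the probability density $$\rho_{y,\tau}(\delta)=\frac1{Z_{y,\tau}}\,\frac{\delta\,e^{-\frac{\delta^2}{2(1-\tau^2)}}}{\sqrt{\delta^2+4y^2}}\,\mathbf 1_{\delta>0},\qquad Z_{y,\tau}=\sqrt{\frac{\pi(1-\tau^2)}2}\;e^{\frac{2y^2}{1-\tau^2}}\;\mathrm{erfc}\!\left(\sqrt{\frac2{1-\tau^2}}\;y\right),$$ where $\mathrm{erfc}(u)=\frac{2}{\sqrt\pi}\int_u^\infty e^{-t^2}\,dt$. In particular this law does not depend on $N$, and the joint law of $(\sqrt N\,b,\sqrt N\,c)$ conditionally on $\lambda=x+iy/\sqrt N$ does not depend on $N$ either: for each $\tau$ there is one family of probability measures on $\mathbb R^2$, indexed by $y$ only, that gives it for every $N\ge2$. -/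

import Mathlib

open MeasureTheory ProbabilityTheory
open scoped ENNReal

noncomputable section

namespace EllipticGinibre

/-- Real matrices carry the product (entrywise Borel) σ-algebra. -/
instance instMeasurableSpaceMatrix (m n : Type*) : MeasurableSpace (Matrix m n ℝ) :=
  inferInstanceAs (MeasurableSpace (m → n → ℝ))

/-! ### The real Elliptic Ginibre ensemble -/

/-- The symmetric matrix `H` built from an array `g`: `H i j = g (i, j)` for `j < i`, and
`H i i = √2 * g (i, i)`.  If the entries of `g` are i.i.d. standard Gaussian, then the entries
`H i j`, `j ≤ i`, are independent centred Gaussians of variance `1 + δ_{ij}`. -/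
def symmPart (N : ℕ) (g : Fin N × Fin N → ℝ) : Matrix (Fin N) (Fin N) ℝ :=
  Matrix.of fun i j => if i = j then √2 * g (i, i) else if j < i then g (i, j) else g (j, i)

/-- The antisymmetric matrix `A` built from an array `g`: `A i j = g (i, j)` for `j < i`. -/
def antisymmPart (N : ℕ) (g : Fin N × Fin N → ℝ) : Matrix (Fin N) (Fin N) ℝ :=
  Matrix.of fun i j => if i = j then 0 else if j < i then g (i, j) else -g (j, i)

/-- An `N × N` array of i.i.d. standard real Gaussian variables. -/
def gaussianArray (N : ℕ) : Measure (Fin N × Fin N → ℝ) :=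
  Measure.pi fun _ => gaussianReal 0 1

/-- The law of the `N × N` real Elliptic Ginibre matrix
`(√(1 + τ) H + √(1 - τ) A) / √(2 N)`, where `H` (GOE) and `A` (antisymmetric) are independent. -/
def ensembleLaw (τ : ℝ) (N : ℕ) : Measure (Matrix (Fin N) (Fin N) ℝ) :=
  ((gaussianArray N).prod (gaussianArray N)).map fun g =>
    (1 / √(2 * (N : ℝ))) • (√(1 + τ) • symmPart N g.1 + √(1 - τ) • antisymmPart N g.2)

/-! ### Schur blocks of the non-real eigenvalues -/

/-- `G` is orthogonally similar, by an incomplete real Schur decomposition `G = O M Oᵀ`, to a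
matrix of the form
```
[ x  b | W ]
[ -c x |   ]
[ 0  0 | A₁ ]
```
The size of the matrix is `n + 2`. -/
def HasSchurBlock {n : ℕ} (G : Matrix (Fin (n + 2)) (Fin (n + 2)) ℝ) (x b c : ℝ) : Prop :=
  ∃ O ∈ Matrix.orthogonalGroup (Fin (n + 2)) ℝ, ∃ M : Matrix (Fin (n + 2)) (Fin (n + 2)) ℝ,
    M 0 0 = x ∧ M 0 1 = b ∧ M 1 0 = -c ∧ M 1 1 = x ∧
    (∀ i : Fin (n + 2), 2 ≤ (i : ℕ) → M i 0 = 0 ∧ M i 1 = 0) ∧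
    G = O * M * O.transpose

/-- The triples `(λ, b, c)` where `λ = x + i √(bc)` is an eigenvalue of `G` in the open upper
half-plane and `(b, c)`, normalised by `b ≥ c > 0`, are the off-diagonal parameters of a `2 × 2`
Schur block of `G` with this eigenvalue. (When `λ` is a simple eigenvalue, `(b, c)` is determined
by `G` and `λ`.) -/
def markedEigenvalues {n : ℕ} (G : Matrix (Fin (n + 2)) (Fin (n + 2)) ℝ) : Set (ℂ × ℝ × ℝ) :=
  {p | 0 < p.2.2 ∧ p.2.2 ≤ p.2.1 ∧ p.1.im = √(p.2.1 * p.2.2) ∧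
    HasSchurBlock G p.1.re p.2.1 p.2.2}

/-- The point measure `∑ δ_{(λ, b_λ, c_λ)}`, the sum running over the eigenvalues `λ` of `G` in
the open upper half-plane. -/
def markedSpectrum {n : ℕ} (G : Matrix (Fin (n + 2)) (Fin (n + 2)) ℝ) :
    Measure (ℂ × ℝ × ℝ) :=
  Measure.sum fun p : markedEigenvalues G => Measure.dirac (p : ℂ × ℝ × ℝ)

/-- The intensity measure `E[∑ δ_{(λ, b_λ, c_λ)}]` for the real Elliptic Ginibre matrix of size
`n + 2`.  "Conditionally on `λ` being an eigenvalue" refers to the disintegration of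
this measure along its first coordinate (Palm conditioning). -/
def markedIntensity (τ : ℝ) (n : ℕ) : Measure (ℂ × ℝ × ℝ) :=
  (ensembleLaw τ (n + 2)).bind markedSpectrum

/-! ### The limiting density -/

/-- The complementary error function. -/
def erfc (x : ℝ) : ℝ := 2 / √Real.pi * ∫ t in Set.Ioi x, Real.exp (-t ^ 2)

/-- The normalising constant `Z_{y,τ}`. -/
def normConst (τ y : ℝ) : ℝ :=
  √(Real.pi * (1 - τ ^ 2) / 2) * Real.exp (2 * y ^ 2 / (1 - τ ^ 2)) *
    erfc (√(2 / (1 - τ ^ 2)) * y)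

/-- The density `ρ_{y,τ}`. -/
def deltaDensity (τ y δ : ℝ) : ℝ :=
  if 0 < δ then
    1 / normConst τ y * (δ * Real.exp (-δ ^ 2 / (2 * (1 - τ ^ 2))) / √(δ ^ 2 + 4 * y ^ 2))
  else 0

lemma antitone_erfc : Antitone erfc := by
  intro a b hab
  unfold erfc
  have h : Integrable fun t : ℝ => Real.exp (-t ^ 2) := by
    simpa using integrable_exp_neg_mul_sq (b := 1) one_pos
  refine mul_le_mul_of_nonneg_left ?_ (by positivity)
  refine setIntegral_mono_set h.integrableOn ?_ (Set.Ioi_subset_Ioi hab).eventuallyLE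
  exact Filter.Eventually.of_forall fun t => (Real.exp_pos _).le

lemma measurable_deltaDensity (τ : ℝ) :
    Measurable (Function.uncurry fun y δ => ENNReal.ofReal (deltaDensity τ y δ)) := by
  have he : Measurable erfc := antitone_erfc.measurable
  have hZ : Measurable fun y => normConst τ y := by
    unfold normConst
    exact (measurable_const.mul (by fun_prop)).mul (he.comp (by fun_prop))
  refine Measurable.ennreal_ofReal ?_
  unfold deltaDensity
  refine Measurable.ite (measurableSet_lt measurable_const measurable_snd) ?_ measurable_const
  exact (measurable_const.div (hZ.comp measurable_fst)).mul (by fun_prop)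

/-- The kernel `y ↦ ρ_{y,τ}(δ) dδ`. -/
def deltaKernel (τ : ℝ) : Kernel ℝ ℝ :=
  Kernel.withDensity (Kernel.const ℝ volume) fun y δ => ENNReal.ofReal (deltaDensity τ y δ)

/-- `deltaKernel` is genuinely the kernel with the given density. -/
lemma deltaKernel_apply (τ y : ℝ) :
    deltaKernel τ y = volume.withDensity fun δ => ENNReal.ofReal (deltaDensity τ y δ) := by
  rw [deltaKernel, Kernel.withDensity_apply _ (measurable_deltaDensity τ), Kernel.const_apply]

/-! ### Rescaling the imaginary part -/

/-- The number `y` such that `z = x + i y / √N`, where `N = n + 2`. -/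
def scaledIm (n : ℕ) (z : ℂ) : ℝ := √((n + 2 : ℕ) : ℝ) * z.im

lemma measurable_scaledIm (n : ℕ) : Measurable (scaledIm n) := by
  unfold scaledIm
  exact measurable_const.mul Complex.measurable_im

end EllipticGinibre

end

noncomputable section

namespace EllipticGinibre

-- Parametrise a matrix with an invariant plane by that plane, written as a graph `{(u, T u)}`,
-- together with its block `A` on the plane, its block `D` on the quotient, and the coupling `Q`.
-- This is `graphMap`. Its Jacobian is the determinant of the Sylvester operator `Y ↦ Y A - D Y`, up
-- to a nonzero factor depending on `T` only (`det_graphDeriv`). Outside a null set of matrices `G`,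
-- the triples `(λ, b, c)` of `G` correspond one to one to the regular preimages of `G`
-- (`blockSpectrum_eq_fiberMeasure`). The area formula with multiplicities
-- (`lintegral_mul_fiberMeasure`) therefore turns the intensity into an integral over `(A, Q, T,
-- D)`.
--
-- The ensemble has density proportional to `exp (-a (tr G Gᵀ - τ tr G²))` with `a = N / (2 (1 -
-- τ²))` (`exists_ensembleLaw_eq`), which is invariant under orthogonal conjugation. An orthonormal
-- frame adapted to the plane thus reduces the slice over `T` to the slice over `T = 0`, up to a
-- factor that does not involve the marks (`exists_lintegral_slice_eq_mul`). Integrating over `T`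
-- costs only a constant. This constant is never computed: the total intensity is nonzero, and it is
-- finite because a matrix has at most `N` eigenvalues, so the constant is neither `0` nor `∞`. What
-- remains is an integral over `A` of its own Boltzmann weight times `spectralWeight`, which is
-- invariant under similarity (`spectralWeight_conj`) and hence a function of `λ` alone.
--
-- Now split `A` into `x` times the identity, a traceless symmetric part `(p, q)` of length `r`, and
-- an antisymmetric part `s`. Then `b - c = 2 r`, `b + c = 2 |s|`, and `λ = x + i y` with `y² = s² -
-- r²`. The exponent `tr A Aᵀ - τ tr A²` becomes `2 (1 - τ) x² + 2 (1 + τ) y² + 4 r²`, so the weight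
-- factors into a function of `λ` and `exp (-4 a r²)` (`weight_planeMatrix`). Polar coordinates in
-- `(p, q)` and the substitution `s ↦ y` contribute `r y / √(y² + r²)` (`lintegral_hyperbolic`).
-- Given `λ`, the variable `r` therefore has density proportional to `r exp (-4 a r²) / √(y² + r²)`.
-- Putting `r = δ / (2 √N)` and rescaling `y` by `√N` removes `N` altogether
-- (`deltaDensity_rescaled`). The substitution `s = √(δ² + 4 y²)` evaluates the normalising constant
-- as a Gaussian tail (`lintegral_deltaDensity`). Since `b` and `c` are functions of `δ` and `y`,
-- their joint law follows.

attribute [local instance] Matrix.normedAddCommGroup Matrix.normedSpace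

/-! ### Lebesgue measure on real matrices -/

/-- The topology of real matrices, as the topology of the entrywise supremum norm. -/
abbrev matrixTopology (m n : Type*) [Fintype m] [Fintype n] : TopologicalSpace (Matrix m n ℝ) :=
  (Matrix.normedAddCommGroup (α := ℝ) (m := m) (n := n)).toMetricSpace.toPseudoMetricSpace
    |>.toUniformSpace.toTopologicalSpace

attribute [local instance] matrixTopology

instance instBorelSpaceMatrix (m n : Type*) [Fintype m] [Fintype n] : BorelSpace (Matrix m n ℝ) :=
  inferInstanceAs (BorelSpace (m → n → ℝ))

instance instSecondCountableTopologyMatrix (m n : Type*) [Fintype m] [Fintype n] :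
    SecondCountableTopology (Matrix m n ℝ) :=
  inferInstanceAs (SecondCountableTopology (m → n → ℝ))

instance instPolishSpaceMatrix (m n : Type*) [Fintype m] [Fintype n] :
    PolishSpace (Matrix m n ℝ) :=
  inferInstanceAs (PolishSpace (m → n → ℝ))

instance instMeasureSpaceMatrix (m n : Type*) [Fintype m] [Fintype n] :
    MeasureSpace (Matrix m n ℝ) :=
  @MeasureSpace.mk _ (instMeasurableSpaceMatrix m n) (volume : Measure (m → n → ℝ))

instance instIsAddHaarMeasureMatrix (m n : Type*) [Fintype m] [Fintype n] :
    (volume : Measure (Matrix m n ℝ)).IsAddHaarMeasure :=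
  Measure.pi.isAddHaarMeasure (fun _ : m => (volume : Measure (n → ℝ)))

instance instSigmaFiniteMatrix (m n : Type*) [Fintype m] [Fintype n] :
    SigmaFinite (volume : Measure (Matrix m n ℝ)) :=
  inferInstanceAs (SigmaFinite (volume : Measure (m → n → ℝ)))

instance instIsAddHaarMeasureVolumeProd {G H : Type*} [AddGroup G] [TopologicalSpace G]
    [MeasureSpace G] [MeasurableAdd G] [AddGroup H] [TopologicalSpace H] [MeasureSpace H]
    [MeasurableAdd H] [(volume : Measure G).IsAddHaarMeasure]
    [(volume : Measure H).IsAddHaarMeasure] [SFinite (volume : Measure G)]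
    [SFinite (volume : Measure H)] : (volume : Measure (G × H)).IsAddHaarMeasure :=
  Measure.prod.instIsAddHaarMeasure _ _

/-- A linear equivalence transports Haar measures into each other up to a constant. -/
theorem exists_lintegral_eq_mul_lintegral_linearEquiv {E F : Type*}
    [NormedAddCommGroup E] [NormedSpace ℝ E] [FiniteDimensional ℝ E] [MeasurableSpace E]
    [BorelSpace E] [NormedAddCommGroup F] [NormedSpace ℝ F] [FiniteDimensional ℝ F]
    [MeasurableSpace F] [BorelSpace F] (μ : Measure E) [μ.IsAddHaarMeasure]
    (ν : Measure F) [ν.IsAddHaarMeasure] (L : E ≃ₗ[ℝ] F) :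
    ∃ c : ℝ≥0∞, c ≠ 0 ∧ c ≠ ∞ ∧ ν = c • μ.map L ∧
      ∀ f : F → ℝ≥0∞, ∫⁻ y, f y ∂ν = c * ∫⁻ x, f (L x) ∂μ := by
  have : FiniteDimensional ℝ F := inferInstance
  have hmap : (μ.map L).IsAddHaarMeasure :=
    L.toContinuousLinearEquiv.isAddHaarMeasure_map μ
  have : ProperSpace F := FiniteDimensional.proper ℝ F
  have h := Measure.isAddLeftInvariant_eq_smul ν (μ.map L)
  have hν : ν = (ν.addHaarScalarFactor (μ.map L) : ℝ≥0∞) • μ.map L := by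
    rw [ENNReal.smul_def] at h
    exact h
  refine ⟨_, ?_, ENNReal.coe_ne_top, hν, fun f => ?_⟩
  · exact_mod_cast (Measure.addHaarScalarFactor_pos_of_isAddHaarMeasure ν (μ.map L)).ne'
  · conv_lhs => rw [hν]
    rw [lintegral_smul_measure, smul_eq_mul]
    congr 1
    exact (L.toContinuousLinearEquiv.toHomeomorph.measurableEmbedding.lintegral_map _)

/-! ### The area formula with multiplicities -/

section AreaFormula

variable {E : Type*} [NormedAddCommGroup E] [NormedSpace ℝ E] [FiniteDimensional ℝ E]
  [MeasurableSpace E] [BorelSpace E] {Y : Type*} [MeasurableSpace Y]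

/-- A map with invertible derivatives on a measurable set is injective on each piece of a countable
measurable partition. -/
theorem exists_partition_injOn {f : E → E} {f' : E → E →L[ℝ] E} {s : Set E} (hs : MeasurableSet s)
    (hf' : ∀ x ∈ s, HasFDerivWithinAt f (f' x) s x) (hdet : ∀ x ∈ s, (f' x).det ≠ 0) :
    ∃ t : ℕ → Set E, Pairwise (Function.onFun Disjoint t) ∧ (∀ n, MeasurableSet (t n)) ∧
      ⋃ n, t n = s ∧ ∀ n, Set.InjOn f (t n) := by
  classical
  rcases s.eq_empty_or_nonempty with rfl | hne
  · exact ⟨fun _ => ∅, fun _ _ _ => by simp [Function.onFun], by simp, by simp, by simp⟩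
  -- An error below `‖A⁻¹‖⁻¹` in the approximation by an invertible `A` keeps the map injective,
  -- whence half of that bound. The value `1` is a harmless default when `A` is singular or the
  -- space is trivial.
  let r : (E →L[ℝ] E) → NNReal := fun A =>
    if h : A.det ≠ 0 then
      (if Subsingleton E then 1 else
        ‖((A.toContinuousLinearEquivOfDetNeZero h).symm : E →L[ℝ] E)‖₊⁻¹ / 2)
    else 1
  have hr : ∀ A, r A ≠ 0 := by
    intro A
    simp only [r]
    split_ifs with h1 h2
    · exact one_ne_zero
    · have : Nontrivial E := not_subsingleton_iff_nontrivial.mp h2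
      refine div_ne_zero (inv_ne_zero ?_) two_ne_zero
      exact (A.toContinuousLinearEquivOfDetNeZero h1).nnnorm_symm_pos.ne'
    · exact one_ne_zero
  obtain ⟨t, A, hd, hm, hcov, happ, hA⟩ :=
    exists_partition_approximatesLinearOn_of_hasFDerivWithinAt f s f' hf' r hr
  refine ⟨fun n => s ∩ t n, fun i j hij => ?_, fun n => hs.inter (hm n), ?_, fun n => ?_⟩
  · exact (hd hij).mono Set.inter_subset_right Set.inter_subset_right
  · rw [← Set.inter_iUnion]
    exact Set.inter_eq_left.mpr hcov
  · obtain ⟨y, hy, hAy⟩ := hA hne n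
    -- The linear maps of the partition can be chosen among the actual derivatives at points of `s`,
    -- so they are invertible.
    have hdA : (A n).det ≠ 0 := hAy ▸ hdet y hy
    have h := happ n
    have hcoe : ((A n).toContinuousLinearEquivOfDetNeZero hdA : E →L[ℝ] E) = A n := by ext; simp
    rw [← hcoe] at h
    refine ApproximatesLinearOn.injOn h ?_
    by_cases hE : Subsingleton E
    · exact Or.inl hE
    · right
      have : Nontrivial E := not_subsingleton_iff_nontrivial.mp hE
      rw [hcoe]
      simp only [r, hdA, hE, ne_eq, not_false_eq_true, dite_true, if_false]
      refine NNReal.half_lt_self (inv_ne_zero ?_)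
      exact ((A n).toContinuousLinearEquivOfDetNeZero hdA).nnnorm_symm_pos.ne'

/-- The point measure `∑ δ_{m x}`, the sum running over the points `x` of `s` with `f x = y`. -/
def fiberMeasure (f : E → E) (s : Set E) (m : E → Y) (y : E) : Measure Y :=
  Measure.sum fun x : {x // x ∈ s ∧ f x = y} => Measure.dirac (m x)

/-- On a piece where `f` is injective, `y` has at most one preimage, so the piece contributes `0` or
`1`. Counting preimages becomes a sum of indicators of images, which can be measured and integrated
term by term. -/
theorem fiberMeasure_apply_of_partition {f : E → E} {s : Set E} {m : E → Y} {t : ℕ → Set E}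
    (hd : Pairwise (Function.onFun Disjoint t)) (ht : ⋃ n, t n = s) (hi : ∀ n, Set.InjOn f (t n))
    {B : Set Y} (hB : MeasurableSet B) (y : E) :
    fiberMeasure f s m y B = ∑' n, (f '' (t n ∩ m ⁻¹' B)).indicator 1 y := by
  classical
  rw [fiberMeasure, Measure.sum_apply _ hB]
  simp_rw [Measure.dirac_apply' _ hB]
  have hset : {x | x ∈ s ∧ f x = y} = ⋃ n, {x | x ∈ t n ∧ f x = y} := by
    ext x; rw [← ht]; simp
  have hd' : Pairwise (Function.onFun Disjoint fun n => {x | x ∈ t n ∧ f x = y}) :=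
    fun i j hij => (hd hij).mono (fun x hx => hx.1) (fun x hx => hx.1)
  have key : ∑' x : {x | x ∈ s ∧ f x = y}, B.indicator (1 : Y → ℝ≥0∞) (m x) =
      ∑' n, (f '' (t n ∩ m ⁻¹' B)).indicator 1 y := by
    rw [hset, ENNReal.tsum_biUnion (f := fun x => B.indicator (1 : Y → ℝ≥0∞) (m x))
      (hd'.set_pairwise _)]
    refine tsum_congr fun n => ?_
    by_cases hy : ∃ x ∈ t n, f x = y
    · obtain ⟨x, hx, rfl⟩ := hy
      have hsing : {z | z ∈ t n ∧ f z = f x} = {x} := by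
        ext z
        exact ⟨fun hz => hi n hz.1 hx hz.2, fun hz => by rw [hz]; exact ⟨hx, rfl⟩⟩
      rw [hsing, tsum_singleton x fun x => B.indicator (1 : Y → ℝ≥0∞) (m x)]
      by_cases hB : m x ∈ B
      · rw [Set.indicator_of_mem hB,
          Set.indicator_of_mem (Set.mem_image_of_mem f (Set.mem_inter hx hB))]
        rfl
      · rw [Set.indicator_of_notMem hB, Set.indicator_of_notMem]
        rintro ⟨z, ⟨hz, hzB⟩, hzx⟩
        exact hB (hi n hz hx hzx ▸ hzB)
    · rw [Set.indicator_of_notMem (by rintro ⟨z, hz, hzy⟩; exact hy ⟨z, hz.1, hzy⟩)]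
      exact ENNReal.tsum_eq_zero.mpr fun x => absurd ⟨x, x.2.1, x.2.2⟩ hy
  exact key

/-- A continuous injective image of a Borel set is Borel (Lusin–Souslin), so each indicator in the
count of preimages is measurable. -/
theorem measurable_fiberMeasure {f : E → E} {f' : E → E →L[ℝ] E} {s : Set E} {m : E → Y}
    (hs : MeasurableSet s) (hf : Measurable m) (hf' : ∀ x ∈ s, HasFDerivWithinAt f (f' x) s x)
    (hdet : ∀ x ∈ s, (f' x).det ≠ 0) : Measurable (fiberMeasure f s m) := by
  obtain ⟨t, hd, hm, ht, hi⟩ := exists_partition_injOn hs hf' hdet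
  refine Measure.measurable_of_measurable_coe _ fun B hB => ?_
  simp_rw [fiberMeasure_apply_of_partition hd ht hi hB]
  refine Measurable.tsum fun n => measurable_one.indicator ?_
  have hsub : t n ∩ m ⁻¹' B ⊆ s := Set.inter_subset_left.trans (ht ▸ Set.subset_iUnion t n)
  refine MeasurableSet.image_of_continuousOn_injOn ((hm n).inter (hf hB)) ?_
    ((hi n).mono Set.inter_subset_left)
  exact fun x hx => ((hf' x (hsub hx)).mono hsub).continuousWithinAt

/-- The area formula. -/
theorem lintegral_mul_fiberMeasure (μ : Measure E) [μ.IsAddHaarMeasure]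
    {f : E → E} {f' : E → E →L[ℝ] E} {s : Set E} {m : E → Y}
    (hs : MeasurableSet s) (hf : Measurable m) (hf' : ∀ x ∈ s, HasFDerivWithinAt f (f' x) s x)
    (hdet : ∀ x ∈ s, (f' x).det ≠ 0) {g : E → ℝ≥0∞} (hg : Measurable g) {B : Set Y}
    (hB : MeasurableSet B) :
    ∫⁻ y, g y * fiberMeasure f s m y B ∂μ =
      ∫⁻ x in s ∩ m ⁻¹' B, ENNReal.ofReal |(f' x).det| * g (f x) ∂μ := by
  obtain ⟨t, hd, hm, ht, hi⟩ := exists_partition_injOn hs hf' hdet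
  have hsub : ∀ n, t n ∩ m ⁻¹' B ⊆ s := fun n =>
    Set.inter_subset_left.trans (ht ▸ Set.subset_iUnion t n)
  have him : ∀ n, MeasurableSet (f '' (t n ∩ m ⁻¹' B)) := fun n => by
    refine MeasurableSet.image_of_continuousOn_injOn ((hm n).inter (hf hB)) ?_
      ((hi n).mono Set.inter_subset_left)
    exact fun x hx => ((hf' x (hsub n hx)).mono (hsub n)).continuousWithinAt
  simp_rw [fiberMeasure_apply_of_partition hd ht hi hB, ← ENNReal.tsum_mul_left]
  rw [lintegral_tsum (f := fun n y => g y * (f '' (t n ∩ m ⁻¹' B)).indicator 1 y)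
    fun n => (hg.mul (measurable_one.indicator (him n))).aemeasurable]
  have hU : s ∩ m ⁻¹' B = ⋃ n, t n ∩ m ⁻¹' B := by rw [← ht, Set.iUnion_inter]
  rw [hU, lintegral_iUnion (fun n => (hm n).inter (hf hB))
    (fun i j hij => (hd hij).mono Set.inter_subset_left Set.inter_subset_left)]
  refine tsum_congr fun n => ?_
  rw [← lintegral_image_eq_lintegral_abs_det_fderiv_mul μ ((hm n).inter (hf hB))
    (fun x hx => (hf' x (hsub n hx)).mono (hsub n)) ((hi n).mono Set.inter_subset_left),
    ← lintegral_indicator (him n)]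
  refine lintegral_congr fun y => ?_
  by_cases hy : y ∈ f '' (t n ∩ m ⁻¹' B) <;> simp [hy]

end AreaFormula

/-! ### The graph parametrisation of matrices with an invariant plane -/

section GraphMap

open Matrix

/-- Matrix multiplication as a continuous bilinear map. -/
def mulBilin (l m n : Type*) [Fintype l] [Fintype m] [Fintype n] :
    Matrix l m ℝ →L[ℝ] Matrix m n ℝ →L[ℝ] Matrix l n ℝ :=
  LinearMap.toContinuousBilinearMap (LinearMap.mk₂ ℝ (fun M N => M * N)
    (fun _ _ _ => Matrix.add_mul _ _ _) (fun _ _ _ => Matrix.smul_mul _ _ _)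
    (fun _ _ _ => Matrix.mul_add _ _ _) (fun _ _ _ => Matrix.mul_smul _ _ _))

/-- The map is `S × id` after the shear by `B`. Doubling the first coordinate conjugates the shear
by `B` to the shear by `2 B`, which is its square; its determinant is thus a nonzero number equal to
its own square, namely `1`. -/
theorem det_prod_triangular {V W : Type*} [AddCommGroup V] [Module ℝ V] [FiniteDimensional ℝ V]
    [AddCommGroup W] [Module ℝ W] [FiniteDimensional ℝ W] (S : V →ₗ[ℝ] V) (B : V →ₗ[ℝ] W) :
    LinearMap.det ((S ∘ₗ LinearMap.fst ℝ V W).prod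
      (LinearMap.snd ℝ V W + B ∘ₗ LinearMap.fst ℝ V W)) = LinearMap.det S := by
  let shear : (V →ₗ[ℝ] W) → (V × W →ₗ[ℝ] V × W) := fun C =>
    (LinearMap.fst ℝ V W).prod (LinearMap.snd ℝ V W + C ∘ₗ LinearMap.fst ℝ V W)
  let g : V × W →ₗ[ℝ] V × W := LinearMap.prodMap ((2 : ℝ) • LinearMap.id) LinearMap.id
  have hg : LinearMap.det g ≠ 0 := by
    simp [g, LinearMap.det_prodMap]
  have hadd : ∀ C D, shear C ∘ₗ shear D = shear (C + D) := by
    intro C D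
    ext x <;> simp [shear, add_comm]
  have hone : LinearMap.det (shear 0) = 1 := by
    have : shear 0 = LinearMap.id := by ext x <;> simp [shear]
    rw [this, LinearMap.det_id]
  have hcomm : shear B ∘ₗ g = g ∘ₗ shear (B + B) := by
    ext x <;> simp [shear, g, two_smul]
  have hne : LinearMap.det (shear B) ≠ 0 := by
    intro h
    have := congrArg LinearMap.det (hadd B (-B))
    rw [LinearMap.det_comp, add_neg_cancel, hone, h, zero_mul] at this
    exact zero_ne_one this
  have hdet : LinearMap.det (shear B) = 1 := by
    have h1 := congrArg LinearMap.det hcomm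
    rw [← hadd, LinearMap.det_comp, LinearMap.det_comp, LinearMap.det_comp, mul_comm] at h1
    have h2 := mul_left_cancel₀ hg h1
    exact (mul_left_cancel₀ hne (by rw [mul_one]; exact h2)).symm
  have hfac : (S ∘ₗ LinearMap.fst ℝ V W).prod
      (LinearMap.snd ℝ V W + B ∘ₗ LinearMap.fst ℝ V W) =
      LinearMap.prodMap S LinearMap.id ∘ₗ shear B := by
    ext x <;> simp [shear]
  rw [hfac, LinearMap.det_comp, hdet, LinearMap.det_prodMap, LinearMap.det_id, mul_one, mul_one]

variable {k : Type*} [Fintype k] [DecidableEq k]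

/-- The Sylvester operator `Y ↦ Y A - D Y`. -/
def sylvester (A : Matrix (Fin 2) (Fin 2) ℝ) (D : Matrix k k ℝ) :
    Matrix k (Fin 2) ℝ →ₗ[ℝ] Matrix k (Fin 2) ℝ where
  toFun Y := Y * A - D * Y
  map_add' Y Z := by rw [Matrix.add_mul, Matrix.mul_add]; abel
  map_smul' c Y := by simp [smul_sub]

theorem sylvester_apply (A : Matrix (Fin 2) (Fin 2) ℝ) (D : Matrix k k ℝ)
    (Y : Matrix k (Fin 2) ℝ) : sylvester A D Y = Y * A - D * Y := rfl

/-- The determinant of the Sylvester operator is a similarity invariant. -/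
theorem det_sylvester_conj {A α α' : Matrix (Fin 2) (Fin 2) ℝ} {D γ γ' : Matrix k k ℝ}
    (hα : α * α' = 1) (hγ : γ * γ' = 1) :
    LinearMap.det (sylvester (α * A * α') (γ * D * γ')) = LinearMap.det (sylvester A D) := by
  have hα' : α' * α = 1 := mul_eq_one_comm.mp hα
  have hγ' : γ' * γ = 1 := mul_eq_one_comm.mp hγ
  let e : Matrix k (Fin 2) ℝ ≃ₗ[ℝ] Matrix k (Fin 2) ℝ :=
    { toFun := fun Y => γ * Y * α'
      invFun := fun Y => γ' * Y * α
      map_add' := fun Y Z => by rw [Matrix.mul_add, Matrix.add_mul]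
      map_smul' := fun c Y => by simp
      left_inv := fun Y => by
        calc γ' * (γ * Y * α') * α = (γ' * γ) * Y * (α' * α) := by simp only [Matrix.mul_assoc]
          _ = Y := by rw [hα', hγ', Matrix.one_mul, Matrix.mul_one]
      right_inv := fun Y => by
        calc γ * (γ' * Y * α) * α' = (γ * γ') * Y * (α * α') := by simp only [Matrix.mul_assoc]
          _ = Y := by rw [hα, hγ, Matrix.one_mul, Matrix.mul_one] }
  rw [← LinearMap.det_conj (sylvester A D) e]
  congr 1
  refine LinearMap.ext fun Y => ?_
  change Y * (α * A * α') - γ * D * γ' * Y = γ * (γ' * Y * α * A - D * (γ' * Y * α)) * α'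
  rw [Matrix.mul_sub, Matrix.sub_mul]
  congr 1
  · calc Y * (α * A * α') = (γ * γ') * Y * (α * A * α') := by rw [hγ, Matrix.one_mul]
      _ = _ := by simp only [Matrix.mul_assoc]
  · calc γ * D * γ' * Y = γ * D * γ' * Y * (α * α') := by rw [hα, Matrix.mul_one]
      _ = _ := by simp only [Matrix.mul_assoc]

/-- The lower left block of a matrix. -/
def lowerPart : Matrix (Fin 2 ⊕ k) (Fin 2 ⊕ k) ℝ →ₗ[ℝ] Matrix (Fin 2 ⊕ k) (Fin 2 ⊕ k) ℝ where
  toFun X := fromBlocks 0 0 X.toBlocks₂₁ 0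
  map_add' X Y := by
    rw [fromBlocks_add]; simp; rfl
  map_smul' c X := by
    rw [RingHom.id_apply, fromBlocks_smul]; simp; rfl

theorem lowerPart_fromBlocks (A : Matrix (Fin 2) (Fin 2) ℝ) (Q : Matrix (Fin 2) k ℝ)
    (T : Matrix k (Fin 2) ℝ) (D : Matrix k k ℝ) :
    lowerPart (fromBlocks A Q T D) = fromBlocks 0 0 T 0 := rfl

/-- The matrix with invariant plane `{(u, T u)}`, with blocks `A`, `D` on the plane and on the
quotient; here `A`, `Q`, `T`, `D` are the blocks of the argument. -/
def graphMap (X : Matrix (Fin 2 ⊕ k) (Fin 2 ⊕ k) ℝ) : Matrix (Fin 2 ⊕ k) (Fin 2 ⊕ k) ℝ :=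
  (1 + lowerPart X) * (X - lowerPart X) * (1 - lowerPart X)

theorem graphMap_fromBlocks (A : Matrix (Fin 2) (Fin 2) ℝ) (Q : Matrix (Fin 2) k ℝ)
    (T : Matrix k (Fin 2) ℝ) (D : Matrix k k ℝ) :
    graphMap (fromBlocks A Q T D) =
      fromBlocks 1 0 T 1 * fromBlocks A Q 0 D * fromBlocks 1 0 (-T) 1 := by
  have h1 : (1 : Matrix (Fin 2 ⊕ k) (Fin 2 ⊕ k) ℝ) + fromBlocks 0 0 T 0 = fromBlocks 1 0 T 1 := by
    rw [← fromBlocks_one, fromBlocks_add]; simp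
  have h2 : (1 : Matrix (Fin 2 ⊕ k) (Fin 2 ⊕ k) ℝ) - fromBlocks 0 0 T 0 =
      fromBlocks 1 0 (-T) 1 := by
    rw [sub_eq_add_neg, fromBlocks_neg, ← fromBlocks_one, fromBlocks_add]; simp
  have h3 : fromBlocks A Q T D - fromBlocks 0 0 T 0 = fromBlocks A Q 0 D := by
    rw [sub_eq_add_neg, fromBlocks_neg, fromBlocks_add]; simp
  rw [graphMap, lowerPart_fromBlocks, h1, h2, h3]

/-- Splitting a block matrix into its lower left block and the other three. -/
def splitBlocks (k : Type*) : Matrix (Fin 2 ⊕ k) (Fin 2 ⊕ k) ℝ ≃ₗ[ℝ]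
    Matrix k (Fin 2) ℝ × Matrix (Fin 2) (Fin 2) ℝ × Matrix (Fin 2) k ℝ × Matrix k k ℝ where
  toFun X := (X.toBlocks₂₁, X.toBlocks₁₁, X.toBlocks₁₂, X.toBlocks₂₂)
  invFun p := fromBlocks p.2.1 p.2.2.1 p.1 p.2.2.2
  map_add' _ _ := rfl
  map_smul' _ _ := rfl
  left_inv X := fromBlocks_toBlocks X
  right_inv _ := rfl

/-- The derivative of `graphMap`, conjugated back by the shear `1 + lowerPart X`. -/
def graphDerivCore (X : Matrix (Fin 2 ⊕ k) (Fin 2 ⊕ k) ℝ) :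
    Matrix (Fin 2 ⊕ k) (Fin 2 ⊕ k) ℝ →ₗ[ℝ] Matrix (Fin 2 ⊕ k) (Fin 2 ⊕ k) ℝ :=
  LinearMap.id - lowerPart + LinearMap.mulRight ℝ (X - lowerPart X) ∘ₗ lowerPart -
    LinearMap.mulLeft ℝ (X - lowerPart X) ∘ₗ lowerPart

/-- With the variation `t` of the graph listed first, the operator is block triangular: `t` goes to
`t A - D t`, while the variations of the other three blocks are only translated by terms linear in
`t`. -/
theorem det_graphDerivCore (X : Matrix (Fin 2 ⊕ k) (Fin 2 ⊕ k) ℝ) :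
    LinearMap.det (graphDerivCore X) =
      LinearMap.det (sylvester X.toBlocks₁₁ X.toBlocks₂₂) := by
  obtain ⟨A, Q, T, D, rfl⟩ : ∃ A Q T D, X = fromBlocks A Q T D :=
    ⟨_, _, _, _, (fromBlocks_toBlocks X).symm⟩
  rw [toBlocks_fromBlocks₁₁, toBlocks_fromBlocks₂₂]
  let B : Matrix k (Fin 2) ℝ →ₗ[ℝ]
      Matrix (Fin 2) (Fin 2) ℝ × Matrix (Fin 2) k ℝ × Matrix k k ℝ :=
    { toFun := fun t => (-(Q * t), 0, t * Q)
      map_add' := fun s t => by simp [Matrix.mul_add, Matrix.add_mul, add_comm]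
      map_smul' := fun c t => by simp }
  rw [← det_prod_triangular (sylvester A D) B,
    ← LinearMap.det_conj (graphDerivCore (fromBlocks A Q T D)) (splitBlocks k)]
  congr 1
  refine LinearMap.ext fun ⟨t, a, q, d⟩ => ?_
  have h3 : fromBlocks A Q T D - fromBlocks 0 0 T 0 = fromBlocks A Q 0 D := by
    rw [sub_eq_add_neg, fromBlocks_neg, fromBlocks_add]; simp
  have h4 : graphDerivCore (fromBlocks A Q T D) (fromBlocks a q t d) =
      fromBlocks (a + -(Q * t)) (q + 0) (t * A - D * t) (d + t * Q) := by
    change fromBlocks a q t d - lowerPart (fromBlocks a q t d) +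
      lowerPart (fromBlocks a q t d) * (fromBlocks A Q T D - lowerPart (fromBlocks A Q T D)) -
      (fromBlocks A Q T D - lowerPart (fromBlocks A Q T D)) * lowerPart (fromBlocks a q t d) = _
    rw [lowerPart_fromBlocks, lowerPart_fromBlocks, h3, fromBlocks_multiply, fromBlocks_multiply,
      sub_eq_add_neg, sub_eq_add_neg, fromBlocks_neg, fromBlocks_neg, fromBlocks_add,
      fromBlocks_add, fromBlocks_add]
    simp [sub_eq_add_neg]
  change splitBlocks k (graphDerivCore (fromBlocks A Q T D) (fromBlocks a q t d)) = _
  rw [h4]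
  rfl

/-- Conjugation by the shear `1 + lowerPart X`. -/
def shearConj (X : Matrix (Fin 2 ⊕ k) (Fin 2 ⊕ k) ℝ) :
    Matrix (Fin 2 ⊕ k) (Fin 2 ⊕ k) ℝ →ₗ[ℝ] Matrix (Fin 2 ⊕ k) (Fin 2 ⊕ k) ℝ :=
  LinearMap.mulLeft ℝ (1 + lowerPart X) ∘ₗ LinearMap.mulRight ℝ (1 - lowerPart X)

theorem lowerPart_mul_lowerPart (X Y : Matrix (Fin 2 ⊕ k) (Fin 2 ⊕ k) ℝ) :
    lowerPart X * lowerPart Y = 0 := by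
  change fromBlocks _ _ _ _ * fromBlocks _ _ _ _ = _
  rw [fromBlocks_multiply]
  simp

theorem det_shearConj_ne_zero (X : Matrix (Fin 2 ⊕ k) (Fin 2 ⊕ k) ℝ) :
    LinearMap.det (shearConj X) ≠ 0 := by
  have h : shearConj (-X) ∘ₗ shearConj X = LinearMap.id := by
    refine LinearMap.ext fun G => ?_
    change (1 + lowerPart (-X)) * ((1 + lowerPart X) * (G * (1 - lowerPart X)) *
      (1 - lowerPart (-X))) = G
    have h1 : (1 + lowerPart (-X)) * (1 + lowerPart X) = 1 := by
      rw [map_neg]; noncomm_ring; simp [lowerPart_mul_lowerPart]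
    have h2 : (1 - lowerPart X) * (1 - lowerPart (-X)) = 1 := by
      rw [map_neg]; noncomm_ring; simp [lowerPart_mul_lowerPart]
    calc _ = ((1 + lowerPart (-X)) * (1 + lowerPart X)) * G *
        ((1 - lowerPart X) * (1 - lowerPart (-X))) := by simp only [Matrix.mul_assoc]
      _ = G := by rw [h1, h2, Matrix.one_mul, Matrix.mul_one]
  have h2 := congrArg LinearMap.det h
  rw [LinearMap.det_comp, LinearMap.det_id] at h2
  exact right_ne_zero_of_mul (h2 ▸ one_ne_zero)

/-- The derivative of `graphMap`. -/
def graphDeriv (X : Matrix (Fin 2 ⊕ k) (Fin 2 ⊕ k) ℝ) :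
    Matrix (Fin 2 ⊕ k) (Fin 2 ⊕ k) ℝ →L[ℝ] Matrix (Fin 2 ⊕ k) (Fin 2 ⊕ k) ℝ :=
  LinearMap.toContinuousLinearMap (shearConj X ∘ₗ graphDerivCore X)

theorem det_graphDeriv (X : Matrix (Fin 2 ⊕ k) (Fin 2 ⊕ k) ℝ) :
    (graphDeriv X).det = LinearMap.det (shearConj X) *
      LinearMap.det (sylvester X.toBlocks₁₁ X.toBlocks₂₂) := by
  rw [← det_graphDerivCore, ← LinearMap.det_comp]
  rfl

theorem hasFDerivAt_graphMap (X : Matrix (Fin 2 ⊕ k) (Fin 2 ⊕ k) ℝ) :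
    HasFDerivAt graphMap (graphDeriv X) X := by
  have hl : HasFDerivAt (fun Y : Matrix (Fin 2 ⊕ k) (Fin 2 ⊕ k) ℝ => lowerPart Y)
      (LinearMap.toContinuousLinearMap (lowerPart (k := k))) X :=
    (LinearMap.toContinuousLinearMap (lowerPart (k := k))).hasFDerivAt
  have h1 := hl.const_add 1
  have h2 := (hasFDerivAt_id X).sub hl
  have h3 := hl.const_sub 1
  have h := (mulBilin _ _ _).hasFDerivAt_of_bilinear
    ((mulBilin _ _ _).hasFDerivAt_of_bilinear h1 h2) h3
  refine h.congr_fderiv ?_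
  refine ContinuousLinearMap.ext fun H => ?_
  change ((1 + lowerPart X) * (X - lowerPart X)) * (-lowerPart H) +
    ((1 + lowerPart X) * (H - lowerPart H) + lowerPart H * (X - lowerPart X)) *
      (1 - lowerPart X) =
    (1 + lowerPart X) * ((H - lowerPart H + lowerPart H * (X - lowerPart X) -
      (X - lowerPart X) * lowerPart H) * (1 - lowerPart X))
  -- Lower blocks multiply to zero, so the shears fix `lowerPart H` by multiplication. Inserting
  -- them where needed lets every term of the product rule be written as a conjugation by the shear.
  have e1 : lowerPart H * (1 - lowerPart X) = lowerPart H := by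
    rw [Matrix.mul_sub, lowerPart_mul_lowerPart, Matrix.mul_one, sub_zero]
  have e2 : (1 + lowerPart X) * lowerPart H = lowerPart H := by
    rw [Matrix.add_mul, lowerPart_mul_lowerPart, Matrix.one_mul, add_zero]
  generalize X - lowerPart X = U at *
  generalize 1 + lowerPart X = L at *
  generalize 1 - lowerPart X = R at *
  generalize H - lowerPart H = W at *
  generalize lowerPart H = V at *
  calc L * U * (-V) + (L * W + V * U) * R
      = L * W * R + V * U * R - L * U * V := by noncomm_ring
    _ = L * W * R + (L * V) * U * R - L * U * (V * R) := by rw [e1, e2]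
    _ = L * ((W + V * U - U * V) * R) := by noncomm_ring

end GraphMap

/-! ### Schur blocks of graph planes -/

section Marks

open Matrix

/-- The columns of `α` form an orthonormal basis for the inner product with Gram matrix `M`. They
are obtained by factoring `M = Bᵀ B` through the spectral theorem and inverting `B`. -/
theorem exists_transpose_mul_mul_eq_one {m : Type*} [Fintype m] [DecidableEq m]
    {M : Matrix m m ℝ} (hM : M.PosDef) :
    ∃ α α' : Matrix m m ℝ, α * α' = 1 ∧ αᵀ * M * α = 1 := by
  obtain ⟨B, hB⟩ : ∃ B : Matrix m m ℝ, M = Bᵀ * B := by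
    let U := (hM.1.eigenvectorUnitary : Matrix m m ℝ)
    refine ⟨diagonal (fun i => √(hM.1.eigenvalues i)) * Uᵀ, ?_⟩
    have h := hM.1.spectral_theorem
    rw [Unitary.conjStarAlgAut_apply] at h
    rw [transpose_mul, transpose_transpose, diagonal_transpose, Matrix.mul_assoc,
      ← Matrix.mul_assoc (diagonal _) (diagonal _), diagonal_mul_diagonal, ← Matrix.mul_assoc]
    conv_lhs => rw [h]
    congr 2
    congr 1
    funext i
    simp [Real.mul_self_sqrt (hM.eigenvalues_pos i).le]
  have hu : IsUnit B.det := by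
    have h := hM.det_pos.ne'
    rw [hB, det_mul] at h
    exact (right_ne_zero_of_mul h).isUnit
  refine ⟨B⁻¹, B, nonsing_inv_mul _ hu, ?_⟩
  have h1 : B * B⁻¹ = 1 := mul_nonsing_inv _ hu
  calc B⁻¹ᵀ * M * B⁻¹ = (B * B⁻¹)ᵀ * (B * B⁻¹) := by
        rw [hB, transpose_mul]; simp only [Matrix.mul_assoc]
    _ = 1 := by rw [h1]; simp

/-- `tr² - 4 det`, the discriminant of the characteristic polynomial. -/
def disc (A : Matrix (Fin 2) (Fin 2) ℝ) : ℝ := A.trace ^ 2 - 4 * A.det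

theorem trace_conj {m : Type*} [Fintype m] [DecidableEq m] {A α α' : Matrix m m ℝ}
    (h : α * α' = 1) : (α * A * α').trace = A.trace := by
  rw [trace_mul_comm, ← Matrix.mul_assoc, mul_eq_one_comm.mp h, Matrix.one_mul]

theorem disc_conj {A α α' : Matrix (Fin 2) (Fin 2) ℝ} (h : α * α' = 1) :
    disc (α * A * α') = disc A := by
  rw [disc, disc, trace_conj h, det_conj_of_mul_eq_one h (mul_eq_one_comm.mp h)]

/-- The `2 × 2` Schur block with parameters `x`, `b`, `c`. -/
def schurBlock (x b c : ℝ) : Matrix (Fin 2) (Fin 2) ℝ := !![x, b; -c, x]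

theorem trace_schurBlock (x b c : ℝ) : (schurBlock x b c).trace = 2 * x := by
  simp [schurBlock, trace_fin_two, two_mul]

theorem det_schurBlock (x b c : ℝ) : (schurBlock x b c).det = x ^ 2 + b * c := by
  simp [schurBlock, det_fin_two, sq]

theorem disc_schurBlock (x b c : ℝ) : disc (schurBlock x b c) = -4 * (b * c) := by
  rw [disc, trace_schurBlock, det_schurBlock]; ring

/-- A `2 × 2` matrix with non-real eigenvalues is similar to `!![x, y; -y, x]`. -/
theorem exists_conj_schurBlock_self {A : Matrix (Fin 2) (Fin 2) ℝ} (hA : disc A < 0) :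
    ∃ α α' : Matrix (Fin 2) (Fin 2) ℝ, α * α' = 1 ∧
      A = α * schurBlock (A.trace / 2) √(A.det - (A.trace / 2) ^ 2)
        √(A.det - (A.trace / 2) ^ 2) * α' := by
  have hd : 0 < A.det - (A.trace / 2) ^ 2 := by rw [disc] at hA; linarith
  have hsq := Real.sq_sqrt hd.le
  have hy := Real.sqrt_pos.mpr hd
  set y := √(A.det - (A.trace / 2) ^ 2)
  rw [trace_fin_two, det_fin_two] at hsq
  have hc : A 1 0 ≠ 0 := by
    intro h
    rw [h] at hsq
    nlinarith [sq_nonneg (A 0 0 - A 1 1), sq_nonneg y]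
  set x := A.trace / 2 with hx
  rw [trace_fin_two] at hx
  have h1 : A 1 1 = 2 * x - A 0 0 := by linarith
  -- If the first column of `α` is `e₁`, the relation `A e₁ = x e₁ - y f` forces the second column
  -- to be `f = (x e₁ - A e₁) / y`.
  refine ⟨!![1, -(A 0 0 - x) / y; 0, -A 1 0 / y], !![1, -(A 0 0 - x) / A 1 0; 0, -y / A 1 0],
    ?_, ?_⟩
  · rw [Matrix.mul_fin_two, one_fin_two]
    ext i j
    fin_cases i <;> fin_cases j <;> simp <;> field_simp <;> ring
  · rw [schurBlock, Matrix.mul_fin_two, Matrix.mul_fin_two]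
    conv_lhs => rw [Matrix.eta_fin_two A]
    have hb : A 0 1 * A 1 0 = -y ^ 2 - (A 0 0 - x) ^ 2 := by
      rw [hsq, h1]; ring
    have hb' : A 0 1 = (-y ^ 2 - (A 0 0 - x) ^ 2) / A 1 0 := by
      rw [← hb]; field_simp
    rw [h1, hb']
    ext i j
    fin_cases i <;> fin_cases j <;> simp <;> field_simp <;> ring

/-- A `2 × 2` matrix with non-real eigenvalues is orthogonally similar to a Schur block. -/
theorem exists_orthogonal_conj_schurBlock {A : Matrix (Fin 2) (Fin 2) ℝ} (hA : disc A < 0) :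
    ∃ R : Matrix (Fin 2) (Fin 2) ℝ, R * Rᵀ = 1 ∧ ∃ x b c : ℝ, 0 < c ∧ c ≤ b ∧
      A = R * schurBlock x b c * Rᵀ := by
  rw [disc, trace_fin_two, det_fin_two] at hA
  set x := (A 0 0 + A 1 1) / 2 with hx
  set p := (A 0 0 - A 1 1) / 2 with hp
  set q := (A 0 1 + A 1 0) / 2 with hq
  set s := (A 0 1 - A 1 0) / 2 with hs
  have h00 : A 0 0 = x + p := by rw [hx, hp]; ring
  have h11 : A 1 1 = x - p := by rw [hx, hp]; ring
  have h01 : A 0 1 = q + s := by rw [hq, hs]; ring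
  have h10 : A 1 0 = q - s := by rw [hq, hs]; ring
  have hlt : p ^ 2 + q ^ 2 < s ^ 2 := by rw [h00, h11, h01, h10] at hA; nlinarith
  -- A rotation by an angle `θ` fixes `x` and `s` and turns the traceless symmetric part `(p, q)` by
  -- `2 θ`. The half angle therefore moves `(p, q)` to `(0, r)`.
  have key : ∀ u v : ℝ, ∃ r C S : ℝ, 0 ≤ r ∧ r ^ 2 = u ^ 2 + v ^ 2 ∧ C ^ 2 + S ^ 2 = 1 ∧
      u = -(2 * r * S * C) ∧ v = r * (C ^ 2 - S ^ 2) := by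
    intro u v
    set z : ℂ := ⟨v, -u⟩
    refine ⟨‖z‖, Real.cos (z.arg / 2), Real.sin (z.arg / 2), norm_nonneg _, ?_,
      Real.cos_sq_add_sin_sq _, ?_, ?_⟩
    · rw [Complex.sq_norm, Complex.normSq_apply]; simp only [z]; ring
    · have h := Complex.norm_mul_sin_arg z
      have h2 : Real.sin z.arg = 2 * Real.sin (z.arg / 2) * Real.cos (z.arg / 2) := by
        rw [← Real.sin_two_mul]; ring_nf
      rw [h2] at h
      simp only [z] at h ⊢
      linarith
    · have h := Complex.norm_mul_cos_arg z
      have h2 : Real.cos z.arg = Real.cos (z.arg / 2) ^ 2 - Real.sin (z.arg / 2) ^ 2 := by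
        rw [← Real.cos_two_mul']; ring_nf
      rw [h2] at h
      simp only [z] at h ⊢
      linarith
  have hR : ∀ C S : ℝ, C ^ 2 + S ^ 2 = 1 → !![C, -S; S, C] * !![C, -S; S, C]ᵀ = 1 := by
    intro C S h
    ext i j
    fin_cases i <;> fin_cases j <;> simp [Matrix.mul_apply, Fin.sum_univ_two] <;>
      first | ring1 | linear_combination h
  have hF : ∀ C S : ℝ, C ^ 2 + S ^ 2 = 1 → !![C, S; S, -C] * !![C, S; S, -C]ᵀ = 1 := by
    intro C S h
    ext i j
    fin_cases i <;> fin_cases j <;> simp [Matrix.mul_apply, Fin.sum_univ_two] <;>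
      first | ring1 | linear_combination h
  rcases le_or_gt 0 s with hs0 | hs0
  · obtain ⟨r, C, S, hr, hr2, h1, hu, hv⟩ := key p q
    have hrs : r < s := by nlinarith
    refine ⟨_, hR C S h1, x, s + r, s - r, by linarith, by linarith, ?_⟩
    have hC : C ^ 2 = 1 - S ^ 2 := by linarith
    rw [Matrix.eta_fin_two A, h00, h01, h10, h11, hu, hv]
    ext i j
    fin_cases i <;> fin_cases j <;>
      simp [schurBlock, Matrix.mul_apply, Fin.sum_univ_two] <;> ring_nf <;>
      (try simp only [hC]) <;> ring_nf
  -- When `s < 0` a reflection is used instead, since it reverses the sign of the antisymmetric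
  -- part.
  · obtain ⟨r, C, S, hr, hr2, h1, hu, hv⟩ := key (-p) (-q)
    have hrs : r < -s := by nlinarith
    refine ⟨_, hF C S h1, x, -s + r, -s - r, by linarith, by linarith, ?_⟩
    have hC : C ^ 2 = 1 - S ^ 2 := by linarith
    have hu' : p = 2 * r * S * C := by linarith
    have hv' : q = -(r * (C ^ 2 - S ^ 2)) := by linarith
    rw [Matrix.eta_fin_two A, h00, h01, h10, h11, hu', hv']
    ext i j
    fin_cases i <;> fin_cases j <;>
      simp [schurBlock, Matrix.mul_apply, Fin.sum_univ_two] <;> ring_nf <;>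
      (try simp only [hC]) <;> ring_nf

variable {k : Type*} [Fintype k] [DecidableEq k]

/-- The eigenvalue and the Schur parameters of the operator `A` on the plane `{(u, T u)}`. -/
def markOf (T : Matrix k (Fin 2) ℝ) (A : Matrix (Fin 2) (Fin 2) ℝ) : ℂ × ℝ × ℝ :=
  -- The plane carries the inner product with Gram matrix `M = 1 + Tᵀ T`, for which the adjoint of
  -- `A` is `M⁻¹ Aᵀ M`. The trace in `F` is then the squared Frobenius norm of `A` in an orthonormal
  -- frame, `2 x² + b² + c²`. Since `d = b c`, the quantities `F ± 2 d` are `(b ± c)²`.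
  let d := A.det - (A.trace / 2) ^ 2
  let F := ((1 + Tᵀ * T) * A * (1 + Tᵀ * T)⁻¹ * Aᵀ).trace - 2 * (A.trace / 2) ^ 2
  (⟨A.trace / 2, √d⟩, (√(F + 2 * d) + √(F - 2 * d)) / 2, (√(F + 2 * d) - √(F - 2 * d)) / 2)

/-- The condition on `α` says that its columns are orthonormal for the inner product of the graph
plane. In such a frame the metric disappears from the formula, and trace and determinant are
similarity invariants. -/
theorem markOf_conj {T : Matrix k (Fin 2) ℝ} {A α α' : Matrix (Fin 2) (Fin 2) ℝ}
    (h : α * α' = 1) (hT : αᵀ * (1 + Tᵀ * T) * α = 1) :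
    markOf T (α * A * α') = markOf (0 : Matrix k (Fin 2) ℝ) A := by
  have h' : α' * α = 1 := mul_eq_one_comm.mp h
  have hinv : (1 + Tᵀ * T)⁻¹ = α * αᵀ := by
    refine inv_eq_left_inv ?_
    rw [Matrix.mul_assoc]
    exact mul_eq_one_comm.mp hT
  have htr : ((1 + Tᵀ * T) * (α * A * α') * (1 + Tᵀ * T)⁻¹ * (α * A * α')ᵀ).trace =
      (A * Aᵀ).trace := by
    have hαt : αᵀ * α'ᵀ = 1 := by rw [← transpose_mul, h', transpose_one]
    rw [hinv, transpose_mul, transpose_mul]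
    calc ((1 + Tᵀ * T) * (α * A * α') * (α * αᵀ) * (α'ᵀ * (Aᵀ * αᵀ))).trace
        = ((1 + Tᵀ * T) * α * A * (α' * α) * (αᵀ * α'ᵀ) * Aᵀ * αᵀ).trace := by
          simp only [Matrix.mul_assoc]
      _ = (αᵀ * ((1 + Tᵀ * T) * α * A * Aᵀ)).trace := by
          rw [h', hαt, Matrix.mul_one, Matrix.mul_one, trace_mul_comm]
      _ = ((αᵀ * (1 + Tᵀ * T) * α) * (A * Aᵀ)).trace := by simp only [Matrix.mul_assoc]
      _ = _ := by rw [hT, Matrix.one_mul]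
  have h0 : ((1 + (0 : Matrix k (Fin 2) ℝ)ᵀ * (0 : Matrix k (Fin 2) ℝ)) * A *
      (1 + (0 : Matrix k (Fin 2) ℝ)ᵀ * (0 : Matrix k (Fin 2) ℝ))⁻¹ * Aᵀ).trace =
      (A * Aᵀ).trace := by simp
  simp only [markOf, htr, h0, trace_conj h, det_conj_of_mul_eq_one h h']

theorem markOf_zero_schurBlock {x b c : ℝ} (hc : 0 < c) (hcb : c ≤ b) :
    markOf (0 : Matrix k (Fin 2) ℝ) (schurBlock x b c) = (⟨x, √(b * c)⟩, b, c) := by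
  have h0 : ((1 + (0 : Matrix k (Fin 2) ℝ)ᵀ * (0 : Matrix k (Fin 2) ℝ)) * schurBlock x b c *
      (1 + (0 : Matrix k (Fin 2) ℝ)ᵀ * (0 : Matrix k (Fin 2) ℝ))⁻¹ * (schurBlock x b c)ᵀ).trace =
      2 * x ^ 2 + b ^ 2 + c ^ 2 := by
    simp only [transpose_zero, Matrix.zero_mul, add_zero, Matrix.one_mul, inv_one, Matrix.mul_one]
    rw [trace_fin_two, Matrix.mul_apply, Matrix.mul_apply, Fin.sum_univ_two, Fin.sum_univ_two]
    simp [schurBlock]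
    ring
  have hx : 2 * x / 2 = x := by ring
  have hd : x ^ 2 + b * c - x ^ 2 = b * c := by ring
  have hp : √(2 * x ^ 2 + b ^ 2 + c ^ 2 - 2 * x ^ 2 + 2 * (b * c)) = b + c := by
    rw [show 2 * x ^ 2 + b ^ 2 + c ^ 2 - 2 * x ^ 2 + 2 * (b * c) = (b + c) ^ 2 by ring,
      Real.sqrt_sq (by linarith)]
  have hm : √(2 * x ^ 2 + b ^ 2 + c ^ 2 - 2 * x ^ 2 - 2 * (b * c)) = b - c := by
    rw [show 2 * x ^ 2 + b ^ 2 + c ^ 2 - 2 * x ^ 2 - 2 * (b * c) = (b - c) ^ 2 by ring,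
      Real.sqrt_sq (by linarith)]
  simp only [markOf, h0, trace_schurBlock, det_schurBlock, hx, hd, hp, hm]
  congr 2 <;> ring

theorem measurable_markOf : Measurable fun p : Matrix k (Fin 2) ℝ × Matrix (Fin 2) (Fin 2) ℝ =>
    markOf p.1 p.2 := by
  have he : ∀ i j, Measurable fun A : Matrix (Fin 2) (Fin 2) ℝ => A i j := fun i j =>
    (measurable_pi_apply j).comp (measurable_pi_apply i)
  have hT : ∀ i j, Measurable fun A : Matrix k (Fin 2) ℝ => A i j := fun i j =>
    (measurable_pi_apply j).comp (measurable_pi_apply i)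
  have htr : Measurable fun p : Matrix k (Fin 2) ℝ × Matrix (Fin 2) (Fin 2) ℝ => p.2.trace := by
    simp only [trace_fin_two]
    exact ((he 0 0).comp measurable_snd).add ((he 1 1).comp measurable_snd)
  have hdet : Measurable fun p : Matrix k (Fin 2) ℝ × Matrix (Fin 2) (Fin 2) ℝ => p.2.det := by
    simp only [det_fin_two]
    exact (((he 0 0).comp measurable_snd).mul ((he 1 1).comp measurable_snd)).sub
      (((he 0 1).comp measurable_snd).mul ((he 1 0).comp measurable_snd))
  have hM : ∀ i j, Measurable fun p : Matrix k (Fin 2) ℝ × Matrix (Fin 2) (Fin 2) ℝ =>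
      (1 + p.1ᵀ * p.1 : Matrix (Fin 2) (Fin 2) ℝ) i j := by
    intro i j
    simp only [Matrix.add_apply, Matrix.mul_apply, transpose_apply]
    exact measurable_const.add (Finset.measurable_sum _ fun l _ =>
      ((hT l i).comp measurable_fst).mul ((hT l j).comp measurable_fst))
  have hdM : Measurable fun p : Matrix k (Fin 2) ℝ × Matrix (Fin 2) (Fin 2) ℝ =>
      ((1 + p.1ᵀ * p.1).det)⁻¹ := by
    simp only [det_fin_two]
    exact (((hM 0 0).mul (hM 1 1)).sub ((hM 0 1).mul (hM 1 0))).inv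
  have hI : ∀ i j, Measurable fun p : Matrix k (Fin 2) ℝ × Matrix (Fin 2) (Fin 2) ℝ =>
      ((1 + p.1ᵀ * p.1)⁻¹ : Matrix (Fin 2) (Fin 2) ℝ) i j := by
    intro i j
    simp only [Matrix.inv_def, Ring.inverse_eq_inv', Matrix.smul_apply, smul_eq_mul,
      adjugate_fin_two]
    refine hdM.mul ?_
    fin_cases i <;> fin_cases j
    · exact hM 1 1
    · exact (hM 0 1).neg
    · exact (hM 1 0).neg
    · exact hM 0 0
  have hF : Measurable fun p : Matrix k (Fin 2) ℝ × Matrix (Fin 2) (Fin 2) ℝ =>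
      ((1 + p.1ᵀ * p.1) * p.2 * (1 + p.1ᵀ * p.1)⁻¹ * p.2ᵀ).trace := by
    have he' := fun i j => (he i j).comp
      (measurable_snd : Measurable (Prod.snd : Matrix k (Fin 2) ℝ × Matrix (Fin 2) (Fin 2) ℝ → _))
    simp only [Function.comp_def] at he'
    have hgen : ∀ M B C : Matrix (Fin 2) (Fin 2) ℝ, (M * B * C * Bᵀ).trace =
        ∑ i, ∑ j, (∑ l, (∑ m, M i m * B m l) * C l j) * B i j := fun M B C => by
      simp only [trace, diag_apply, Matrix.mul_apply, transpose_apply]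
    simp only [hgen]
    exact Finset.measurable_sum _ fun i _ => Finset.measurable_sum _ fun j _ =>
      (Finset.measurable_sum _ fun l _ => (Finset.measurable_sum _ fun m _ =>
        (hM i m).mul (he' m l)).mul (hI l j)).mul (he' i j)
  have hd := hdet.sub ((htr.div_const 2).pow_const 2)
  have hF' := hF.sub (((htr.div_const 2).pow_const 2).const_mul 2)
  have hp := (hF'.add (hd.const_mul 2)).sqrt
  have hm := (hF'.sub (hd.const_mul 2)).sqrt
  refine Measurable.prodMk ?_ (((hp.add hm).div_const 2).prodMk ((hp.sub hm).div_const 2))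
  exact Complex.equivRealProdCLM.symm.continuous.measurable.comp ((htr.div_const 2).prodMk hd.sqrt)

/-- An orthonormal frame adapted to the plane `{(u, T u)}`. -/
theorem exists_orthogonal_frame (T : Matrix k (Fin 2) ℝ) :
    ∃ (α α' : Matrix (Fin 2) (Fin 2) ℝ) (β : Matrix (Fin 2) k ℝ) (δ δ' : Matrix k k ℝ),
      α * α' = 1 ∧ δ * δ' = 1 ∧ αᵀ * (1 + Tᵀ * T) * α = 1 ∧
      fromBlocks 1 0 T 1 * fromBlocks α β 0 δ ∈ orthogonalGroup (Fin 2 ⊕ k) ℝ := by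
  have h1 : (1 + Tᵀ * T).PosDef :=
    PosDef.one.add_posSemidef (by simpa using posSemidef_conjTranspose_mul_self T)
  have h2 : (1 + T * Tᵀ).PosDef :=
    PosDef.one.add_posSemidef (by simpa using posSemidef_self_mul_conjTranspose T)
  obtain ⟨α, α', hα, hαT⟩ := exists_transpose_mul_mul_eq_one h1
  obtain ⟨γ, γ', hγ, hγT⟩ := exists_transpose_mul_mul_eq_one h2
  -- The orthogonal complement of `{(u, T u)}` is `{(-Tᵀ v, v)}`, with Gram matrix `1 + T Tᵀ`, which
  -- `γ` orthonormalises. Removing the shear from these columns adds `T Tᵀ γ` to their lower block.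
  refine ⟨α, α', -(Tᵀ * γ), (1 + T * Tᵀ) * γ, γᵀ, hα, ?_, hαT, ?_⟩
  · rw [Matrix.mul_assoc] at hγT
    exact mul_eq_one_comm.mp hγT
  · have hO : fromBlocks 1 0 T 1 * fromBlocks α (-(Tᵀ * γ)) 0 ((1 + T * Tᵀ) * γ) =
        fromBlocks α (-(Tᵀ * γ)) (T * α) γ := by
      rw [fromBlocks_multiply]
      congr 1 <;> simp [Matrix.add_mul, Matrix.mul_assoc]
    rw [hO, mem_orthogonalGroup_iff', fromBlocks_transpose, fromBlocks_multiply, ← fromBlocks_one]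
    congr 1
    · rw [← hαT]; simp [Matrix.mul_add, Matrix.add_mul, Matrix.mul_assoc]
    · simp [Matrix.mul_assoc]
    · simp [Matrix.mul_assoc]
    · rw [← hγT]; simp [Matrix.mul_add, Matrix.add_mul, Matrix.mul_assoc, add_comm]

end Marks

/-! ### Marked eigenvalues in block form -/

section BlockMarks

open Matrix

variable {k : Type*} [Fintype k] [DecidableEq k]

/-- `HasSchurBlock` for matrices indexed by `Fin 2 ⊕ k`. -/
def BlockSchur (G : Matrix (Fin 2 ⊕ k) (Fin 2 ⊕ k) ℝ) (x b c : ℝ) : Prop :=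
  ∃ O ∈ orthogonalGroup (Fin 2 ⊕ k) ℝ, ∃ (Q : Matrix (Fin 2) k ℝ) (D : Matrix k k ℝ),
    G = O * fromBlocks (schurBlock x b c) Q 0 D * Oᵀ

/-- `markedEigenvalues` for matrices indexed by `Fin 2 ⊕ k`. -/
def blockMarks (G : Matrix (Fin 2 ⊕ k) (Fin 2 ⊕ k) ℝ) : Set (ℂ × ℝ × ℝ) :=
  {p | 0 < p.2.2 ∧ p.2.2 ≤ p.2.1 ∧ p.1.im = √(p.2.1 * p.2.2) ∧ BlockSchur G p.1.re p.2.1 p.2.2}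

theorem shear_mul_shear_neg (T : Matrix k (Fin 2) ℝ) :
    fromBlocks (1 : Matrix (Fin 2) (Fin 2) ℝ) 0 T (1 : Matrix k k ℝ) *
      fromBlocks 1 0 (-T) 1 = 1 := by
  rw [fromBlocks_multiply, ← fromBlocks_one]; simp

theorem upper_mul_upper_inv {α α' : Matrix (Fin 2) (Fin 2) ℝ} {β : Matrix (Fin 2) k ℝ}
    {δ δ' : Matrix k k ℝ} (hα : α * α' = 1) (hδ : δ * δ' = 1) :
    fromBlocks α β 0 δ * fromBlocks α' (-(α' * β * δ')) 0 δ' = 1 := by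
  rw [fromBlocks_multiply, ← fromBlocks_one]
  congr 1
  · simp [hα]
  · rw [Matrix.mul_neg, ← Matrix.mul_assoc, ← Matrix.mul_assoc, hα, Matrix.one_mul,
      neg_add_cancel]
  · simp
  · simp [hδ]

/-- In an orthonormal frame adapted to the plane, `graphMap` is an orthogonal conjugation. -/
theorem graphMap_eq_orthogonal_conj {T : Matrix k (Fin 2) ℝ} {A : Matrix (Fin 2) (Fin 2) ℝ}
    {Q : Matrix (Fin 2) k ℝ} {D : Matrix k k ℝ} {U U' Y : Matrix (Fin 2 ⊕ k) (Fin 2 ⊕ k) ℝ}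
    (hU : U * U' = 1) (hO : fromBlocks 1 0 T 1 * U ∈ orthogonalGroup (Fin 2 ⊕ k) ℝ)
    (hY : fromBlocks A Q 0 D = U * Y * U') :
    graphMap (fromBlocks A Q T D) =
      (fromBlocks 1 0 T 1 * U) * Y * (fromBlocks 1 0 T 1 * U)ᵀ := by
  have h1 : (fromBlocks 1 0 T 1 * U)ᵀ = U' * fromBlocks 1 0 (-T) 1 := by
    have h2 : (fromBlocks 1 0 T 1 * U)ᵀ * (fromBlocks 1 0 T 1 * U) = 1 :=
      (mem_orthogonalGroup_iff' _ _).mp hO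
    have h3 : (fromBlocks 1 0 T 1 * U) * (U' * fromBlocks 1 0 (-T) 1) = 1 := by
      calc _ = fromBlocks 1 0 T 1 * (U * U') * fromBlocks 1 0 (-T) 1 := by
            simp only [Matrix.mul_assoc]
        _ = 1 := by rw [hU, Matrix.mul_one, shear_mul_shear_neg]
    exact left_inv_eq_right_inv h2 h3
  rw [graphMap_fromBlocks, h1, hY]
  simp only [Matrix.mul_assoc]

/-- In an orthonormal frame of the graph plane the operator `A` is orthogonally similar to a Schur
block. Rotating the frame inside the plane accordingly gives the orthogonal matrix of a Schur
decomposition. -/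
theorem markOf_mem_blockMarks {T : Matrix k (Fin 2) ℝ} {A : Matrix (Fin 2) (Fin 2) ℝ}
    (Q : Matrix (Fin 2) k ℝ) (D : Matrix k k ℝ) (hA : disc A < 0) :
    markOf T A ∈ blockMarks (graphMap (fromBlocks A Q T D)) := by
  obtain ⟨α, α', β, δ, δ', hα, hδ, hαT, hO⟩ := exists_orthogonal_frame T
  have hα' : α' * α = 1 := mul_eq_one_comm.mp hα
  obtain ⟨R, hR, x, b, c, hc, hcb, hS⟩ := exists_orthogonal_conj_schurBlock
    (A := α' * A * α) (by rwa [disc_conj hα'])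
  have hR' : Rᵀ * R = 1 := mul_eq_one_comm.mp hR
  have hαR : (α * R) * (Rᵀ * α') = 1 := by
    calc (α * R) * (Rᵀ * α') = α * (R * Rᵀ) * α' := by simp only [Matrix.mul_assoc]
      _ = 1 := by rw [hR, Matrix.mul_one, hα]
  have hA' : A = (α * R) * schurBlock x b c * (Rᵀ * α') := by
    calc A = (α * α') * A * (α * α') := by rw [hα, Matrix.one_mul, Matrix.mul_one]
      _ = α * (α' * A * α) * α' := by simp only [Matrix.mul_assoc]
      _ = _ := by rw [hS]; simp only [Matrix.mul_assoc]
  have hαRT : (α * R)ᵀ * (1 + Tᵀ * T) * (α * R) = 1 := by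
    calc _ = Rᵀ * (αᵀ * (1 + Tᵀ * T) * α) * R := by
          rw [transpose_mul]; simp only [Matrix.mul_assoc]
      _ = 1 := by rw [hαT, Matrix.mul_one, hR']
  have hV : fromBlocks R 0 0 (1 : Matrix k k ℝ) ∈ orthogonalGroup (Fin 2 ⊕ k) ℝ := by
    rw [mem_orthogonalGroup_iff', fromBlocks_transpose, fromBlocks_multiply, ← fromBlocks_one]
    simp [hR']
  have hU : fromBlocks α β 0 δ * fromBlocks R 0 0 1 = fromBlocks (α * R) β 0 δ := by
    rw [fromBlocks_multiply]; simp
  have hO' : fromBlocks 1 0 T 1 * fromBlocks (α * R) β 0 δ ∈ orthogonalGroup (Fin 2 ⊕ k) ℝ := by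
    rw [← hU, ← Matrix.mul_assoc]
    exact mul_mem hO hV
  have hinv := upper_mul_upper_inv (β := β) hαR hδ
  have hY : fromBlocks A Q 0 D = fromBlocks (α * R) β 0 δ *
      (fromBlocks (Rᵀ * α') (-(Rᵀ * α' * β * δ')) 0 δ' * fromBlocks A Q 0 D *
        fromBlocks (α * R) β 0 δ) * fromBlocks (Rᵀ * α') (-(Rᵀ * α' * β * δ')) 0 δ' := by
    calc fromBlocks A Q 0 D = 1 * fromBlocks A Q 0 D * 1 := by
          rw [Matrix.one_mul, Matrix.mul_one]
      _ = _ := by rw [← hinv]; simp only [Matrix.mul_assoc]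
  have hS' : (Rᵀ * α') * A * (α * R) = schurBlock x b c := by
    have hRα : (Rᵀ * α') * (α * R) = 1 := mul_eq_one_comm.mp hαR
    calc (Rᵀ * α') * A * (α * R) =
          ((Rᵀ * α') * (α * R)) * schurBlock x b c * ((Rᵀ * α') * (α * R)) := by
          conv_lhs => rw [hA']
          simp only [Matrix.mul_assoc]
      _ = _ := by rw [hRα, Matrix.one_mul, Matrix.mul_one]
  rw [hA', markOf_conj hαR hαRT, markOf_zero_schurBlock hc hcb, ← hA']
  obtain ⟨Q', D', hQD⟩ : ∃ Q' D', fromBlocks (Rᵀ * α') (-(Rᵀ * α' * β * δ')) 0 δ' *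
      fromBlocks A Q 0 D * fromBlocks (α * R) β 0 δ = fromBlocks (schurBlock x b c) Q' 0 D' := by
    rw [fromBlocks_multiply, fromBlocks_multiply]
    simp only [Matrix.mul_zero, Matrix.zero_mul, add_zero, zero_add, hS']
    exact ⟨_, _, rfl⟩
  rw [hQD] at hY
  exact ⟨hc, hcb, rfl, _, hO', Q', D', graphMap_eq_orthogonal_conj hinv hO' hY⟩

/-- A Schur decomposition whose plane is the graph of `T` comes from `graphMap`. -/
theorem exists_graphMap_eq_of_orthogonal {a : Matrix (Fin 2) (Fin 2) ℝ} {b : Matrix (Fin 2) k ℝ}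
    {c : Matrix k (Fin 2) ℝ} {d : Matrix k k ℝ} (hO : fromBlocks a b c d ∈ orthogonalGroup _ ℝ)
    (ha : a.det ≠ 0) (S : Matrix (Fin 2) (Fin 2) ℝ) (Q : Matrix (Fin 2) k ℝ) (D : Matrix k k ℝ) :
    ∃ Q' D', graphMap (fromBlocks (a * S * a⁻¹) Q' (c * a⁻¹) D') =
        fromBlocks a b c d * fromBlocks S Q 0 D * (fromBlocks a b c d)ᵀ ∧
      markOf (c * a⁻¹) (a * S * a⁻¹) = markOf (0 : Matrix k (Fin 2) ℝ) S := by
  have haa : a * a⁻¹ = 1 := mul_nonsing_inv _ ha.isUnit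
  have haa' : a⁻¹ * a = 1 := nonsing_inv_mul _ ha.isUnit
  -- Block LU factorisation: the first two columns of the orthogonal matrix span the graph of `c
  -- a⁻¹`, and the remaining factor is block triangular with the Schur complement in its corner.
  have hL : fromBlocks 1 0 (c * a⁻¹) 1 * fromBlocks a b 0 (d - c * a⁻¹ * b) =
      fromBlocks a b c d := by
    rw [fromBlocks_multiply]
    congr 1
    · simp
    · simp
    · rw [Matrix.mul_assoc, haa']; simp
    · simp
  have hdet : (d - c * a⁻¹ * b).det ≠ 0 := by
    intro h
    have h1 := congrArg det ((mem_orthogonalGroup_iff' _ _).mp hO)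
    change ((fromBlocks a b c d)ᵀ * fromBlocks a b c d).det = _ at h1
    rw [det_mul, ← hL, det_mul, det_fromBlocks_zero₂₁ a, h, det_one] at h1
    simp at h1
  have hδ : (d - c * a⁻¹ * b) * (d - c * a⁻¹ * b)⁻¹ = 1 := mul_nonsing_inv _ hdet.isUnit
  generalize d - c * a⁻¹ * b = δ at *
  have hU := upper_mul_upper_inv (β := b) haa hδ
  have hO' := hO
  rw [← hL] at hO'
  obtain ⟨Q', hQ'⟩ : ∃ Q', fromBlocks (a * S * a⁻¹) Q' 0 (δ * D * δ⁻¹) =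
      fromBlocks a b 0 δ * fromBlocks S Q 0 D * fromBlocks a⁻¹ (-(a⁻¹ * b * δ⁻¹)) 0 δ⁻¹ := by
    rw [fromBlocks_multiply, fromBlocks_multiply]
    simp only [Matrix.mul_zero, Matrix.zero_mul, add_zero, zero_add]
    exact ⟨_, rfl⟩
  refine ⟨Q', δ * D * δ⁻¹, ?_, markOf_conj haa ?_⟩
  · rw [graphMap_eq_orthogonal_conj hU hO' hQ', hL]
  · have h1 := (mem_orthogonalGroup_iff' _ _).mp hO
    change (fromBlocks a b c d)ᵀ * fromBlocks a b c d = _ at h1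
    rw [fromBlocks_transpose, fromBlocks_multiply, ← fromBlocks_one] at h1
    have h2 := (fromBlocks_inj.mp h1).1
    calc aᵀ * (1 + (c * a⁻¹)ᵀ * (c * a⁻¹)) * a
        = aᵀ * a + (a⁻¹ * a)ᵀ * cᵀ * c * (a⁻¹ * a) := by
          rw [transpose_mul, transpose_mul, Matrix.mul_add, Matrix.add_mul]
          simp only [Matrix.mul_assoc, Matrix.mul_one]
      _ = 1 := by rw [haa', transpose_one, Matrix.one_mul, Matrix.mul_one, h2]

/-- An eigenvalue at which the Sylvester operator is invertible determines the plane. -/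
theorem eq_of_graphMap_eq {X X' : Matrix (Fin 2 ⊕ k) (Fin 2 ⊕ k) ℝ}
    (h : graphMap X = graphMap X') (hX : disc X.toBlocks₁₁ < 0) (hX' : disc X'.toBlocks₁₁ < 0)
    (hs : LinearMap.det (sylvester X.toBlocks₁₁ X.toBlocks₂₂) ≠ 0)
    (hm : (markOf X.toBlocks₂₁ X.toBlocks₁₁).1 = (markOf X'.toBlocks₂₁ X'.toBlocks₁₁).1) :
    X = X' := by
  obtain ⟨A, Q, T, D, rfl⟩ : ∃ A Q T D, X = fromBlocks A Q T D :=
    ⟨_, _, _, _, (fromBlocks_toBlocks X).symm⟩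
  obtain ⟨A', Q', T', D', rfl⟩ : ∃ A Q T D, X' = fromBlocks A Q T D :=
    ⟨_, _, _, _, (fromBlocks_toBlocks X').symm⟩
  simp only [toBlocks_fromBlocks₁₁, toBlocks_fromBlocks₂₁, toBlocks_fromBlocks₂₂, markOf,
    Complex.mk.injEq] at *
  obtain ⟨α, α', hα, hAα⟩ := exists_conj_schurBlock_self hX
  obtain ⟨γ, γ', hγ, hAγ⟩ := exists_conj_schurBlock_self hX'
  have h1 : (1 : Matrix k k ℝ) * 1 = 1 := Matrix.one_mul 1
  -- Equal eigenvalues make `A` and `A'` similar to the same Schur block, and the Sylvester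
  -- determinant only sees the similarity class.
  have hs' : LinearMap.det (sylvester A' D) ≠ 0 := by
    rw [hAγ, ← hm.2, ← hm.1, ← Matrix.mul_one D, ← Matrix.one_mul D, det_sylvester_conj hγ h1]
    rwa [hAα, ← Matrix.mul_one D, ← Matrix.one_mul D, det_sylvester_conj hα h1] at hs
  rw [graphMap_fromBlocks, graphMap_fromBlocks] at h
  have hneg : ∀ S : Matrix k (Fin 2) ℝ,
      fromBlocks (1 : Matrix (Fin 2) (Fin 2) ℝ) 0 (-S) 1 * fromBlocks 1 0 S 1 =
        (1 : Matrix (Fin 2 ⊕ k) (Fin 2 ⊕ k) ℝ) := fun S => by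
    simpa using shear_mul_shear_neg (-S)
  have hTT : fromBlocks (1 : Matrix (Fin 2) (Fin 2) ℝ) 0 (-T) (1 : Matrix k k ℝ) *
      fromBlocks 1 0 T' 1 =
      fromBlocks 1 0 (T' - T) 1 := by
    rw [fromBlocks_multiply]; simp [sub_eq_neg_add]
  have h2 : fromBlocks A Q 0 D * fromBlocks 1 0 (T' - T) 1 =
      fromBlocks 1 0 (T' - T) 1 * fromBlocks A' Q' 0 D' := by
    rw [← hTT]
    have e1 := hneg T
    have e2 := hneg T'
    generalize fromBlocks (1 : Matrix (Fin 2) (Fin 2) ℝ) 0 (-T) (1 : Matrix k k ℝ) = L1 at *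
    generalize fromBlocks (1 : Matrix (Fin 2) (Fin 2) ℝ) 0 (-T') (1 : Matrix k k ℝ) = L1' at *
    generalize fromBlocks (1 : Matrix (Fin 2) (Fin 2) ℝ) 0 T (1 : Matrix k k ℝ) = L at *
    generalize fromBlocks (1 : Matrix (Fin 2) (Fin 2) ℝ) 0 T' (1 : Matrix k k ℝ) = L' at *
    calc fromBlocks A Q 0 D * (L1 * L') = (L1 * L) * fromBlocks A Q 0 D * (L1 * L') := by
          rw [e1, Matrix.one_mul]
      _ = L1 * (L * fromBlocks A Q 0 D * L1) * L' := by simp only [Matrix.mul_assoc]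
      _ = L1 * L' * fromBlocks A' Q' 0 D' * (L1' * L') := by rw [h]; simp only [Matrix.mul_assoc]
      _ = _ := by rw [e2, Matrix.mul_one]
  rw [fromBlocks_multiply, fromBlocks_multiply] at h2
  simp only [Matrix.mul_zero, Matrix.zero_mul, add_zero, zero_add, Matrix.mul_one,
    Matrix.one_mul] at h2
  obtain ⟨hA, hQ, hT, hD⟩ := fromBlocks_inj.mp h2
  -- Invariance of both graphs says that `T' - T` intertwines `A'` and `D`, so it lies in the kernel
  -- of an invertible Sylvester operator.
  have hY : T' - T = 0 := by
    by_contra hne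
    have hbij : Function.Injective (sylvester A' D) :=
      ((LinearMap.isUnit_iff_isUnit_det _).mpr hs'.isUnit |> (Module.End.isUnit_iff _).mp).1
    refine hne (hbij ?_)
    rw [sylvester_apply, hT, sub_self, map_zero]
  rw [hY, Matrix.zero_mul, zero_add] at hD
  rw [hY, Matrix.mul_zero, add_zero] at hA
  rw [hA, hQ, hD, sub_eq_zero.mp hY]

end BlockMarks

/-! ### Almost every matrix is covered by the graph parametrisation -/

section GenericMatrices

open Matrix

variable {k : Type*} [Fintype k] [DecidableEq k]

theorem measurable_matrix_apply {m n : Type*} (i : m) (j : n) :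
    Measurable fun A : Matrix m n ℝ => A i j :=
  (measurable_pi_apply j).comp (measurable_pi_apply i)

theorem measurable_toBlocks₁₁ : Measurable fun X : Matrix (Fin 2 ⊕ k) (Fin 2 ⊕ k) ℝ =>
    X.toBlocks₁₁ :=
  measurable_pi_lambda _ fun _ => measurable_pi_lambda _ fun _ => measurable_matrix_apply _ _

theorem measurable_toBlocks₂₁ : Measurable fun X : Matrix (Fin 2 ⊕ k) (Fin 2 ⊕ k) ℝ =>
    X.toBlocks₂₁ :=
  measurable_pi_lambda _ fun _ => measurable_pi_lambda _ fun _ => measurable_matrix_apply _ _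

theorem measurable_toBlocks₂₂ : Measurable fun X : Matrix (Fin 2 ⊕ k) (Fin 2 ⊕ k) ℝ =>
    X.toBlocks₂₂ :=
  measurable_pi_lambda _ fun _ => measurable_pi_lambda _ fun _ => measurable_matrix_apply _ _

theorem measurable_disc : Measurable disc := by
  unfold disc
  simp only [trace_fin_two, det_fin_two]
  have h := fun i j => measurable_matrix_apply (m := Fin 2) (n := Fin 2) i j
  exact (((h 0 0).add (h 1 1)).pow_const 2).sub
    ((((h 0 0).mul (h 1 1)).sub ((h 0 1).mul (h 1 0))).const_mul 4)

theorem continuous_det_sylvester :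
    Continuous fun p : Matrix (Fin 2) (Fin 2) ℝ × Matrix k k ℝ =>
      LinearMap.det (sylvester p.1 p.2) := by
  let S : Matrix (Fin 2) (Fin 2) ℝ × Matrix k k ℝ →
      (Matrix k (Fin 2) ℝ →L[ℝ] Matrix k (Fin 2) ℝ) := fun p =>
    ((mulBilin k (Fin 2) (Fin 2)).flip p.1 : Matrix k (Fin 2) ℝ →L[ℝ] Matrix k (Fin 2) ℝ) -
      (mulBilin k k (Fin 2) p.2 : Matrix k (Fin 2) ℝ →L[ℝ] Matrix k (Fin 2) ℝ)
  have hS : Continuous S :=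
    ((mulBilin k (Fin 2) (Fin 2)).flip.continuous.comp continuous_fst).sub
      ((mulBilin k k (Fin 2)).continuous.comp continuous_snd)
  exact ContinuousLinearMap.continuous_det.comp hS

/-- The parameters at which the graph parametrisation is regular and whose plane carries a pair of
non-real eigenvalues. -/
def regularSet (k : Type*) [Fintype k] [DecidableEq k] :
    Set (Matrix (Fin 2 ⊕ k) (Fin 2 ⊕ k) ℝ) :=
  {X | disc X.toBlocks₁₁ < 0 ∧ LinearMap.det (sylvester X.toBlocks₁₁ X.toBlocks₂₂) ≠ 0}

/-- `markOf` as a function of the parameter matrix. -/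
def markBlock (X : Matrix (Fin 2 ⊕ k) (Fin 2 ⊕ k) ℝ) : ℂ × ℝ × ℝ :=
  markOf X.toBlocks₂₁ X.toBlocks₁₁

theorem measurable_markBlock : Measurable (markBlock (k := k)) :=
  measurable_markOf.comp (measurable_toBlocks₂₁.prodMk measurable_toBlocks₁₁)

theorem measurableSet_regularSet : MeasurableSet (regularSet k) := by
  have h : Measurable fun X : Matrix (Fin 2 ⊕ k) (Fin 2 ⊕ k) ℝ =>
      LinearMap.det (sylvester X.toBlocks₁₁ X.toBlocks₂₂) :=
    continuous_det_sylvester.measurable.comp (measurable_toBlocks₁₁.prodMk measurable_toBlocks₂₂)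
  exact (measurableSet_lt (measurable_disc.comp measurable_toBlocks₁₁) measurable_const).inter
    (h (measurableSet_singleton 0).compl)

theorem det_graphDeriv_ne_zero {X : Matrix (Fin 2 ⊕ k) (Fin 2 ⊕ k) ℝ} (hX : X ∈ regularSet k) :
    (graphDeriv X).det ≠ 0 := by
  rw [det_graphDeriv]
  exact mul_ne_zero (det_shearConj_ne_zero X) hX.2

/-! ### Null sets of degenerate planes -/

/-- The `2 × 2` minor of a two-column matrix in rows `a`, `b`. -/
def minor {m : Type*} (F : Matrix m (Fin 2) ℝ) (a b : m) : ℝ := F a 0 * F b 1 - F a 1 * F b 0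

theorem minor_mul {m : Type*} (F : Matrix m (Fin 2) ℝ) (B : Matrix (Fin 2) (Fin 2) ℝ) (a b : m) :
    minor (F * B) a b = minor F a b * B.det := by
  simp only [minor, Matrix.mul_apply, Fin.sum_univ_two, det_fin_two]
  ring

theorem finite_setOf_quadratic_eq_zero (p q : ℝ) : {t : ℝ | t ^ 2 + p * t + q = 0}.Finite := by
  rcases Set.eq_empty_or_nonempty {t : ℝ | t ^ 2 + p * t + q = 0} with h | ⟨s, hs⟩
  · rw [h]; exact Set.finite_empty
  · refine (Set.toFinite {s, -p - s}).subset fun t ht => ?_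
    have h : (t - s) * (t - (-p - s)) = 0 := by
      have h1 : t ^ 2 + p * t + q = 0 := ht
      have h2 : s ^ 2 + p * s + q = 0 := hs
      linear_combination h1 - h2
    rcases mul_eq_zero.mp h with h | h
    · exact Or.inl (sub_eq_zero.mp h)
    · exact Or.inr (sub_eq_zero.mp h)

/-- Moving two well-chosen entries of `T`, or one, or none, according to how many of the rows `a`,
`b` lie in the lower block, makes the minor a polynomial in `t` with leading coefficient `±1`. -/
theorem exists_direction_minor_ne_zero {a b : Fin 2 ⊕ k} (hab : a ≠ b) :
    ∃ W : Matrix k (Fin 2) ℝ, ∀ T : Matrix k (Fin 2) ℝ,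
      {t : ℝ | minor (fromRows (1 : Matrix (Fin 2) (Fin 2) ℝ) (T + t • W)) a b = 0}.Finite := by
  have hlin : ∀ p : ℝ, {t : ℝ | p + t = 0}.Finite := fun p =>
    (Set.finite_singleton (-p)).subset fun t ht => by
      have h : p + t = 0 := ht
      exact (eq_neg_of_add_eq_zero_right h)
  have hlin' : ∀ p : ℝ, {t : ℝ | -(p + t) = 0}.Finite := fun p =>
    (hlin p).subset fun t ht => neg_eq_zero.mp ht
  rcases a with i | i <;> rcases b with j | j
  · refine ⟨0, fun T => ?_⟩
    convert Set.finite_empty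
    ext t
    fin_cases i <;> fin_cases j <;> simp [minor] at hab ⊢
  · refine ⟨of fun l c => if l = j ∧ c = 1 - i then 1 else 0, fun T => ?_⟩
    fin_cases i
    · simpa [minor] using hlin (T j 1)
    · simpa [minor] using hlin' (T j 0)
  · refine ⟨of fun l c => if l = i ∧ c = 1 - j then 1 else 0, fun T => ?_⟩
    fin_cases j
    · simpa [minor] using hlin' (T i 1)
    · simpa [minor] using hlin (T i 0)
  · have hij : i ≠ j := fun h => hab (by rw [h])
    refine ⟨of fun l c => if (l = i ∧ c = 0) ∨ (l = j ∧ c = 1) then 1 else 0, fun T => ?_⟩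
    refine (finite_setOf_quadratic_eq_zero (T i 0 + T j 1)
      (T i 0 * T j 1 - T i 1 * T j 0)).subset fun t ht => ?_
    simp [minor, hij, hij.symm] at ht
    change t ^ 2 + (T i 0 + T j 1) * t + (T i 0 * T j 1 - T i 1 * T j 0) = 0
    linear_combination ht

theorem measurable_minor {m n : Type*} (a b : m ⊕ n) (B : Matrix m (Fin 2) ℝ) :
    Measurable fun T : Matrix n (Fin 2) ℝ => minor (fromRows B T) a b := by
  have h : ∀ (c : m ⊕ n) (j : Fin 2), Measurable fun T : Matrix n (Fin 2) ℝ =>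
      fromRows B T c j := by
    rintro (c | c) j
    · exact measurable_const
    · exact measurable_matrix_apply c j
  exact ((h a 0).mul (h b 1)).sub ((h a 1).mul (h b 0))

theorem volume_setOf_minor_eq_zero {a b : Fin 2 ⊕ k} (hab : a ≠ b) :
    volume {T : Matrix k (Fin 2) ℝ |
      minor (fromRows (1 : Matrix (Fin 2) (Fin 2) ℝ) T) a b = 0} = 0 := by
  obtain ⟨W, hW⟩ := exists_direction_minor_ne_zero hab
  -- Fubini along the lines of direction `W`: each of them meets the zero set in finitely many
  -- points.
  have h := ae_mem_of_ae_add_linearMap_mem (LinearMap.toSpanSingleton ℝ _ W) volume volume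
    (s := {T : Matrix k (Fin 2) ℝ | minor (fromRows (1 : Matrix (Fin 2) (Fin 2) ℝ) T) a b ≠ 0})
    (measurable_minor a b 1 (measurableSet_singleton 0).compl) fun T => by
      refine measure_mono_null (fun t ht => ?_) (Set.Finite.measure_zero (hW T) volume)
      simpa using ht
  refine measure_mono_null (fun T hT => ?_) h
  simpa using hT

theorem volume_setOf_lowerLeft_mem {N : Set (Matrix k (Fin 2) ℝ)} (hN : volume N = 0) :
    volume {X : Matrix (Fin 2 ⊕ k) (Fin 2 ⊕ k) ℝ | X.toBlocks₂₁ ∈ N} = 0 := by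
  obtain ⟨c, -, -, hc, -⟩ := exists_lintegral_eq_mul_lintegral_linearEquiv
    (volume : Measure (Matrix k (Fin 2) ℝ × Matrix (Fin 2) (Fin 2) ℝ ×
      Matrix (Fin 2) k ℝ × Matrix k k ℝ))
    (volume : Measure (Matrix (Fin 2 ⊕ k) (Fin 2 ⊕ k) ℝ)) (splitBlocks k).symm
  rw [hc, Measure.smul_apply, smul_eq_mul]
  have hm : MeasurableEmbedding (splitBlocks k).symm :=
    (splitBlocks k).symm.toContinuousLinearEquiv.toHomeomorph.measurableEmbedding
  rw [hm.map_apply]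
  have : (splitBlocks k).symm ⁻¹' {X | X.toBlocks₂₁ ∈ N} = N ×ˢ Set.univ := by
    ext p
    change p.1 ∈ N ↔ _
    simp
  rw [this, Measure.volume_eq_prod, Measure.prod_prod, hN, zero_mul, mul_zero]

/-- The matrices, up to a permutation of the coordinates, with an invariant plane that is a graph
but not over the first two coordinates. -/
theorem volume_image_degenerate (σ : Equiv.Perm (Fin 2 ⊕ k)) :
    volume ((fun X => (graphMap X).submatrix σ σ) ''
      {X : Matrix (Fin 2 ⊕ k) (Fin 2 ⊕ k) ℝ |
        minor (fromRows (1 : Matrix (Fin 2) (Fin 2) ℝ) X.toBlocks₂₁)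
          (σ (Sum.inl 0)) (σ (Sum.inl 1)) = 0}) = 0 := by
  -- A differentiable map between spaces of equal dimension sends null sets to null sets.
  refine addHaar_image_eq_zero_of_differentiableOn_of_addHaar_eq_zero volume (fun X _ => ?_)
    (volume_setOf_lowerLeft_mem (volume_setOf_minor_eq_zero (σ.injective.ne (by simp))))
  let R : Matrix (Fin 2 ⊕ k) (Fin 2 ⊕ k) ℝ →ₗ[ℝ] Matrix (Fin 2 ⊕ k) (Fin 2 ⊕ k) ℝ :=
    { toFun := fun G => G.submatrix σ σ, map_add' := fun _ _ => rfl, map_smul' := fun _ _ => rfl }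
  exact (((LinearMap.toContinuousLinearMap R).hasFDerivAt.comp X
    (hasFDerivAt_graphMap X)).differentiableAt).differentiableWithinAt

/-- Sard's theorem in equal dimensions. It discards the matrices for which some graph plane has a
singular Sylvester operator, that is, shares an eigenvalue with the quotient. -/
theorem volume_image_critical :
    volume (graphMap '' {X : Matrix (Fin 2 ⊕ k) (Fin 2 ⊕ k) ℝ | (graphDeriv X).det = 0}) = 0 :=
  addHaar_image_eq_zero_of_det_fderivWithin_eq_zero volume
    (fun X _ => (hasFDerivAt_graphMap X).hasFDerivWithinAt) fun _ h => h

/-- Matrices all of whose relevant invariant planes are regular graphs. -/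
def Generic (G : Matrix (Fin 2 ⊕ k) (Fin 2 ⊕ k) ℝ) : Prop :=
  (∀ X, graphMap X = G → (graphDeriv X).det ≠ 0) ∧
  ∀ (σ : Equiv.Perm (Fin 2 ⊕ k)) (X : Matrix (Fin 2 ⊕ k) (Fin 2 ⊕ k) ℝ),
    (graphMap X).submatrix σ σ = G →
      minor (fromRows (1 : Matrix (Fin 2) (Fin 2) ℝ) X.toBlocks₂₁)
        (σ (Sum.inl 0)) (σ (Sum.inl 1)) ≠ 0

theorem ae_generic : ∀ᵐ G : Matrix (Fin 2 ⊕ k) (Fin 2 ⊕ k) ℝ, Generic G := by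
  refine Filter.Eventually.and ?_ (Filter.eventually_all.mpr fun σ => ?_)
  · refine measure_mono_null (fun G hG => ?_) (volume_image_critical (k := k))
    obtain ⟨X, hX⟩ := not_forall.mp hG
    rw [Classical.not_imp, not_not] at hX
    exact ⟨X, hX.2, hX.1⟩
  · refine measure_mono_null (fun G hG => ?_) (volume_image_degenerate σ)
    obtain ⟨X, hX⟩ := not_forall.mp hG
    rw [Classical.not_imp, not_not] at hX
    exact ⟨X, hX.2, hX.1⟩

theorem exists_perm_pair {m : Type*} [DecidableEq m] {a b i j : m} (hab : a ≠ b) (hij : i ≠ j) :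
    ∃ σ : Equiv.Perm m, σ a = i ∧ σ b = j := by
  have h1 : Equiv.swap a i j ≠ a := fun h => hij (by
    rw [Equiv.swap_apply_eq_iff, Equiv.swap_apply_left] at h; exact h.symm)
  refine ⟨(Equiv.swap b (Equiv.swap a i j)).trans (Equiv.swap a i), ?_, ?_⟩
  · rw [Equiv.trans_apply, Equiv.swap_apply_of_ne_of_ne hab h1.symm, Equiv.swap_apply_left]
  · rw [Equiv.trans_apply, Equiv.swap_apply_left, Equiv.swap_apply_self]

/-- If all minors vanished, contracting them with `u` would give `v = 0`. -/
theorem exists_minor_ne_zero_of_orthogonal {m : Type*} [Fintype m] (u v : m → ℝ)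
    (hu : u ⬝ᵥ u = 1) (hv : v ⬝ᵥ v = 1) (huv : u ⬝ᵥ v = 0) :
    ∃ i j, u i * v j - v i * u j ≠ 0 := by
  by_contra! h
  have h1 : ∀ i, v i = 0 := by
    intro i
    have : ∑ j, (u i * v j - v i * u j) * u j = 0 := by simp [h]
    simp only [sub_mul, Finset.sum_sub_distrib, mul_assoc, ← Finset.mul_sum] at this
    rw [show ∑ j, v j * u j = 0 by rw [← huv, dotProduct]; simp only [mul_comm],
      show ∑ j, u j * u j = 1 from hu] at this
    linarith
  rw [show v = 0 from funext h1, dotProduct_zero] at hv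
  exact zero_ne_one hv

/-- Every marked eigenvalue of a generic matrix comes from a regular parameter. -/
theorem exists_markBlock_eq_of_generic {G : Matrix (Fin 2 ⊕ k) (Fin 2 ⊕ k) ℝ} (hG : Generic G)
    {p : ℂ × ℝ × ℝ} (hp : p ∈ blockMarks G) :
    ∃ X ∈ regularSet k, graphMap X = G ∧ markBlock X = p := by
  obtain ⟨hc, hcb, him, O, hO, Q, D, hGO⟩ := hp
  have hpd : p = (⟨p.1.re, √(p.2.1 * p.2.2)⟩, p.2.1, p.2.2) := by
    rw [← him]
  have hOO := (mem_orthogonalGroup_iff' _ _).mp hO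
  change Oᵀ * O = 1 at hOO
  by_cases ha : O.toBlocks₁₁.det = 0
  · exfalso
    obtain ⟨i, j, hij⟩ := exists_minor_ne_zero_of_orthogonal (fun l => O l (Sum.inl 0))
      (fun l => O l (Sum.inl 1))
      (by have := congrFun (congrFun hOO (Sum.inl 0)) (Sum.inl 0)
          simpa [Matrix.mul_apply, dotProduct] using this)
      (by have := congrFun (congrFun hOO (Sum.inl 1)) (Sum.inl 1)
          simpa [Matrix.mul_apply, dotProduct] using this)
      (by have := congrFun (congrFun hOO (Sum.inl 0)) (Sum.inl 1)
          simpa [Matrix.mul_apply, dotProduct] using this)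
    have hne : i ≠ j := by
      rintro rfl
      exact hij (by ring)
    obtain ⟨σ, hσi, hσj⟩ := exists_perm_pair (a := (Sum.inl 0 : Fin 2 ⊕ k)) (b := Sum.inl 1)
      (by simp) hne
    -- Some pair of rows of the first two columns of `O` has a nonzero minor. Permuting these rows
    -- to the top makes the plane a graph over the first two coordinates.
    set P := O.submatrix σ id with hP
    have hPO : P ∈ orthogonalGroup (Fin 2 ⊕ k) ℝ := by
      rw [mem_orthogonalGroup_iff']
      change Pᵀ * P = 1
      rw [hP, transpose_submatrix, submatrix_mul_equiv, hOO, submatrix_id_id]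
    have hPa : P.toBlocks₁₁.det ≠ 0 := by
      rw [det_fin_two]
      simpa [hP, toBlocks₁₁, hσi, hσj] using hij
    rw [← fromBlocks_toBlocks P] at hPO
    obtain ⟨Q', D', hX, -⟩ := exists_graphMap_eq_of_orthogonal hPO hPa
      (schurBlock p.1.re p.2.1 p.2.2) Q D
    rw [fromBlocks_toBlocks] at hX
    have hGP : P * fromBlocks (schurBlock p.1.re p.2.1 p.2.2) Q 0 D * Pᵀ = G.submatrix σ σ := by
      rw [hGO, hP, transpose_submatrix]
      rfl
    -- The minor excluded by genericity is, up to the nonzero determinant of the top block of `P`,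
    -- the upper minor of `O`, which vanishes by assumption.
    refine hG.2 σ.symm _ (by rw [hX, hGP]; ext; simp) ?_
    rw [toBlocks_fromBlocks₂₁]
    have hF : fromRows (1 : Matrix (Fin 2) (Fin 2) ℝ) (P.toBlocks₂₁ * (P.toBlocks₁₁)⁻¹) *
        P.toBlocks₁₁ = fromRows P.toBlocks₁₁ P.toBlocks₂₁ := by
      rw [fromRows_mul, Matrix.one_mul, Matrix.mul_assoc, nonsing_inv_mul _ hPa.isUnit,
        Matrix.mul_one]
    have hrow : ∀ l c, fromRows P.toBlocks₁₁ P.toBlocks₂₁ l c = O (σ l) (Sum.inl c) := by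
      rintro (l | l) c <;> rfl
    have h := minor_mul (fromRows (1 : Matrix (Fin 2) (Fin 2) ℝ)
      (P.toBlocks₂₁ * (P.toBlocks₁₁)⁻¹)) P.toBlocks₁₁ (σ.symm (Sum.inl 0)) (σ.symm (Sum.inl 1))
    rw [hF, minor, hrow, hrow, hrow, hrow, Equiv.apply_symm_apply, Equiv.apply_symm_apply] at h
    rw [det_fin_two] at ha
    exact (mul_eq_zero.mp (h.symm.trans ha)).resolve_right hPa
  · rw [← fromBlocks_toBlocks O] at hO
    obtain ⟨Q', D', hX, hm⟩ := exists_graphMap_eq_of_orthogonal hO ha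
      (schurBlock p.1.re p.2.1 p.2.2) Q D
    rw [fromBlocks_toBlocks, ← hGO] at hX
    refine ⟨_, ⟨?_, ?_⟩, hX, ?_⟩
    · rw [toBlocks_fromBlocks₁₁, disc_conj (mul_nonsing_inv _ (Ne.isUnit ha)), disc_schurBlock]
      have : 0 < p.2.1 * p.2.2 := mul_pos (hc.trans_le hcb) hc
      linarith
    · have := hG.1 _ hX
      rw [det_graphDeriv] at this
      exact right_ne_zero_of_mul this
    · rw [markBlock, toBlocks_fromBlocks₁₁, toBlocks_fromBlocks₂₁, hm,
        markOf_zero_schurBlock hc hcb, ← hpd]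

/-! ### The marked spectrum as a count of preimages -/

/-- The point measure of the marked eigenvalues. -/
def blockSpectrum (G : Matrix (Fin 2 ⊕ k) (Fin 2 ⊕ k) ℝ) : Measure (ℂ × ℝ × ℝ) :=
  Measure.sum fun p : blockMarks G => Measure.dirac (p : ℂ × ℝ × ℝ)

/-- Among the regular preimages of one matrix the eigenvalue alone determines the parameter. This
makes the correspondence with the marks injective and bounds the number of preimages by that of the
eigenvalues. -/
theorem injOn_fst_markBlock (G : Matrix (Fin 2 ⊕ k) (Fin 2 ⊕ k) ℝ) :
    Set.InjOn (fun X => (markBlock X).1) {X | X ∈ regularSet k ∧ graphMap X = G} :=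
  fun _ hX _ hX' h => eq_of_graphMap_eq (hX.2.trans hX'.2.symm) hX.1.1 hX'.1.1 hX.1.2 h

theorem blockSpectrum_eq_fiberMeasure {G : Matrix (Fin 2 ⊕ k) (Fin 2 ⊕ k) ℝ} (hG : Generic G) :
    blockSpectrum G = fiberMeasure graphMap (regularSet k) markBlock G := by
  have hmem : ∀ X : {X // X ∈ regularSet k ∧ graphMap X = G}, markBlock X.1 ∈ blockMarks G := by
    rintro ⟨X, hX, rfl⟩
    have := markOf_mem_blockMarks (T := X.toBlocks₂₁) X.toBlocks₁₂ X.toBlocks₂₂ hX.1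
    rwa [fromBlocks_toBlocks] at this
  let e : {X // X ∈ regularSet k ∧ graphMap X = G} ≃ blockMarks G :=
    Equiv.ofBijective (fun X => ⟨markBlock X.1, hmem X⟩) ⟨fun X X' h => Subtype.ext
      (injOn_fst_markBlock G X.2 X'.2 (congrArg (fun p => p.1.1) h)), fun ⟨p, hp⟩ => by
        obtain ⟨X, h1, h2, h3⟩ := exists_markBlock_eq_of_generic hG hp
        exact ⟨⟨X, h1, h2⟩, Subtype.ext h3⟩⟩
  ext B hB
  rw [blockSpectrum, fiberMeasure, Measure.sum_apply _ hB, Measure.sum_apply _ hB,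
    ← Equiv.tsum_eq e]
  rfl

theorem charpoly_graphMap (X : Matrix (Fin 2 ⊕ k) (Fin 2 ⊕ k) ℝ) :
    (graphMap X).charpoly = X.toBlocks₁₁.charpoly * X.toBlocks₂₂.charpoly := by
  rw [← charpoly_fromBlocks_zero₂₁ _ X.toBlocks₁₂]
  conv_lhs => rw [← fromBlocks_toBlocks X, graphMap_fromBlocks, Matrix.mul_assoc,
    charpoly_mul_comm, Matrix.mul_assoc,
    mul_eq_one_comm.mp (shear_mul_shear_neg X.toBlocks₂₁), Matrix.mul_one]

/-- Distinct preimages carry distinct complex roots of the characteristic polynomial. This crude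
bound is the only source of finiteness for the intensity. -/
theorem fiberMeasure_univ_le (G : Matrix (Fin 2 ⊕ k) (Fin 2 ⊕ k) ℝ) :
    fiberMeasure graphMap (regularSet k) markBlock G Set.univ ≤ Fintype.card (Fin 2 ⊕ k) := by
  classical
  have hroot : ∀ X : {X // X ∈ regularSet k ∧ graphMap X = G},
      (markBlock X.1).1 ∈ (G.charpoly.map (algebraMap ℝ ℂ)).roots.toFinset := by
    rintro ⟨X, hX, rfl⟩
    rw [Multiset.mem_toFinset, Polynomial.mem_roots
      ((Polynomial.map_ne_zero (charpoly_monic _).ne_zero)), charpoly_graphMap, Polynomial.IsRoot,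
      Polynomial.map_mul, Polynomial.eval_mul, charpoly_fin_two]
    refine mul_eq_zero_of_left ?_ _
    have hd : 0 ≤ X.toBlocks₁₁.det - (X.toBlocks₁₁.trace / 2) ^ 2 := by
      have h := hX.1
      rw [disc] at h
      linarith
    have hsq := Real.sq_sqrt hd
    simp only [markBlock, markOf]
    set y := √(X.toBlocks₁₁.det - (X.toBlocks₁₁.trace / 2) ^ 2)
    simp only [Polynomial.map_add, Polynomial.map_sub, Polynomial.map_pow, Polynomial.map_X,
      Polynomial.map_mul, Polynomial.map_C, Polynomial.eval_add, Polynomial.eval_sub,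
      Polynomial.eval_pow, Polynomial.eval_X, Polynomial.eval_mul, Polynomial.eval_C,
      Complex.coe_algebraMap]
    apply Complex.ext
    · simp [sq]
      nlinarith [hsq]
    · simp [sq]
      ring
  let f : {X // X ∈ regularSet k ∧ graphMap X = G} →
      (G.charpoly.map (algebraMap ℝ ℂ)).roots.toFinset := fun X => ⟨_, hroot X⟩
  have hf : Function.Injective f := fun X X' h => Subtype.ext
    (injOn_fst_markBlock G X.2 X'.2 (congrArg Subtype.val h))
  have : Finite {X // X ∈ regularSet k ∧ graphMap X = G} := Finite.of_injective f hf
  have := Fintype.ofFinite {X // X ∈ regularSet k ∧ graphMap X = G}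
  rw [fiberMeasure, Measure.sum_apply _ MeasurableSet.univ]
  simp only [measure_univ, tsum_fintype, Finset.sum_const, Finset.card_univ, nsmul_eq_mul, mul_one]
  norm_cast
  calc Fintype.card {X // X ∈ regularSet k ∧ graphMap X = G}
      ≤ Fintype.card (G.charpoly.map (algebraMap ℝ ℂ)).roots.toFinset :=
        Fintype.card_le_of_injective f hf
    _ = (G.charpoly.map (algebraMap ℝ ℂ)).roots.toFinset.card := Fintype.card_coe _
    _ ≤ (G.charpoly.map (algebraMap ℝ ℂ)).roots.card := Multiset.toFinset_card_le _
    _ ≤ (G.charpoly.map (algebraMap ℝ ℂ)).natDegree := Polynomial.card_roots' _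
    _ = Fintype.card (Fin 2 ⊕ k) := by
      rw [Polynomial.natDegree_map, charpoly_natDegree_eq_dim]

end GenericMatrices

/-! ### Integrating out the invariant plane -/

section Reduction

open Matrix

/-- The unnormalised density `exp (-a (tr G Gᵀ - τ tr G²))` of the elliptic ensemble. -/
def boltzmann {m : Type*} [Fintype m] (a τ : ℝ) (G : Matrix m m ℝ) : ℝ≥0∞ :=
  ENNReal.ofReal (Real.exp (-a * ((G * Gᵀ).trace - τ * (G * G).trace)))

theorem boltzmann_ne_zero {m : Type*} [Fintype m] (a τ : ℝ) (G : Matrix m m ℝ) :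
    boltzmann a τ G ≠ 0 :=
  (ENNReal.ofReal_pos.mpr (Real.exp_pos _)).ne'

theorem measurable_boltzmann {m : Type*} [Fintype m] (a τ : ℝ) :
    Measurable (boltzmann a τ : Matrix m m ℝ → ℝ≥0∞) := by
  have h := fun i j => measurable_matrix_apply (m := m) (n := m) i j
  refine (Real.measurable_exp.comp (Measurable.const_mul (Measurable.sub ?_
    (Measurable.const_mul ?_ τ)) (-a))).ennreal_ofReal
  · simp only [trace, diag_apply, Matrix.mul_apply, transpose_apply]
    exact Finset.measurable_sum _ fun i _ => Finset.measurable_sum _ fun j _ => (h i j).mul (h i j)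
  · simp only [trace, diag_apply, Matrix.mul_apply]
    exact Finset.measurable_sum _ fun i _ => Finset.measurable_sum _ fun j _ => (h i j).mul (h j i)

theorem boltzmann_orthogonal_conj {m : Type*} [Fintype m] [DecidableEq m] (a τ : ℝ)
    {O : Matrix m m ℝ} (hO : O ∈ orthogonalGroup m ℝ) (G : Matrix m m ℝ) :
    boltzmann a τ (O * G * Oᵀ) = boltzmann a τ G := by
  have h1 : O * Oᵀ = 1 := (mem_orthogonalGroup_iff _ _).mp hO
  have h2 : Oᵀ * O = 1 := mul_eq_one_comm.mp h1
  have e1 : O * G * Oᵀ * (O * G * Oᵀ)ᵀ = O * (G * Gᵀ) * Oᵀ := by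
    calc O * G * Oᵀ * (O * G * Oᵀ)ᵀ = O * G * (Oᵀ * O) * Gᵀ * Oᵀ := by
          rw [transpose_mul, transpose_mul, transpose_transpose]; simp only [Matrix.mul_assoc]
      _ = _ := by rw [h2, Matrix.mul_one]; simp only [Matrix.mul_assoc]
  have e2 : O * G * Oᵀ * (O * G * Oᵀ) = O * (G * G) * Oᵀ := by
    calc O * G * Oᵀ * (O * G * Oᵀ) = O * G * (Oᵀ * O) * G * Oᵀ := by simp only [Matrix.mul_assoc]
      _ = _ := by rw [h2, Matrix.mul_one]; simp only [Matrix.mul_assoc]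
  rw [boltzmann, boltzmann, e1, e2, trace_conj h1, trace_conj h1]

variable {k : Type*} [Fintype k] [DecidableEq k]

/-- The weight of the blocks other than the `2 × 2` block. -/
def restWeight (a τ : ℝ) (p : Matrix (Fin 2) k ℝ × Matrix k k ℝ) : ℝ≥0∞ :=
  ENNReal.ofReal (Real.exp (-a * (p.1 * p.1ᵀ).trace)) * boltzmann a τ p.2

/-- In a block triangular matrix the coupling `Q` enters `tr G Gᵀ` but not `tr G²`, and both traces
are sums over the blocks. -/
theorem boltzmann_fromBlocks_zero (a τ : ℝ) (A : Matrix (Fin 2) (Fin 2) ℝ)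
    (Q : Matrix (Fin 2) k ℝ) (D : Matrix k k ℝ) :
    boltzmann a τ (fromBlocks A Q 0 D) = boltzmann a τ A * restWeight a τ (Q, D) := by
  rw [restWeight, boltzmann, boltzmann, boltzmann, ← ENNReal.ofReal_mul (Real.exp_pos _).le,
    ← ENNReal.ofReal_mul (Real.exp_pos _).le, ← Real.exp_add, ← Real.exp_add,
    fromBlocks_transpose, fromBlocks_multiply, fromBlocks_multiply]
  congr 2
  simp only [trace, Fintype.sum_sum_type, diag_apply, fromBlocks_apply₁₁, fromBlocks_apply₂₂,
    Matrix.add_apply, transpose_zero, Matrix.mul_zero, Matrix.zero_mul, zero_add, add_zero,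
    Finset.sum_add_distrib]
  ring

theorem measurable_restWeight (a τ : ℝ) : Measurable (restWeight (k := k) a τ) := by
  refine Measurable.mul ?_ ((measurable_boltzmann a τ).comp measurable_snd)
  refine (Real.measurable_exp.comp (Measurable.const_mul ?_ (-a))).ennreal_ofReal
  have h := fun i j => (measurable_matrix_apply (m := Fin 2) (n := k) i j).comp
    (measurable_fst : Measurable (Prod.fst : Matrix (Fin 2) k ℝ × Matrix k k ℝ → _))
  simp only [trace, diag_apply, Matrix.mul_apply, transpose_apply]
  exact Finset.measurable_sum _ fun i _ => Finset.measurable_sum _ fun j _ => (h i j).mul (h i j)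

/-- The contribution of the remaining eigenvalues, as a function of the `2 × 2` block. -/
def spectralWeight (k : Type*) [Fintype k] [DecidableEq k] (a τ : ℝ)
    (A : Matrix (Fin 2) (Fin 2) ℝ) : ℝ≥0∞ :=
  ∫⁻ p : Matrix (Fin 2) k ℝ × Matrix k k ℝ,
    ENNReal.ofReal |LinearMap.det (sylvester A p.2)| * restWeight a τ p

theorem measurable_spectralWeight (a τ : ℝ) : Measurable (spectralWeight k a τ) := by
  refine Measurable.lintegral_prod_right (Measurable.mul ?_
    ((measurable_restWeight a τ).comp measurable_snd))
  refine (Measurable.abs (continuous_det_sylvester.measurable.comp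
    (measurable_fst.prodMk measurable_snd.snd))).ennreal_ofReal

/-- `A` enters only through the Sylvester determinant, which is a similarity invariant. Hence the
rest of the matrix influences the mark through the eigenvalue only, not through `b - c`. -/
theorem spectralWeight_conj (a τ : ℝ) {A α α' : Matrix (Fin 2) (Fin 2) ℝ} (h : α * α' = 1) :
    spectralWeight k a τ (α * A * α') = spectralWeight k a τ A := by
  refine lintegral_congr fun p => ?_
  have h1 : (1 : Matrix k k ℝ) * 1 = 1 := Matrix.one_mul 1
  have h2 := det_sylvester_conj (A := A) (D := p.2) h h1
  rw [Matrix.one_mul, Matrix.mul_one] at h2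
  rw [h2]

/-- At `D = 0` the Sylvester operator is right multiplication by `A`, which is invertible; by
continuity the integrand is positive on a nonempty open set. -/
theorem spectralWeight_ne_zero (a τ : ℝ) {A : Matrix (Fin 2) (Fin 2) ℝ} (hA : A.det ≠ 0) :
    spectralWeight k a τ A ≠ 0 := by
  have hcont : Continuous fun p : Matrix (Fin 2) k ℝ × Matrix k k ℝ =>
      LinearMap.det (sylvester A p.2) :=
    continuous_det_sylvester.comp (continuous_const.prodMk continuous_snd)
  have hmeas : Measurable fun p : Matrix (Fin 2) k ℝ × Matrix k k ℝ =>
      ENNReal.ofReal |LinearMap.det (sylvester A p.2)| * restWeight a τ p :=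
    (hcont.measurable.abs).ennreal_ofReal.mul (measurable_restWeight a τ)
  intro h
  rw [spectralWeight, lintegral_eq_zero_iff hmeas] at h
  have hopen : IsOpen {p : Matrix (Fin 2) k ℝ × Matrix k k ℝ |
      LinearMap.det (sylvester A p.2) ≠ 0} := isOpen_ne_fun hcont continuous_const
  have hne : {p : Matrix (Fin 2) k ℝ × Matrix k k ℝ |
      LinearMap.det (sylvester A p.2) ≠ 0}.Nonempty := by
    refine ⟨0, fun h0 => ?_⟩
    have hu : A * A⁻¹ = 1 := mul_nonsing_inv _ hA.isUnit
    have hc : sylvester A⁻¹ (0 : Matrix k k ℝ) ∘ₗ sylvester A 0 = LinearMap.id := by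
      refine LinearMap.ext fun Y => ?_
      rw [LinearMap.comp_apply, sylvester_apply, sylvester_apply, Matrix.zero_mul, sub_zero,
        Matrix.zero_mul, sub_zero, Matrix.mul_assoc, hu, Matrix.mul_one, LinearMap.id_apply]
    have hd := congrArg LinearMap.det hc
    rw [LinearMap.det_comp, LinearMap.det_id] at hd
    have h0' : LinearMap.det (sylvester A (0 : Matrix k k ℝ)) = 0 := h0
    rw [h0', mul_zero] at hd
    exact zero_ne_one hd
  refine (hopen.measure_pos volume hne).ne' (measure_mono_null (fun p hp => ?_) h)
  have h3 : restWeight a τ p ≠ 0 :=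
    mul_ne_zero (ENNReal.ofReal_pos.mpr (Real.exp_pos _)).ne' (boltzmann_ne_zero _ _ _)
  exact mul_ne_zero (ENNReal.ofReal_pos.mpr (abs_pos.mpr hp)).ne' h3

/-! ### Reduction to the plane of the first two coordinates -/

/-- The reduced intensity of the marks, for the plane of the first two coordinates. -/
def reducedIntensity (k : Type*) [Fintype k] [DecidableEq k] (a τ : ℝ)
    (B : Set (ℂ × ℝ × ℝ)) : ℝ≥0∞ :=
  ∫⁻ A : Matrix (Fin 2) (Fin 2) ℝ,
    {A | disc A < 0 ∧ markOf (0 : Matrix k (Fin 2) ℝ) A ∈ B}.indicator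
      (fun A => boltzmann a τ A * spectralWeight k a τ A) A

theorem measurable_markOf_zero : Measurable (markOf (0 : Matrix k (Fin 2) ℝ)) :=
  measurable_markOf.comp (measurable_const.prodMk measurable_id)

theorem measurableSet_disc_markOf {B : Set (ℂ × ℝ × ℝ)} (hB : MeasurableSet B) :
    MeasurableSet {A | disc A < 0 ∧ markOf (0 : Matrix k (Fin 2) ℝ) A ∈ B} :=
  (measurableSet_lt measurable_disc measurable_const).inter (measurable_markOf_zero hB)

/-- The reduced intensity as an integral over block triangular matrices. -/
theorem reducedIntensity_eq_lintegral (a τ : ℝ) {B : Set (ℂ × ℝ × ℝ)} (hB : MeasurableSet B) :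
    reducedIntensity k a τ B =
      ∫⁻ w : Matrix (Fin 2) (Fin 2) ℝ × Matrix (Fin 2) k ℝ × Matrix k k ℝ,
        {A | disc A < 0 ∧ markOf (0 : Matrix k (Fin 2) ℝ) A ∈ B}.indicator 1 w.1 *
          (ENNReal.ofReal |LinearMap.det (sylvester w.1 w.2.2)| *
            boltzmann a τ (fromBlocks w.1 w.2.1 0 w.2.2)) := by
  have hm := measurableSet_disc_markOf (k := k) hB
  have hs : Measurable fun w : Matrix (Fin 2) (Fin 2) ℝ × Matrix (Fin 2) k ℝ × Matrix k k ℝ =>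
      ENNReal.ofReal |LinearMap.det (sylvester w.1 w.2.2)| :=
    (Measurable.abs (continuous_det_sylvester.measurable.comp
      (measurable_fst.prodMk measurable_snd.snd))).ennreal_ofReal
  have hmeas : Measurable fun w : Matrix (Fin 2) (Fin 2) ℝ × Matrix (Fin 2) k ℝ × Matrix k k ℝ =>
      {A | disc A < 0 ∧ markOf (0 : Matrix k (Fin 2) ℝ) A ∈ B}.indicator
        (1 : Matrix (Fin 2) (Fin 2) ℝ → ℝ≥0∞) w.1 *
        (ENNReal.ofReal |LinearMap.det (sylvester w.1 w.2.2)| *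
          (boltzmann a τ w.1 * restWeight a τ w.2)) :=
    ((measurable_one.indicator hm).comp measurable_fst).mul (hs.mul
      (((measurable_boltzmann a τ).comp measurable_fst).mul
        ((measurable_restWeight a τ).comp measurable_snd)))
  simp_rw [boltzmann_fromBlocks_zero]
  rw [Measure.volume_eq_prod, lintegral_prod _ hmeas.aemeasurable, reducedIntensity]
  refine lintegral_congr fun A => ?_
  by_cases hA : A ∈ {A | disc A < 0 ∧ markOf (0 : Matrix k (Fin 2) ℝ) A ∈ B}
  · simp only [Set.indicator_of_mem hA, Pi.one_apply, one_mul]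
    rw [spectralWeight, ← lintegral_const_mul]
    · exact lintegral_congr fun p => by ring
    · exact ((continuous_det_sylvester.measurable.comp
        (measurable_const.prodMk measurable_snd)).abs.ennreal_ofReal).mul
        (measurable_restWeight a τ)
  · simp only [Set.indicator_of_notMem hA, zero_mul, lintegral_zero]

/-- Block triangular matrices. -/
def upperBlocks (k : Type*) : Matrix (Fin 2) (Fin 2) ℝ × Matrix (Fin 2) k ℝ × Matrix k k ℝ →ₗ[ℝ]
    Matrix (Fin 2 ⊕ k) (Fin 2 ⊕ k) ℝ where
  toFun w := fromBlocks w.1 w.2.1 0 w.2.2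
  map_add' v w := by rw [fromBlocks_add, add_zero]; rfl
  map_smul' c w := by rw [RingHom.id_apply, fromBlocks_smul, smul_zero]; rfl

/-- Conjugation by a block triangular matrix is a linear automorphism of the block triangular
matrices. -/
theorem exists_linearEquiv_upperBlocks {α α' : Matrix (Fin 2) (Fin 2) ℝ}
    (β : Matrix (Fin 2) k ℝ) {δ δ' : Matrix k k ℝ} (hα : α * α' = 1) (hδ : δ * δ' = 1) :
    ∃ ψ : (Matrix (Fin 2) (Fin 2) ℝ × Matrix (Fin 2) k ℝ × Matrix k k ℝ) ≃ₗ[ℝ]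
        (Matrix (Fin 2) (Fin 2) ℝ × Matrix (Fin 2) k ℝ × Matrix k k ℝ), ∀ w,
      (ψ w).1 = α * w.1 * α' ∧ (ψ w).2.2 = δ * w.2.2 * δ' ∧
      upperBlocks k (ψ w) = fromBlocks α β 0 δ * upperBlocks k w *
        fromBlocks α' (-(α' * β * δ')) 0 δ' := by
  let π : Matrix (Fin 2 ⊕ k) (Fin 2 ⊕ k) ℝ →ₗ[ℝ]
      Matrix (Fin 2) (Fin 2) ℝ × Matrix (Fin 2) k ℝ × Matrix k k ℝ :=
    LinearMap.snd ℝ _ _ ∘ₗ (splitBlocks k).toLinearMap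
  let f := π ∘ₗ LinearMap.mulLeft ℝ (fromBlocks α β 0 δ) ∘ₗ
    LinearMap.mulRight ℝ (fromBlocks α' (-(α' * β * δ')) 0 δ') ∘ₗ upperBlocks k
  have hmul : ∀ w, ∃ q, fromBlocks α β 0 δ * (upperBlocks k w *
      fromBlocks α' (-(α' * β * δ')) 0 δ') =
      fromBlocks (α * w.1 * α') q 0 (δ * w.2.2 * δ') := by
    intro w
    change ∃ q, _ * (fromBlocks w.1 w.2.1 0 w.2.2 * _) = _
    rw [fromBlocks_multiply, fromBlocks_multiply]
    simp only [Matrix.mul_zero, Matrix.zero_mul, add_zero, zero_add, ← Matrix.mul_assoc]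
    exact ⟨_, rfl⟩
  have hf : ∀ w, upperBlocks k (f w) = fromBlocks α β 0 δ * (upperBlocks k w *
      fromBlocks α' (-(α' * β * δ')) 0 δ') := by
    intro w
    obtain ⟨q, hq⟩ := hmul w
    change upperBlocks k (π (fromBlocks α β 0 δ * (upperBlocks k w *
      fromBlocks α' (-(α' * β * δ')) 0 δ'))) = _
    rw [hq]
    rfl
  have hU := upper_mul_upper_inv (β := β) hα hδ
  have hU' := mul_eq_one_comm.mp hU
  have hinj : Function.Injective f := by
    intro v w h
    have h1 := congrArg (upperBlocks k) h
    rw [hf, hf] at h1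
    have hc : ∀ M : Matrix (Fin 2 ⊕ k) (Fin 2 ⊕ k) ℝ,
        fromBlocks α' (-(α' * β * δ')) 0 δ' * (fromBlocks α β 0 δ *
          (M * fromBlocks α' (-(α' * β * δ')) 0 δ')) * fromBlocks α β 0 δ = M := fun M => by
      rw [← Matrix.mul_assoc, hU', Matrix.one_mul, Matrix.mul_assoc, hU', Matrix.mul_one]
    have h2 : upperBlocks k v = upperBlocks k w := by
      rw [← hc (upperBlocks k v), h1, hc]
    obtain ⟨e1, e2, -, e3⟩ := fromBlocks_inj.mp h2
    exact Prod.ext e1 (Prod.ext e2 e3)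
  refine ⟨LinearEquiv.ofInjectiveEndo f hinj, fun w => ?_⟩
  obtain ⟨q, hq⟩ := hmul w
  have h3 : f w = (α * w.1 * α', q, δ * w.2.2 * δ') := by
    change π (fromBlocks α β 0 δ * (upperBlocks k w *
      fromBlocks α' (-(α' * β * δ')) 0 δ')) = _
    rw [hq]
    rfl
  change (f w).1 = _ ∧ (f w).2.2 = _ ∧ upperBlocks k (f w) = _
  refine ⟨by rw [h3], by rw [h3], ?_⟩
  rw [hf]
  exact (Matrix.mul_assoc _ _ _).symm

theorem measurable_det_graphDeriv :
    Measurable fun X : Matrix (Fin 2 ⊕ k) (Fin 2 ⊕ k) ℝ => (graphDeriv X).det := by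
  have h : (fun X : Matrix (Fin 2 ⊕ k) (Fin 2 ⊕ k) ℝ => graphDeriv X) = fderiv ℝ graphMap :=
    funext fun X => (hasFDerivAt_graphMap X).fderiv.symm
  have h2 := ContinuousLinearMap.continuous_det.measurable.comp
    (measurable_fderiv ℝ (graphMap (k := k)))
  rw [← h] at h2
  exact h2

theorem measurable_graphMap :
    Measurable (graphMap : Matrix (Fin 2 ⊕ k) (Fin 2 ⊕ k) ℝ → _) :=
  Continuous.measurable <| continuous_iff_continuousAt.mpr fun X =>
    (hasFDerivAt_graphMap X).continuousAt

/-- For a fixed plane, the remaining integral is a multiple of the reduced intensity. -/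
theorem exists_lintegral_slice_eq_mul (a τ : ℝ) (T : Matrix k (Fin 2) ℝ) :
    ∃ K : ℝ≥0∞, K ≠ 0 ∧ ∀ B, MeasurableSet B →
      ∫⁻ w : Matrix (Fin 2) (Fin 2) ℝ × Matrix (Fin 2) k ℝ × Matrix k k ℝ,
        (regularSet k ∩ markBlock ⁻¹' B).indicator (fun X =>
          ENNReal.ofReal |(graphDeriv X).det| * boltzmann a τ (graphMap X))
          ((splitBlocks k).symm (T, w)) = K * reducedIntensity k a τ B := by
  obtain ⟨α, α', β, δ, δ', hα, hδ, hαT, hO⟩ := exists_orthogonal_frame T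
  obtain ⟨ψ, hψ⟩ := exists_linearEquiv_upperBlocks β hα hδ
  obtain ⟨c, hc0, -, -, hc⟩ := exists_lintegral_eq_mul_lintegral_linearEquiv
    (volume : Measure (Matrix (Fin 2) (Fin 2) ℝ × Matrix (Fin 2) k ℝ × Matrix k k ℝ))
    (volume : Measure (Matrix (Fin 2) (Fin 2) ℝ × Matrix (Fin 2) k ℝ × Matrix k k ℝ)) ψ
  -- The shear factor of the Jacobian depends on `T` only, so it is constant on the slice; so is the
  -- Jacobian `c` of the linear substitution `ψ`.
  set s := |LinearMap.det (shearConj (fromBlocks (0 : Matrix (Fin 2) (Fin 2) ℝ) 0 T 0))|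
  have hs : 0 < s := abs_pos.mpr (det_shearConj_ne_zero _)
  refine ⟨c * ENNReal.ofReal s, mul_ne_zero hc0 (ENNReal.ofReal_pos.mpr hs).ne', fun B hB => ?_⟩
  rw [hc, reducedIntensity_eq_lintegral a τ hB, mul_assoc,
    ← lintegral_const_mul' _ _ ENNReal.ofReal_ne_top]
  congr 1
  refine lintegral_congr fun w => ?_
  obtain ⟨h1, h2, h3⟩ := hψ w
  have hX : (splitBlocks k).symm (T, ψ w) = fromBlocks (ψ w).1 (ψ w).2.1 T (ψ w).2.2 := rfl
  have hdet : |(graphDeriv (fromBlocks (ψ w).1 (ψ w).2.1 T (ψ w).2.2)).det| =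
      s * |LinearMap.det (sylvester w.1 w.2.2)| := by
    rw [det_graphDeriv, abs_mul, toBlocks_fromBlocks₁₁, toBlocks_fromBlocks₂₂, h1, h2,
      det_sylvester_conj hα hδ]
    rfl
  have hb : boltzmann a τ (graphMap (fromBlocks (ψ w).1 (ψ w).2.1 T (ψ w).2.2)) =
      boltzmann a τ (fromBlocks w.1 w.2.1 0 w.2.2) := by
    rw [graphMap_eq_orthogonal_conj (upper_mul_upper_inv (β := β) hα hδ) hO h3,
      boltzmann_orthogonal_conj a τ hO]
    rfl
  have hmark : markBlock (fromBlocks (ψ w).1 (ψ w).2.1 T (ψ w).2.2) =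
      markOf (0 : Matrix k (Fin 2) ℝ) w.1 := by
    rw [markBlock, toBlocks_fromBlocks₁₁, toBlocks_fromBlocks₂₁, h1, markOf_conj hα hαT]
  have hdisc : disc (ψ w).1 = disc w.1 := by rw [h1, disc_conj hα]
  have hsyl : LinearMap.det (sylvester (ψ w).1 (ψ w).2.2) =
      LinearMap.det (sylvester w.1 w.2.2) := by rw [h1, h2, det_sylvester_conj hα hδ]
  rw [hX]
  -- The reduced intensity does not impose regularity, but where the Sylvester determinant vanishes
  -- its integrand is zero anyway.
  by_cases hz : LinearMap.det (sylvester w.1 w.2.2) = 0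
  · rw [Set.indicator_of_notMem, hz]
    · simp
    · rintro ⟨⟨-, h⟩, -⟩
      rw [toBlocks_fromBlocks₁₁, toBlocks_fromBlocks₂₂, hsyl] at h
      exact h hz
  · have hiff : fromBlocks (ψ w).1 (ψ w).2.1 T (ψ w).2.2 ∈ regularSet k ∩ markBlock ⁻¹' B ↔
        w.1 ∈ {A | disc A < 0 ∧ markOf (0 : Matrix k (Fin 2) ℝ) A ∈ B} := by
      rw [Set.mem_inter_iff, Set.mem_preimage, hmark, regularSet, Set.mem_ofPred_eq,
        Set.mem_ofPred_eq, toBlocks_fromBlocks₁₁, toBlocks_fromBlocks₂₂, hdisc, hsyl]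
      simp [hz]
    by_cases hw : w.1 ∈ {A | disc A < 0 ∧ markOf (0 : Matrix k (Fin 2) ℝ) A ∈ B}
    · rw [Set.indicator_of_mem (hiff.mpr hw), Set.indicator_of_mem hw, hdet, hb,
        ENNReal.ofReal_mul hs.le, Pi.one_apply, one_mul, mul_assoc]
    · rw [Set.indicator_of_notMem (fun h => hw (hiff.mp h)), Set.indicator_of_notMem hw]
      simp

/-- The integrand is positive on the nonempty open set of negative discriminant, where `4 det A >
(tr A)²` makes `A` invertible. -/
theorem reducedIntensity_univ_ne_zero (a τ : ℝ) : reducedIntensity k a τ Set.univ ≠ 0 := by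
  intro h
  rw [reducedIntensity, lintegral_indicator (measurableSet_disc_markOf MeasurableSet.univ),
    setLIntegral_eq_zero_iff (f := fun A => boltzmann a τ A * spectralWeight k a τ A)
    (measurableSet_disc_markOf MeasurableSet.univ)
    ((measurable_boltzmann a τ).mul (measurable_spectralWeight a τ))] at h
  have hcont : Continuous disc := by
    have he : ∀ i j, Continuous fun A : Matrix (Fin 2) (Fin 2) ℝ => A i j := fun i j =>
      (continuous_apply j).comp (continuous_apply i)
    unfold disc
    simp only [trace_fin_two, det_fin_two]
    exact (((he 0 0).add (he 1 1)).pow 2).sub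
      ((((he 0 0).mul (he 1 1)).sub ((he 0 1).mul (he 1 0))).const_mul 4)
  have hopen : IsOpen {A | disc A < 0} := isOpen_lt hcont continuous_const
  have hne : {A | disc A < 0}.Nonempty := ⟨schurBlock 0 1 1, by
    change disc _ < 0
    rw [disc_schurBlock]; norm_num⟩
  refine (hopen.measure_pos volume hne).ne' (measure_mono_null (fun A hA => ?_) h)
  have hA' : disc A < 0 := hA
  have hdet : A.det ≠ 0 := by
    rw [disc] at hA'
    nlinarith [sq_nonneg A.trace]
  have hn := mul_ne_zero (boltzmann_ne_zero a τ A) (spectralWeight_ne_zero (k := k) a τ hdet)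
  intro hcon
  exact hn (hcon ⟨hA', Set.mem_univ _⟩)

/-- Up to a constant, the intensity of the marks is the reduced intensity. -/
theorem exists_lintegral_fiberMeasure_eq_mul (a τ : ℝ)
    (hfin : ∫⁻ G : Matrix (Fin 2 ⊕ k) (Fin 2 ⊕ k) ℝ, boltzmann a τ G ≠ ∞) :
    ∃ K : ℝ≥0∞, K ≠ 0 ∧ K ≠ ∞ ∧ ∀ B, MeasurableSet B →
      ∫⁻ G, boltzmann a τ G * fiberMeasure graphMap (regularSet k) markBlock G B =
        K * reducedIntensity k a τ B := by
  obtain ⟨c, hc0, hctop, -, hc⟩ := exists_lintegral_eq_mul_lintegral_linearEquiv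
    (volume : Measure (Matrix k (Fin 2) ℝ × Matrix (Fin 2) (Fin 2) ℝ ×
      Matrix (Fin 2) k ℝ × Matrix k k ℝ))
    (volume : Measure (Matrix (Fin 2 ⊕ k) (Fin 2 ⊕ k) ℝ)) (splitBlocks k).symm
  choose K hK0 hK using fun T => exists_lintegral_slice_eq_mul (k := k) a τ T
  have hS : ∀ B, MeasurableSet B → MeasurableSet (regularSet k ∩ markBlock ⁻¹' B) := fun B hB =>
    measurableSet_regularSet.inter (measurable_markBlock hB)
  have hmeas : ∀ B, MeasurableSet B → Measurable
      fun p : Matrix k (Fin 2) ℝ × Matrix (Fin 2) (Fin 2) ℝ × Matrix (Fin 2) k ℝ × Matrix k k ℝ =>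
      (regularSet k ∩ markBlock ⁻¹' B).indicator (fun X =>
          ENNReal.ofReal |(graphDeriv X).det| * boltzmann a τ (graphMap X))
          ((splitBlocks k).symm p) := fun B hB =>
    ((measurable_det_graphDeriv.abs.ennreal_ofReal.mul
      ((measurable_boltzmann a τ).comp measurable_graphMap)).indicator (hS B hB)).comp
      (splitBlocks k).symm.toContinuousLinearEquiv.continuous.measurable
  have hJ : ∀ B, MeasurableSet B →
      ∫⁻ G, boltzmann a τ G * fiberMeasure graphMap (regularSet k) markBlock G B =
        c * ∫⁻ T, K T * reducedIntensity k a τ B := by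
    intro B hB
    rw [lintegral_mul_fiberMeasure volume measurableSet_regularSet measurable_markBlock
      (fun X _ => (hasFDerivAt_graphMap X).hasFDerivWithinAt)
      (fun X hX => det_graphDeriv_ne_zero hX) (measurable_boltzmann a τ) hB,
      ← lintegral_indicator (hS B hB), hc, Measure.volume_eq_prod,
      lintegral_prod _ (hmeas B hB).aemeasurable]
    simp_rw [hK _ B hB]
  -- The bound on the number of preimages makes the left side finite. As no `K T` is zero and the
  -- total reduced intensity is nonzero, both factors on the right must then be finite.
  have hJtop : ∫⁻ G, boltzmann a τ G *
      fiberMeasure graphMap (regularSet k) markBlock G Set.univ ≠ ∞ := by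
    refine ne_top_of_le_ne_top ?_ (lintegral_mono fun G =>
      mul_le_mul_right (fiberMeasure_univ_le G) (boltzmann a τ G))
    rw [lintegral_mul_const _ (measurable_boltzmann a τ)]
    exact ENNReal.mul_ne_top hfin (ENNReal.natCast_ne_top _)
  have hI0 := reducedIntensity_univ_ne_zero (k := k) a τ
  rw [hJ _ MeasurableSet.univ] at hJtop
  have hint : ∫⁻ T, K T * reducedIntensity k a τ Set.univ ≠ ∞ := fun h =>
    hJtop (by rw [h, ENNReal.mul_top hc0])
  have hItop : reducedIntensity k a τ Set.univ ≠ ∞ := by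
    intro h
    refine hint ?_
    simp only [h, ENNReal.mul_top (hK0 _), lintegral_const]
    exact ENNReal.top_mul (isOpen_univ.measure_pos volume Set.univ_nonempty).ne'
  have hmono : ∀ B, reducedIntensity k a τ B ≤ reducedIntensity k a τ Set.univ := fun B =>
    lintegral_mono fun A => Set.indicator_le_indicator_of_subset
      (fun A (hA : disc A < 0 ∧ _) => show disc A < 0 ∧ _ from ⟨hA.1, Set.mem_univ _⟩)
      (fun _ => zero_le) A
  have hpull : ∀ B, ∫⁻ T, K T * reducedIntensity k a τ B =
      (∫⁻ T, K T) * reducedIntensity k a τ B := fun B =>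
    lintegral_mul_const' _ _ (ne_top_of_le_ne_top hItop (hmono B))
  refine ⟨c * ∫⁻ T, K T, mul_ne_zero hc0 fun h => ?_, ENNReal.mul_ne_top hctop fun h => ?_,
    fun B hB => by rw [hJ B hB, hpull, mul_assoc]⟩
  · have h1 := hpull Set.univ
    rw [h, zero_mul] at h1
    -- `K` is a pointwise choice with no measurability of its own, but its product with the total
    -- reduced intensity is a slice integral, hence measurable.
    have h2 : Measurable fun T => K T * reducedIntensity k a τ Set.univ := by
      have := (hmeas _ MeasurableSet.univ).lintegral_prod_right' (ν := volume)
      simpa only [hK _ _ MeasurableSet.univ] using this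
    rw [lintegral_eq_zero_iff h2] at h1
    obtain ⟨T, hT⟩ := h1.exists
    exact mul_ne_zero (hK0 T) hI0 hT
  · exact hint (by rw [hpull, h, ENNReal.top_mul hI0])

end Reduction

/-! ### The law of the elliptic ensemble -/

section Gaussian

/-- A product of measures with densities with respect to a probability measure. -/
theorem pi_withDensity {ι : Type*} [Fintype ι] (ν : Measure ℝ) [IsProbabilityMeasure ν]
    {w : ℝ → ℝ≥0∞} (hw : Measurable w) [SigmaFinite (ν.withDensity w)] :
    Measure.pi (fun _ : ι => ν.withDensity w) =
      (Measure.pi fun _ : ι => ν).withDensity fun h => ∏ i, w (h i) := by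
  refine Measure.pi_eq fun s hs => ?_
  rw [withDensity_apply _ (MeasurableSet.univ_pi hs),
    ← lintegral_indicator (MeasurableSet.univ_pi hs)]
  have h1 : ∀ h : ι → ℝ, (Set.univ.pi s).indicator (fun h => ∏ i, w (h i)) h =
      ∏ i, (s i).indicator w (h i) := by
    intro h
    by_cases hh : h ∈ Set.univ.pi s
    · rw [Set.indicator_of_mem hh]
      exact Finset.prod_congr rfl fun i _ => (Set.indicator_of_mem (hh i (Set.mem_univ i)) w).symm
    · rw [Set.indicator_of_notMem hh]
      obtain ⟨i, hi⟩ := not_forall.mp hh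
      rw [Classical.not_imp] at hi
      exact (Finset.prod_eq_zero (Finset.mem_univ i) (Set.indicator_of_notMem hi.2 w)).symm
  simp_rw [h1]
  -- The coordinates are independent under a product of probability measures, so the integral of the
  -- product factors.
  have hind := iIndepFun_pi (μ := fun _ : ι => ν) (X := fun i => (s i).indicator w)
    fun i => (hw.indicator (hs i)).aemeasurable
  rw [lintegral_prod_eq_prod_lintegral_of_indepFun Finset.univ
    (fun i (h : ι → ℝ) => (s i).indicator w (h i)) hind
    (fun i => (hw.indicator (hs i)).comp (measurable_pi_apply i))]
  refine Finset.prod_congr rfl fun i _ => ?_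
  have h2 := (measurePreserving_eval (fun _ : ι => ν) i).lintegral_comp (hw.indicator (hs i))
  simp only [Function.eval] at h2
  rw [h2, lintegral_indicator (hs i), withDensity_apply _ (hs i)]

/-- The density of an array of i.i.d. standard Gaussian variables. -/
theorem exists_pi_gaussianReal_eq (ι : Type*) [Fintype ι] : ∃ c : ℝ≥0∞, c ≠ 0 ∧ c ≠ ∞ ∧
    Measure.pi (fun _ : ι => gaussianReal 0 1) =
      c • (volume : Measure (ι → ℝ)).withDensity
        fun h => ENNReal.ofReal (Real.exp (-(∑ i, h i ^ 2) / 2)) := by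
  have hne : (1 : NNReal) ≠ 0 := one_ne_zero
  have hw : Measurable fun x => (gaussianPDF 0 1 x)⁻¹ := (measurable_gaussianPDF 0 1).inv
  have hpos : ∀ x, gaussianPDF 0 1 x ≠ 0 := fun x => (gaussianPDF_pos 0 hne x).ne'
  have htop : ∀ x, gaussianPDF 0 1 x ≠ ∞ := fun x => ENNReal.ofReal_ne_top
  -- Lebesgue measure is written as a density with respect to the Gaussian rather than the reverse,
  -- because the product formula needs a probability measure as its base. The resulting identity is
  -- inverted afterwards.
  have hvol : (gaussianReal 0 1).withDensity (fun x => (gaussianPDF 0 1 x)⁻¹) = volume := by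
    rw [gaussianReal_of_var_ne_zero 0 hne]
    exact withDensity_inv_same (measurable_gaussianPDF 0 1)
      (Filter.Eventually.of_forall hpos) (Filter.Eventually.of_forall htop)
  have : SigmaFinite ((gaussianReal 0 1).withDensity fun x => (gaussianPDF 0 1 x)⁻¹) := by
    rw [hvol]; infer_instance
  have h := pi_withDensity (ι := ι) (gaussianReal 0 1) hw
  rw [hvol, ← volume_pi] at h
  have hW : Measurable fun h : ι → ℝ => ∏ i, (gaussianPDF 0 1 (h i))⁻¹ :=
    Finset.measurable_prod _ fun i _ => hw.comp (measurable_pi_apply i)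
  have h3 := congrArg (fun μ => μ.withDensity fun h : ι → ℝ => (∏ i, (gaussianPDF 0 1 (h i))⁻¹)⁻¹) h
  rw [withDensity_inv_same hW] at h3
  · have hc : (0 : ℝ) < (√(2 * Real.pi * (1 : NNReal)))⁻¹ := by positivity
    refine ⟨∏ i : ι, ENNReal.ofReal (√(2 * Real.pi * (1 : NNReal)))⁻¹,
      Finset.prod_ne_zero_iff.mpr fun _ _ => (ENNReal.ofReal_pos.mpr hc).ne',
      ENNReal.prod_ne_top fun _ _ => ENNReal.ofReal_ne_top, ?_⟩
    rw [← h3, ← withDensity_smul' _ _ (ENNReal.prod_ne_top fun _ _ => ENNReal.ofReal_ne_top)]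
    congr 1
    funext h
    rw [← ENNReal.prod_inv_distrib]
    · simp only [inv_inv, Pi.smul_apply, smul_eq_mul, gaussianPDF, gaussianPDFReal]
      simp_rw [ENNReal.ofReal_mul hc.le]
      rw [Finset.prod_mul_distrib, ← ENNReal.ofReal_prod_of_nonneg fun _ _ => (Real.exp_pos _).le,
        ← Real.exp_sum]
      congr 3
      rw [neg_div, Finset.sum_div, ← Finset.sum_neg_distrib]
      exact Finset.sum_congr rfl fun i _ => by simp [neg_div]
    · exact fun i _ j _ _ => Or.inl (hpos _)
  · exact Filter.Eventually.of_forall fun h => Finset.prod_ne_zero_iff.mpr fun i _ =>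
      ENNReal.inv_ne_zero.mpr (htop _)
  · exact Filter.Eventually.of_forall fun h => ENNReal.prod_ne_top fun i _ =>
      ENNReal.inv_ne_top.mpr (hpos _)

instance instIsProbabilityMeasureGaussianArray (N : ℕ) :
    IsProbabilityMeasure (gaussianArray N) := by
  unfold gaussianArray; infer_instance

/-- Reading the lower triangle of one Gaussian array and the strict lower triangle of another, one
obtains a single Gaussian array. -/
def mergeArray (N : ℕ) (g : (Fin N × Fin N → ℝ) × (Fin N × Fin N → ℝ)) : Fin N × Fin N → ℝ :=
  fun p => if p.2 ≤ p.1 then g.1 p else g.2 p.swap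

theorem measurable_mergeArray (N : ℕ) : Measurable (mergeArray N) := by
  refine measurable_pi_lambda _ fun p => ?_
  unfold mergeArray
  split_ifs
  · exact (measurable_pi_apply p).comp measurable_fst
  · exact (measurable_pi_apply p.swap).comp measurable_snd

/-- Each entry of the merged array reads its own coordinate of the pair of arrays, so the entries
stay i.i.d. The unused coordinates integrate to `1`. -/
theorem map_mergeArray (N : ℕ) :
    ((gaussianArray N).prod (gaussianArray N)).map (mergeArray N) = gaussianArray N := by
  refine (Measure.pi_eq fun s hs => ?_).symm
  rw [Measure.map_apply (measurable_mergeArray N) (MeasurableSet.univ_pi hs)]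
  have hset : mergeArray N ⁻¹' Set.univ.pi s =
      (Set.univ.pi fun p => if p.2 ≤ p.1 then s p else Set.univ) ×ˢ
        (Set.univ.pi fun p => if p.1 ≤ p.2 then Set.univ else s p.swap) := by
    ext g
    simp only [Set.mem_preimage, Set.mem_pi, Set.mem_univ, true_imp_iff, Set.mem_prod, mergeArray]
    constructor
    · refine fun h => ⟨fun p => ?_, fun p => ?_⟩
      · have := h p
        split_ifs with hp
        · rwa [if_pos hp] at this
        · trivial
      · have := h p.swap
        split_ifs with hp
        · trivial
        · rwa [if_neg (by simpa using hp), Prod.swap_swap] at this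
    · rintro ⟨h1, h2⟩ p
      split_ifs with hp
      · have := h1 p
        rwa [if_pos hp] at this
      · have := h2 p.swap
        rwa [if_neg (by simpa using hp), Prod.swap_swap] at this
  rw [hset, Measure.prod_prod, gaussianArray, Measure.pi_pi, Measure.pi_pi,
    ← (Equiv.prodComm (Fin N) (Fin N)).prod_comp fun p =>
      gaussianReal 0 1 (if p.1 ≤ p.2 then Set.univ else s p.swap), ← Finset.prod_mul_distrib]
  refine Finset.prod_congr rfl fun p _ => ?_
  simp only [Equiv.prodComm_apply, Prod.fst_swap, Prod.snd_swap, Prod.swap_swap]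
  split_ifs <;> simp

end Gaussian

/-! ### The density of the ensemble in matrix coordinates -/

section EnsembleLaw

open Matrix

/-- The elliptic matrix as a linear function of an array. -/
def arrayMatrix (τ : ℝ) (N : ℕ) : (Fin N × Fin N → ℝ) →ₗ[ℝ] Matrix (Fin N) (Fin N) ℝ where
  toFun h := of fun i j => (1 / √(2 * (N : ℝ))) *
    if i = j then √(1 + τ) * (√2 * h (i, i)) else
      if j < i then √(1 + τ) * h (i, j) + √(1 - τ) * h (j, i)
      else √(1 + τ) * h (j, i) - √(1 - τ) * h (i, j)
  map_add' g h := by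
    ext i j
    simp only [of_apply, Matrix.add_apply, Pi.add_apply]
    split_ifs <;> ring
  map_smul' c h := by
    ext i j
    simp only [of_apply, Matrix.smul_apply, Pi.smul_apply, smul_eq_mul, RingHom.id_apply]
    split_ifs <;> ring

theorem arrayMatrix_mergeArray (τ : ℝ) (N : ℕ)
    (g : (Fin N × Fin N → ℝ) × (Fin N × Fin N → ℝ)) :
    (1 / √(2 * (N : ℝ))) • (√(1 + τ) • symmPart N g.1 + √(1 - τ) • antisymmPart N g.2) =
      arrayMatrix τ N (mergeArray N g) := by
  ext i j
  change (1 / √(2 * (N : ℝ))) * (√(1 + τ) * (if i = j then √2 * g.1 (i, i) else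
    if j < i then g.1 (i, j) else g.1 (j, i)) + √(1 - τ) * (if i = j then 0 else
    if j < i then g.2 (i, j) else -g.2 (j, i))) = (1 / √(2 * (N : ℝ))) * _
  congr 1
  by_cases hij : i = j
  · simp [hij, mergeArray]
  · by_cases hlt : j < i
    · simp [hij, hlt, mergeArray, hlt.le]
    · have hgt : i < j := lt_of_le_of_ne (not_lt.mp hlt) hij
      simp [hij, hlt, mergeArray, hgt.le, not_le.mpr hgt]
      ring

/-- The form `tr G Gᵀ - τ tr G²` weights the symmetric part by `1 - τ` and the antisymmetric part by
`1 + τ`, while the ensemble scales their squares by `1 + τ` and `1 - τ`. Both products are `1 - τ²`.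
The identity is checked on the pairs `(i, j)`, `(j, i)`. -/
theorem trace_arrayMatrix {τ : ℝ} (h0 : -1 < τ) (h1 : τ < 1) {N : ℕ} (hN : N ≠ 0)
    (h : Fin N × Fin N → ℝ) :
    N / (1 - τ ^ 2) * ((arrayMatrix τ N h * (arrayMatrix τ N h)ᵀ).trace -
      τ * (arrayMatrix τ N h * arrayMatrix τ N h).trace) = ∑ p, h p ^ 2 := by
  have hN' : (N : ℝ) ≠ 0 := Nat.cast_ne_zero.mpr hN
  have hτ : 1 - τ ^ 2 ≠ 0 := by nlinarith
  have hs : √(1 + τ) ^ 2 = 1 + τ := Real.sq_sqrt (by linarith)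
  have ht : √(1 - τ) ^ 2 = 1 - τ := Real.sq_sqrt (by linarith)
  have h2 : √2 ^ 2 = (2 : ℝ) := Real.sq_sqrt (by norm_num)
  have hc : (1 / √(2 * (N : ℝ))) ^ 2 = 1 / (2 * N) := by
    rw [div_pow, Real.sq_sqrt (by positivity), one_pow]
  set G := arrayMatrix τ N h with hG
  let F : Fin N × Fin N → ℝ := fun p =>
    N / (1 - τ ^ 2) * (G p.1 p.2 ^ 2 - τ * (G p.1 p.2 * G p.2 p.1))
  have hF : N / (1 - τ ^ 2) * ((G * Gᵀ).trace - τ * (G * G).trace) = ∑ p, F p := by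
    simp only [F, trace, diag_apply, Matrix.mul_apply, transpose_apply, ← Finset.mul_sum,
      Finset.sum_sub_distrib, Fintype.sum_prod_type, pow_two]
  have hlow : ∀ i j, j < i → F (i, j) + F (j, i) = h (i, j) ^ 2 + h (j, i) ^ 2 := by
    intro i j hij
    have e1 : G i j = 1 / √(2 * (N : ℝ)) * (√(1 + τ) * h (i, j) + √(1 - τ) * h (j, i)) := by
      simp [hG, arrayMatrix, hij.ne', hij]
    have e2 : G j i = 1 / √(2 * (N : ℝ)) * (√(1 + τ) * h (i, j) - √(1 - τ) * h (j, i)) := by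
      simp [hG, arrayMatrix, hij.ne, not_lt.mpr hij.le]
    have e3 : F (i, j) + F (j, i) = N / (1 - τ ^ 2) * ((1 / √(2 * (N : ℝ))) ^ 2 *
        (2 * √(1 + τ) ^ 2 * h (i, j) ^ 2 + 2 * √(1 - τ) ^ 2 * h (j, i) ^ 2 - 2 * τ *
          (√(1 + τ) ^ 2 * h (i, j) ^ 2 - √(1 - τ) ^ 2 * h (j, i) ^ 2))) := by
      simp only [F, e1, e2]; ring
    rw [e3, hc, hs, ht]
    field_simp
    ring
  have hsym : ∀ p : Fin N × Fin N, F p + F p.swap = h p ^ 2 + h p.swap ^ 2 := by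
    rintro ⟨i, j⟩
    rcases lt_trichotomy i j with hij | rfl | hij
    · have := hlow j i hij
      simp only [Prod.swap_prod_mk]
      linarith
    · have e1 : G i i = 1 / √(2 * (N : ℝ)) * (√(1 + τ) * (√2 * h (i, i))) := by
        simp [hG, arrayMatrix]
      have e2 : F (i, i) = N / (1 - τ ^ 2) * ((1 / √(2 * (N : ℝ))) ^ 2 * √(1 + τ) ^ 2 * √2 ^ 2 *
          (1 - τ)) * h (i, i) ^ 2 := by
        simp only [F, e1]; ring
      simp only [Prod.swap_prod_mk]
      rw [e2, hc, hs, h2]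
      field_simp
      ring
    · exact hlow i j hij
  have hswap : ∀ f : Fin N × Fin N → ℝ, ∑ p, f p = (∑ p, (f p + f p.swap)) / 2 := by
    intro f
    have := (Equiv.prodComm (Fin N) (Fin N)).sum_comp f
    simp only [Equiv.prodComm_apply] at this
    rw [Finset.sum_add_distrib, this]
    ring
  rw [hF, hswap F, hswap fun p => h p ^ 2]
  simp_rw [hsym]

/-- The density of the elliptic ensemble. -/
theorem exists_ensembleLaw_eq {τ : ℝ} (h0 : -1 < τ) (h1 : τ < 1) {N : ℕ} (hN : N ≠ 0) :
    ∃ c : ℝ≥0∞, c ≠ 0 ∧ c ≠ ∞ ∧ ensembleLaw τ N =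
      c • (volume : Measure (Matrix (Fin N) (Fin N) ℝ)).withDensity
        (boltzmann (N / (2 * (1 - τ ^ 2))) τ) := by
  obtain ⟨c, hc0, hctop, hc⟩ := exists_pi_gaussianReal_eq (Fin N × Fin N)
  -- The trace identity expresses the norm of the array through its matrix, so the kernel is
  -- trivial.
  have hinj : Function.Injective (arrayMatrix τ N) := by
    refine (injective_iff_map_eq_zero _).mpr fun h hh => ?_
    have := trace_arrayMatrix h0 h1 hN h
    rw [hh] at this
    simp only [Matrix.zero_mul, trace_zero, mul_zero, sub_zero] at this
    have h3 := (Finset.sum_eq_zero_iff_of_nonneg fun p _ => sq_nonneg (h p)).mp this.symm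
    exact funext fun p => pow_eq_zero_iff two_ne_zero |>.mp (h3 p (Finset.mem_univ p))
  let L : (Fin N × Fin N → ℝ) ≃ₗ[ℝ] Matrix (Fin N) (Fin N) ℝ :=
    LinearEquiv.ofInjectiveOfFinrankEq (arrayMatrix τ N) hinj (by simp [Module.finrank_matrix])
  have hL : ∀ h, L h = arrayMatrix τ N h := fun _ => rfl
  have hLm : Measurable L := L.toContinuousLinearEquiv.continuous.measurable
  obtain ⟨d, hd0, hdtop, -, hd⟩ := exists_lintegral_eq_mul_lintegral_linearEquiv
    (volume : Measure (Fin N × Fin N → ℝ)) (volume : Measure (Matrix (Fin N) (Fin N) ℝ)) L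
  have hlaw : ensembleLaw τ N = (gaussianArray N).map L := by
    rw [← map_mergeArray, Measure.map_map hLm (measurable_mergeArray N), ensembleLaw]
    congr 1
    exact funext fun g => arrayMatrix_mergeArray τ N g
  have hb : ∀ h, boltzmann (N / (2 * (1 - τ ^ 2))) τ (L h) =
      ENNReal.ofReal (Real.exp (-(∑ p, h p ^ 2) / 2)) := by
    intro h
    rw [boltzmann, hL, ← trace_arrayMatrix h0 h1 hN h]
    congr 2
    have hτ : 1 - τ ^ 2 ≠ 0 := by nlinarith
    field_simp
  refine ⟨c * d⁻¹, mul_ne_zero hc0 (ENNReal.inv_ne_zero.mpr hdtop),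
    ENNReal.mul_ne_top hctop (ENNReal.inv_ne_top.mpr hd0), ?_⟩
  ext B hB
  rw [hlaw, Measure.map_apply hLm hB, gaussianArray, hc, Measure.smul_apply, Measure.smul_apply,
    withDensity_apply _ (hLm hB), withDensity_apply _ hB, ← lintegral_indicator hB,
    ← lintegral_indicator (hLm hB), hd, smul_eq_mul, smul_eq_mul, mul_assoc, ← mul_assoc d⁻¹,
    ENNReal.inv_mul_cancel hd0 hdtop, one_mul]
  congr 1
  refine lintegral_congr fun h => ?_
  by_cases hh : L h ∈ B
  · rw [Set.indicator_of_mem hh, Set.indicator_of_mem (Set.mem_preimage.mpr hh), hb]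
  · rw [Set.indicator_of_notMem hh, Set.indicator_of_notMem (s := L ⁻¹' B) hh]

theorem ensembleLaw_univ (τ : ℝ) (N : ℕ) : ensembleLaw τ N Set.univ = 1 := by
  have hm : Measurable fun h => arrayMatrix τ N (mergeArray N h) :=
    (arrayMatrix τ N).toContinuousLinearMap.continuous.measurable.comp (measurable_mergeArray N)
  rw [ensembleLaw]
  simp_rw [arrayMatrix_mergeArray]
  rw [Measure.map_apply hm MeasurableSet.univ, Set.preimage_univ]
  exact measure_univ

/-! ### Transfer to block indices and the total intensity -/

/-- The first two coordinates, and the remaining ones. -/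
def blockIndex (n : ℕ) : Fin 2 ⊕ Fin n ≃ Fin (n + 2) :=
  finSumFinEquiv.trans (finCongr (Nat.add_comm 2 n))

theorem blockIndex_inl (n : ℕ) (i : Fin 2) : (blockIndex n (Sum.inl i) : ℕ) = i := rfl

theorem blockIndex_inr (n : ℕ) (i : Fin n) : (blockIndex n (Sum.inr i) : ℕ) = 2 + i := rfl

theorem submatrix_mem_orthogonalGroup {l m : Type*} [Fintype l] [DecidableEq l] [Fintype m]
    [DecidableEq m] {O : Matrix m m ℝ} (hO : O ∈ orthogonalGroup m ℝ) (e : l ≃ m) :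
    O.submatrix e e ∈ orthogonalGroup l ℝ := by
  have h1 : O * Oᵀ = 1 := (mem_orthogonalGroup_iff _ _).mp hO
  refine (mem_orthogonalGroup_iff _ _).mpr ?_
  change O.submatrix e e * Oᵀ.submatrix e e = 1
  rw [submatrix_mul_equiv, h1, submatrix_one_equiv]

theorem submatrix_conj {l m : Type*} [Fintype l] [Fintype m] (O M : Matrix m m ℝ) (e : l ≃ m) :
    (O * M * Oᵀ).submatrix e e = O.submatrix e e * M.submatrix e e * (O.submatrix e e)ᵀ := by
  rw [transpose_submatrix, submatrix_mul_equiv, submatrix_mul_equiv]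

theorem hasSchurBlock_iff {n : ℕ} (G : Matrix (Fin (n + 2)) (Fin (n + 2)) ℝ) (x b c : ℝ) :
    HasSchurBlock G x b c ↔ BlockSchur (G.submatrix (blockIndex n) (blockIndex n)) x b c := by
  set e := blockIndex n
  have e0 : e (Sum.inl 0) = 0 := rfl
  have e1 : e (Sum.inl 1) = 1 := rfl
  constructor
  · rintro ⟨O, hO, M, h00, h01, h10, h11, hM, rfl⟩
    refine ⟨O.submatrix e e, submatrix_mem_orthogonalGroup hO e, (M.submatrix e e).toBlocks₁₂,
      (M.submatrix e e).toBlocks₂₂, ?_⟩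
    rw [submatrix_conj]
    congr 2
    rw [← fromBlocks_toBlocks (M.submatrix e e)]
    congr 1
    · ext i j
      fin_cases i <;> fin_cases j <;> simp [schurBlock, toBlocks₁₁, e0, e1, h00, h01, h10, h11]
    · ext i j
      have h2 := hM (e (Sum.inr i)) (by rw [blockIndex_inr]; omega)
      fin_cases j
      · exact h2.1
      · exact h2.2
  · rintro ⟨O, hO, Q, D, h⟩
    refine ⟨O.submatrix e.symm e.symm, submatrix_mem_orthogonalGroup hO e.symm,
      (fromBlocks (schurBlock x b c) Q 0 D).submatrix e.symm e.symm, ?_, ?_, ?_, ?_, ?_, ?_⟩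
    · rw [submatrix_apply, ← e0, e.symm_apply_apply]; rfl
    · rw [submatrix_apply, ← e0, ← e1, e.symm_apply_apply, e.symm_apply_apply]; rfl
    · rw [submatrix_apply, ← e0, ← e1, e.symm_apply_apply, e.symm_apply_apply]; rfl
    · rw [submatrix_apply, ← e1, e.symm_apply_apply]; rfl
    · intro i hi
      obtain ⟨j, rfl⟩ := e.surjective i
      rcases j with j | j
      · rw [blockIndex_inl] at hi
        omega
      · constructor
        · rw [submatrix_apply, ← e0, e.symm_apply_apply, e.symm_apply_apply]; rfl
        · rw [submatrix_apply, ← e1, e.symm_apply_apply, e.symm_apply_apply]; rfl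
    · rw [← submatrix_conj, ← h, submatrix_submatrix, e.self_comp_symm, submatrix_id_id]

theorem markedSpectrum_eq_blockSpectrum {n : ℕ} (G : Matrix (Fin (n + 2)) (Fin (n + 2)) ℝ) :
    markedSpectrum G = blockSpectrum (G.submatrix (blockIndex n) (blockIndex n)) := by
  have h : markedEigenvalues G = blockMarks (G.submatrix (blockIndex n) (blockIndex n)) := by
    ext p
    change _ ∧ _ ∧ _ ∧ _ ↔ _ ∧ _ ∧ _ ∧ _
    rw [hasSchurBlock_iff]
  rw [markedSpectrum, blockSpectrum, h]

theorem boltzmann_submatrix {l m : Type*} [Fintype l] [Fintype m] (a τ : ℝ) (G : Matrix m m ℝ)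
    (e : l ≃ m) : boltzmann a τ (G.submatrix e e) = boltzmann a τ G := by
  rw [boltzmann, boltzmann, transpose_submatrix, submatrix_mul_equiv, submatrix_mul_equiv]
  simp only [trace, diag_apply, submatrix_apply, e.sum_comp fun i => (G * Gᵀ) i i,
    e.sum_comp fun i => (G * G) i i]

/-- The law of the elliptic ensemble, for matrices indexed by `Fin 2 ⊕ Fin n`. -/
theorem exists_map_submatrix_ensembleLaw_eq {τ : ℝ} (h0 : -1 < τ) (h1 : τ < 1) (n : ℕ) :
    ∃ c : ℝ≥0∞, c ≠ 0 ∧ c ≠ ∞ ∧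
      (ensembleLaw τ (n + 2)).map (fun G => G.submatrix (blockIndex n) (blockIndex n)) =
      c • (volume : Measure (Matrix (Fin 2 ⊕ Fin n) (Fin 2 ⊕ Fin n) ℝ)).withDensity
        (boltzmann ((n + 2 : ℕ) / (2 * (1 - τ ^ 2))) τ) := by
  obtain ⟨c, hc0, hctop, hc⟩ := exists_ensembleLaw_eq h0 h1 (N := n + 2) (by omega)
  set a : ℝ := (n + 2 : ℕ) / (2 * (1 - τ ^ 2))
  let e := blockIndex n
  let L : Matrix (Fin (n + 2)) (Fin (n + 2)) ℝ ≃ₗ[ℝ] Matrix (Fin 2 ⊕ Fin n) (Fin 2 ⊕ Fin n) ℝ :=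
    reindexLinearEquiv ℝ ℝ e.symm e.symm
  have hL : ∀ G, L G = G.submatrix e e := fun _ => rfl
  have hLm : Measurable L := L.toContinuousLinearEquiv.continuous.measurable
  obtain ⟨d, hd0, hdtop, -, hd⟩ := exists_lintegral_eq_mul_lintegral_linearEquiv
    (volume : Measure (Matrix (Fin (n + 2)) (Fin (n + 2)) ℝ))
    (volume : Measure (Matrix (Fin 2 ⊕ Fin n) (Fin 2 ⊕ Fin n) ℝ)) L
  refine ⟨c * d⁻¹, mul_ne_zero hc0 (ENNReal.inv_ne_zero.mpr hdtop),
    ENNReal.mul_ne_top hctop (ENNReal.inv_ne_top.mpr hd0), ?_⟩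
  change (ensembleLaw τ (n + 2)).map L = _
  ext B hB
  rw [Measure.map_apply hLm hB, hc, Measure.smul_apply, Measure.smul_apply,
    withDensity_apply _ (hLm hB), withDensity_apply _ hB, ← lintegral_indicator hB,
    ← lintegral_indicator (hLm hB), hd, smul_eq_mul, smul_eq_mul, mul_assoc, ← mul_assoc d⁻¹,
    ENNReal.inv_mul_cancel hd0 hdtop, one_mul]
  congr 1
  refine lintegral_congr fun G => ?_
  by_cases hG : L G ∈ B
  · rw [Set.indicator_of_mem hG, Set.indicator_of_mem (Set.mem_preimage.mpr hG), hL,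
      boltzmann_submatrix]
  · rw [Set.indicator_of_notMem hG, Set.indicator_of_notMem (s := L ⁻¹' B) hG]

theorem measurable_submatrix {l m : Type*} (f : l → m) :
    Measurable fun G : Matrix m m ℝ => G.submatrix f f :=
  measurable_pi_lambda _ fun i => measurable_pi_lambda _ fun j =>
    measurable_matrix_apply (f i) (f j)

theorem measurable_fiberMeasure_graphMap (k : Type*) [Fintype k] [DecidableEq k] :
    Measurable (fiberMeasure graphMap (regularSet k) markBlock) :=
  measurable_fiberMeasure measurableSet_regularSet measurable_markBlock
    (fun X _ => (hasFDerivAt_graphMap X).hasFDerivWithinAt) fun _ hX => det_graphDeriv_ne_zero hX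

/-- The ensemble has a density, so its matrices are almost surely generic. This replaces the marked
spectrum, whose measurability is not evident, by a measurable count of preimages. -/
theorem markedSpectrum_ae_eq {τ : ℝ} (h0 : -1 < τ) (h1 : τ < 1) (n : ℕ) :
    (markedSpectrum : Matrix (Fin (n + 2)) (Fin (n + 2)) ℝ → _) =ᵐ[ensembleLaw τ (n + 2)]
      fun G => fiberMeasure graphMap (regularSet (Fin n)) markBlock
        (G.submatrix (blockIndex n) (blockIndex n)) := by
  obtain ⟨c, -, -, hc⟩ := exists_map_submatrix_ensembleLaw_eq h0 h1 n
  have hgen : ∀ᵐ G ∂(ensembleLaw τ (n + 2)).map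
      (fun G => G.submatrix (blockIndex n) (blockIndex n)), Generic G := by
    rw [hc]
    exact Measure.ae_smul_measure ((withDensity_absolutelyContinuous _ _).ae_le ae_generic) c
  filter_upwards [ae_of_ae_map (measurable_submatrix _).aemeasurable hgen] with G hG
  rw [markedSpectrum_eq_blockSpectrum, blockSpectrum_eq_fiberMeasure hG]

theorem aemeasurable_markedSpectrum {τ : ℝ} (h0 : -1 < τ) (h1 : τ < 1) (n : ℕ) :
    AEMeasurable markedSpectrum (ensembleLaw τ (n + 2)) :=
  ⟨_, (measurable_fiberMeasure_graphMap (Fin n)).comp (measurable_submatrix (blockIndex n)),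
    markedSpectrum_ae_eq h0 h1 n⟩

theorem markedIntensity_apply {τ : ℝ} (h0 : -1 < τ) (h1 : τ < 1) (n : ℕ) {B : Set (ℂ × ℝ × ℝ)}
    (hB : MeasurableSet B) : markedIntensity τ n B =
      ∫⁻ G, fiberMeasure graphMap (regularSet (Fin n)) markBlock G B
        ∂(ensembleLaw τ (n + 2)).map (fun G => G.submatrix (blockIndex n) (blockIndex n)) := by
  rw [markedIntensity, Measure.bind_apply hB (aemeasurable_markedSpectrum h0 h1 n),
    lintegral_map (f := fun G => fiberMeasure graphMap (regularSet (Fin n)) markBlock G B)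
      ((Measure.measurable_coe hB).comp (measurable_fiberMeasure_graphMap (Fin n)))
      (measurable_submatrix _)]
  refine lintegral_congr_ae ?_
  filter_upwards [markedSpectrum_ae_eq h0 h1 n] with G hG
  rw [hG]

theorem isFiniteMeasure_markedIntensity {τ : ℝ} (h0 : -1 < τ) (h1 : τ < 1) (n : ℕ) :
    IsFiniteMeasure (markedIntensity τ n) := by
  refine ⟨?_⟩
  rw [markedIntensity_apply h0 h1 n MeasurableSet.univ]
  refine (lintegral_mono fun G => fiberMeasure_univ_le G).trans_lt ?_
  rw [lintegral_const, Measure.map_apply (measurable_submatrix _) MeasurableSet.univ,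
    Set.preimage_univ, ensembleLaw_univ, mul_one]
  exact (ENNReal.natCast_ne_top _).lt_top

/-- The intensity of the marked eigenvalues, up to a constant. -/
theorem exists_markedIntensity_eq_mul {τ : ℝ} (h0 : -1 < τ) (h1 : τ < 1) (n : ℕ) :
    ∃ K : ℝ≥0∞, K ≠ 0 ∧ K ≠ ∞ ∧ ∀ B, MeasurableSet B → markedIntensity τ n B =
      K * reducedIntensity (Fin n) ((n + 2 : ℕ) / (2 * (1 - τ ^ 2))) τ B := by
  obtain ⟨c, hc0, hctop, hc⟩ := exists_map_submatrix_ensembleLaw_eq h0 h1 n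
  -- Finiteness of the Gaussian integral is read off from the total mass `1` of the ensemble.
  have hfin : ∫⁻ G : Matrix (Fin 2 ⊕ Fin n) (Fin 2 ⊕ Fin n) ℝ,
      boltzmann ((n + 2 : ℕ) / (2 * (1 - τ ^ 2))) τ G ≠ ∞ := by
    intro h
    have h3 := congrArg (fun μ => μ Set.univ) hc
    rw [Measure.map_apply (measurable_submatrix _) MeasurableSet.univ, Set.preimage_univ,
      ensembleLaw_univ, Measure.smul_apply, withDensity_apply _ MeasurableSet.univ,
      Measure.restrict_univ, h, smul_eq_mul, ENNReal.mul_top hc0] at h3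
    exact ENNReal.one_ne_top h3
  obtain ⟨K, hK0, hKtop, hK⟩ := exists_lintegral_fiberMeasure_eq_mul
    ((n + 2 : ℕ) / (2 * (1 - τ ^ 2))) τ hfin
  refine ⟨c * K, mul_ne_zero hc0 hK0, ENNReal.mul_ne_top hctop hKtop, fun B hB => ?_⟩
  have hm : Measurable fun G : Matrix (Fin 2 ⊕ Fin n) (Fin 2 ⊕ Fin n) ℝ =>
      fiberMeasure graphMap (regularSet (Fin n)) markBlock G B :=
    (Measure.measurable_coe hB).comp (measurable_fiberMeasure_graphMap (Fin n))
  rw [markedIntensity_apply h0 h1 n hB, hc, lintegral_smul_measure, smul_eq_mul,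
    lintegral_withDensity_eq_lintegral_mul _ (measurable_boltzmann _ τ) hm, mul_assoc, ← hK B hB]
  rfl

end EnsembleLaw

/-! ### The intensity in coordinates -/

section Coordinates

theorem lintegral_comp_sqrt_sq_add_sq {g : ℝ → ℝ≥0∞} (hg : Measurable g) :
    ∫⁻ p : ℝ × ℝ, g √(p.1 ^ 2 + p.2 ^ 2) =
      ENNReal.ofReal (2 * Real.pi) * ∫⁻ r in Set.Ioi 0, ENNReal.ofReal r * g r := by
  rw [← lintegral_comp_polarCoord_symm fun p : ℝ × ℝ => g √(p.1 ^ 2 + p.2 ^ 2)]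
  have hm : Measurable fun p : ℝ × ℝ => ENNReal.ofReal p.1 * g p.1 :=
    measurable_fst.ennreal_ofReal.mul (hg.comp measurable_fst)
  have h1 : ∫⁻ p in polarCoord.target, ENNReal.ofReal p.1 •
      g √((polarCoord.symm p).1 ^ 2 + (polarCoord.symm p).2 ^ 2) =
      ∫⁻ p in polarCoord.target, ENNReal.ofReal p.1 * g p.1 := by
    refine setLIntegral_congr_fun polarCoord.open_target.measurableSet fun p hp => ?_
    have hp0 : 0 < p.1 := (Set.mem_prod.mp hp).1
    have h2 : (p.1 * Real.cos p.2) ^ 2 + (p.1 * Real.sin p.2) ^ 2 = p.1 ^ 2 := by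
      linear_combination p.1 ^ 2 * Real.cos_sq_add_sin_sq p.2
    simp only [polarCoord_symm_apply, smul_eq_mul]
    rw [h2, Real.sqrt_sq hp0.le]
  rw [h1, polarCoord_target, Measure.volume_eq_prod, ← Measure.prod_restrict,
    lintegral_prod _ hm.aemeasurable]
  simp only [lintegral_const, Measure.restrict_apply MeasurableSet.univ, Set.univ_inter,
    Real.volume_Ioo]
  rw [lintegral_mul_const' _ _ ENNReal.ofReal_ne_top, mul_comm]
  congr 2
  ring

/-- Substitution along a hyperbola. -/
theorem setLIntegral_Ioi_comp_sqrt_sq_sub_sq {r : ℝ} (hr : 0 ≤ r) (h : ℝ → ℝ≥0∞) :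
    ∫⁻ s in Set.Ioi r, h √(s ^ 2 - r ^ 2) =
      ∫⁻ y in Set.Ioi 0, ENNReal.ofReal (y / √(y ^ 2 + r ^ 2)) * h y := by
  have himage : (fun y => √(y ^ 2 + r ^ 2)) '' Set.Ioi 0 = Set.Ioi r := by
    ext s
    constructor
    · rintro ⟨y, hy, rfl⟩
      have hy : 0 < y := hy
      exact Real.lt_sqrt_of_sq_lt (by nlinarith [pow_pos hy 2])
    · intro hs
      have hs : r < s := hs
      have h2 : 0 < s ^ 2 - r ^ 2 := by nlinarith
      refine ⟨√(s ^ 2 - r ^ 2), Real.sqrt_pos.mpr h2, ?_⟩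
      simp only
      rw [Real.sq_sqrt h2.le, sub_add_cancel, Real.sqrt_sq (hr.trans hs.le)]
  have hpos : ∀ y ∈ Set.Ioi (0 : ℝ), 0 < y ^ 2 + r ^ 2 := fun y hy => by
    have := pow_pos (Set.mem_Ioi.mp hy) 2
    positivity
  rw [← himage, lintegral_image_eq_lintegral_abs_deriv_mul measurableSet_Ioi
    (f' := fun y => y / √(y ^ 2 + r ^ 2))]
  · refine setLIntegral_congr_fun measurableSet_Ioi fun y hy => ?_
    rw [Real.sq_sqrt (hpos y hy).le, add_sub_cancel_right, Real.sqrt_sq (Set.mem_Ioi.mp hy).le,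
      abs_of_nonneg (div_nonneg (Set.mem_Ioi.mp hy).le (Real.sqrt_nonneg _))]
  · intro y hy
    have h1 : HasDerivAt (fun y : ℝ => y ^ 2 + r ^ 2) (2 * y) y := by
      simpa using (hasDerivAt_pow 2 y).add_const (r ^ 2)
    have h2 := h1.sqrt (hpos y hy).ne'
    rw [mul_div_mul_left _ _ two_ne_zero] at h2
    exact h2.hasDerivWithinAt
  · intro y hy z hz hyz
    have hy0 : 0 < y := hy
    have hz0 : 0 < z := hz
    have h1 := congrArg (· ^ 2) hyz
    simp only at h1
    rw [Real.sq_sqrt (hpos y hy).le, Real.sq_sqrt (hpos z hz).le] at h1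
    exact (pow_left_inj₀ hy0.le hz0.le two_ne_zero).mp (by linarith)

/-- The factor `2` counts the two branches `s > r` and `s < -r`. -/
theorem setLIntegral_comp_sqrt_sq_sub_sq {r : ℝ} (hr : 0 ≤ r) (h : ℝ → ℝ≥0∞) :
    ∫⁻ s in {s | r < |s|}, h √(s ^ 2 - r ^ 2) =
      2 * ∫⁻ y in Set.Ioi 0, ENNReal.ofReal (y / √(y ^ 2 + r ^ 2)) * h y := by
  have hset : {s : ℝ | r < |s|} = Set.Ioi r ∪ Set.Iio (-r) := by
    ext s
    simp only [Set.mem_ofPred_eq, lt_abs, Set.mem_union, Set.mem_Ioi, Set.mem_Iio]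
    exact or_congr_right ⟨fun h => by linarith, fun h => by linarith⟩
  have hdisj : Disjoint (Set.Ioi r) (Set.Iio (-r)) :=
    Set.disjoint_left.mpr fun s (h1 : r < s) (h2 : s < -r) => by linarith
  have hneg : ∫⁻ s in Set.Iio (-r), h √(s ^ 2 - r ^ 2) =
      ∫⁻ s in Set.Ioi r, h √(s ^ 2 - r ^ 2) := by
    have := (Measure.measurePreserving_neg (volume : Measure ℝ)).setLIntegral_comp_preimage_emb
      (MeasurableEquiv.neg ℝ).measurableEmbedding (fun s => h √(s ^ 2 - r ^ 2)) (Set.Iio (-r))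
    rw [← this]
    simp
  rw [hset, lintegral_union measurableSet_Iio hdisj, hneg,
    setLIntegral_Ioi_comp_sqrt_sq_sub_sq hr, two_mul]

open Matrix

/-- Coordinates on `2 × 2` matrices. -/
def planeMatrix : (ℝ × (ℝ × ℝ) × ℝ) ≃ₗ[ℝ] Matrix (Fin 2) (Fin 2) ℝ where
  -- The coordinates are a multiple `x` of the identity, the traceless symmetric part `(p, q)` and
  -- the antisymmetric part `s`.
  toFun v := !![v.1 + v.2.1.1, v.2.1.2 + v.2.2; v.2.1.2 - v.2.2, v.1 - v.2.1.1]
  invFun A := ((A 0 0 + A 1 1) / 2, ((A 0 0 - A 1 1) / 2, (A 0 1 + A 1 0) / 2),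
    (A 0 1 - A 1 0) / 2)
  map_add' v w := by
    ext i j
    fin_cases i <;> fin_cases j <;> simp <;> ring
  map_smul' c v := by
    ext i j
    fin_cases i <;> fin_cases j <;> simp <;> ring
  left_inv v := by
    refine Prod.ext ?_ (Prod.ext (Prod.ext ?_ ?_) ?_) <;> simp
  right_inv A := by
    ext i j
    fin_cases i <;> fin_cases j <;> simp <;> ring

theorem trace_planeMatrix (x p q s : ℝ) : (planeMatrix (x, (p, q), s)).trace = 2 * x := by
  simp [planeMatrix, trace_fin_two]
  ring

theorem det_planeMatrix (x p q s : ℝ) :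
    (planeMatrix (x, (p, q), s)).det = x ^ 2 - (p ^ 2 + q ^ 2) + s ^ 2 := by
  simp [planeMatrix, det_fin_two]
  ring

theorem trace_planeMatrix_mul_transpose (x p q s : ℝ) :
    (planeMatrix (x, (p, q), s) * (planeMatrix (x, (p, q), s))ᵀ).trace =
      2 * x ^ 2 + 2 * (p ^ 2 + q ^ 2) + 2 * s ^ 2 := by
  rw [trace_fin_two, Matrix.mul_apply, Matrix.mul_apply, Fin.sum_univ_two, Fin.sum_univ_two]
  simp [planeMatrix]
  ring

theorem trace_planeMatrix_mul_self (x p q s : ℝ) :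
    (planeMatrix (x, (p, q), s) * planeMatrix (x, (p, q), s)).trace =
      2 * x ^ 2 + 2 * (p ^ 2 + q ^ 2) - 2 * s ^ 2 := by
  rw [trace_fin_two, Matrix.mul_apply, Matrix.mul_apply, Fin.sum_univ_two, Fin.sum_univ_two]
  simp [planeMatrix]
  ring

theorem disc_planeMatrix (x p q s : ℝ) :
    disc (planeMatrix (x, (p, q), s)) = 4 * (p ^ 2 + q ^ 2 - s ^ 2) := by
  rw [disc, trace_planeMatrix, det_planeMatrix]
  ring

variable {k : Type*} [Fintype k] [DecidableEq k]

/-- The mark with eigenvalue `x + iy` and `b - c = 2r`. -/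
def hyperbolicMark (x r y : ℝ) : ℂ × ℝ × ℝ :=
  (⟨x, y⟩, √(y ^ 2 + r ^ 2) + r, √(y ^ 2 + r ^ 2) - r)

theorem markOf_planeMatrix {x p q s : ℝ} (h : p ^ 2 + q ^ 2 < s ^ 2) :
    markOf (0 : Matrix k (Fin 2) ℝ) (planeMatrix (x, (p, q), s)) =
      hyperbolicMark x √(p ^ 2 + q ^ 2) √(s ^ 2 - √(p ^ 2 + q ^ 2) ^ 2) := by
  have h0 : ((1 + (0 : Matrix k (Fin 2) ℝ)ᵀ * (0 : Matrix k (Fin 2) ℝ)) *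
      planeMatrix (x, (p, q), s) * (1 + (0 : Matrix k (Fin 2) ℝ)ᵀ * (0 : Matrix k (Fin 2) ℝ))⁻¹ *
      (planeMatrix (x, (p, q), s))ᵀ).trace = 2 * x ^ 2 + 2 * (p ^ 2 + q ^ 2) + 2 * s ^ 2 := by
    rw [← trace_planeMatrix_mul_transpose]
    simp
  have hr : 0 ≤ p ^ 2 + q ^ 2 := by positivity
  have hx : 2 * x / 2 = x := by ring
  have hd : x ^ 2 - (p ^ 2 + q ^ 2) + s ^ 2 - x ^ 2 = s ^ 2 - (p ^ 2 + q ^ 2) := by ring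
  have hp : √(2 * x ^ 2 + 2 * (p ^ 2 + q ^ 2) + 2 * s ^ 2 - 2 * x ^ 2 +
      2 * (s ^ 2 - (p ^ 2 + q ^ 2))) = 2 * √(s ^ 2) := by
    rw [← Real.sqrt_sq (show (0 : ℝ) ≤ 2 by norm_num), ← Real.sqrt_mul (by norm_num)]
    congr 1; ring
  have hm : √(2 * x ^ 2 + 2 * (p ^ 2 + q ^ 2) + 2 * s ^ 2 - 2 * x ^ 2 -
      2 * (s ^ 2 - (p ^ 2 + q ^ 2))) = 2 * √(p ^ 2 + q ^ 2) := by
    rw [← Real.sqrt_sq (show (0 : ℝ) ≤ 2 by norm_num), ← Real.sqrt_mul (by norm_num)]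
    congr 1; ring
  rw [markOf]
  simp only [h0, trace_planeMatrix, det_planeMatrix, hx, hd, hp, hm, hyperbolicMark,
    Real.sq_sqrt hr, Real.sq_sqrt (sub_nonneg.mpr h.le), sub_add_cancel]
  refine Prod.ext rfl (Prod.ext ?_ ?_) <;> simp only <;> ring

theorem measurable_schurBlock : Measurable fun p : ℝ × ℝ => schurBlock p.1 p.2 p.2 := by
  refine measurable_pi_lambda _ fun i => measurable_pi_lambda _ fun j => ?_
  fin_cases i <;> fin_cases j <;> simp [schurBlock] <;> fun_prop

/-- The factor of the intensity that depends on the eigenvalue `x + iy` only. -/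
def eigenvalueWeight (k : Type*) [Fintype k] [DecidableEq k] (a τ x y : ℝ) : ℝ≥0∞ :=
  ENNReal.ofReal (Real.exp (-a * (2 * (1 - τ) * x ^ 2 + 2 * (1 + τ) * y ^ 2))) *
    spectralWeight k a τ (schurBlock x y y)

theorem measurable_eigenvalueWeight (a τ : ℝ) :
    Measurable fun p : ℝ × ℝ => eigenvalueWeight k a τ p.1 p.2 := by
  unfold eigenvalueWeight
  refine Measurable.mul ?_ ((measurable_spectralWeight a τ).comp measurable_schurBlock)
  exact Measurable.ennreal_ofReal (by fun_prop)

theorem eigenvalueWeight_ne_zero (a τ x : ℝ) {y : ℝ} (hy : y ≠ 0) :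
    eigenvalueWeight k a τ x y ≠ 0 := by
  refine mul_ne_zero (ENNReal.ofReal_pos.mpr (Real.exp_pos _)).ne' (spectralWeight_ne_zero a τ ?_)
  rw [det_schurBlock]
  have := mul_self_pos.mpr hy
  positivity

/-- With `r² = p² + q²`, the exponent is `2 (1 - τ) x² + 2 (1 - τ) r² + 2 (1 + τ) s²`. Substituting
`s² = y² + r²` cancels `τ` in the coefficient of `r²`, which becomes `4`, and decouples `r` from the
eigenvalue. -/
theorem weight_planeMatrix (a τ : ℝ) {x p q s : ℝ} (h : p ^ 2 + q ^ 2 < s ^ 2) :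
    boltzmann a τ (planeMatrix (x, (p, q), s)) *
      spectralWeight k a τ (planeMatrix (x, (p, q), s)) =
      ENNReal.ofReal (Real.exp (-a * (4 * √(p ^ 2 + q ^ 2) ^ 2))) *
        eigenvalueWeight k a τ x √(s ^ 2 - √(p ^ 2 + q ^ 2) ^ 2) := by
  have hr : 0 ≤ p ^ 2 + q ^ 2 := by positivity
  have hdisc : disc (planeMatrix (x, (p, q), s)) < 0 := by
    rw [disc_planeMatrix]; linarith
  obtain ⟨α, α', hα, hA⟩ := exists_conj_schurBlock_self hdisc
  rw [trace_planeMatrix, det_planeMatrix, mul_div_cancel_left₀ _ two_ne_zero,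
    show x ^ 2 - (p ^ 2 + q ^ 2) + s ^ 2 - x ^ 2 = s ^ 2 - (p ^ 2 + q ^ 2) by ring] at hA
  have hS : spectralWeight k a τ (planeMatrix (x, (p, q), s)) = spectralWeight k a τ
      (schurBlock x √(s ^ 2 - (p ^ 2 + q ^ 2)) √(s ^ 2 - (p ^ 2 + q ^ 2))) := by
    conv_lhs => rw [hA]
    exact spectralWeight_conj a τ hα
  rw [hS, eigenvalueWeight, ← mul_assoc, Real.sq_sqrt hr, boltzmann,
    ← ENNReal.ofReal_mul (Real.exp_pos _).le, ← Real.exp_add, trace_planeMatrix_mul_transpose,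
    trace_planeMatrix_mul_self, Real.sq_sqrt (sub_nonneg.mpr h.le)]
  congr 3
  ring

theorem measurable_hyperbolicMark :
    Measurable fun v : ℝ × ℝ × ℝ => hyperbolicMark v.1 v.2.1 v.2.2 := by
  unfold hyperbolicMark
  refine Measurable.prodMk ?_ (by fun_prop)
  exact Complex.measurableEquivRealProd.symm.measurable.comp
    (measurable_fst.prodMk measurable_snd.snd)

theorem lintegral_complex {f : ℂ → ℝ≥0∞} (hf : Measurable f) :
    ∫⁻ z, f z = ∫⁻ x : ℝ, ∫⁻ y : ℝ, f ⟨x, y⟩ := by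
  rw [← (Complex.volume_preserving_equiv_real_prod.symm).lintegral_comp_emb
    Complex.measurableEquivRealProd.symm.measurableEmbedding, Measure.volume_eq_prod,
    lintegral_prod (fun p => f (Complex.measurableEquivRealProd.symm p))
      (hf.comp Complex.measurableEquivRealProd.symm.measurable).aemeasurable]
  rfl

/-- Polar coordinates in `(p, q)` give `2 π r`, the substitution `y = √(s² - r²)` on both branches
gives `2 y / √(y² + r²)`, and Tonelli exchanges `r` and `y`. -/
theorem lintegral_hyperbolic {H : ℝ → ℝ → ℝ → ℝ≥0∞}
    (hH : Measurable fun v : ℝ × ℝ × ℝ => H v.1 v.2.1 v.2.2) :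
    ∫⁻ v : ℝ × (ℝ × ℝ) × ℝ, {v | √(v.2.1.1 ^ 2 + v.2.1.2 ^ 2) < |v.2.2|}.indicator (fun v =>
      H v.1 √(v.2.1.1 ^ 2 + v.2.1.2 ^ 2) √(v.2.2 ^ 2 - √(v.2.1.1 ^ 2 + v.2.1.2 ^ 2) ^ 2)) v =
    2 * ENNReal.ofReal (2 * Real.pi) * ∫⁻ x, ∫⁻ y in Set.Ioi 0, ∫⁻ r in Set.Ioi 0,
      ENNReal.ofReal r * (ENNReal.ofReal (y / √(y ^ 2 + r ^ 2)) * H x r y) := by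
  have hr : Measurable fun v : ℝ × (ℝ × ℝ) × ℝ => √(v.2.1.1 ^ 2 + v.2.1.2 ^ 2) := by fun_prop
  have hy : Measurable fun v : ℝ × (ℝ × ℝ) × ℝ =>
      √(v.2.2 ^ 2 - √(v.2.1.1 ^ 2 + v.2.1.2 ^ 2) ^ 2) := by fun_prop
  have hcomp := hH.comp (measurable_fst.prodMk (hr.prodMk hy))
  have hset : MeasurableSet {v : ℝ × (ℝ × ℝ) × ℝ | √(v.2.1.1 ^ 2 + v.2.1.2 ^ 2) < |v.2.2|} :=
    measurableSet_lt hr measurable_snd.snd.abs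
  set g : ℝ × (ℝ × ℝ) × ℝ → ℝ≥0∞ :=
    {v | √(v.2.1.1 ^ 2 + v.2.1.2 ^ 2) < |v.2.2|}.indicator (fun v =>
      H v.1 √(v.2.1.1 ^ 2 + v.2.1.2 ^ 2) √(v.2.2 ^ 2 - √(v.2.1.1 ^ 2 + v.2.1.2 ^ 2) ^ 2))
  have hG : Measurable g := hcomp.indicator hset
  have hGx : ∀ x, Measurable fun w => g (x, w) := fun x =>
    hG.comp (measurable_const.prodMk measurable_id)
  have hj : ∀ x, Measurable fun p : ℝ × ℝ =>
      ENNReal.ofReal (p.2 / √(p.2 ^ 2 + p.1 ^ 2)) * H x p.1 p.2 := fun x =>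
    Measurable.mul (Measurable.ennreal_ofReal (by fun_prop))
      (hH.comp (measurable_const.prodMk measurable_id))
  have hm : ∀ x, Measurable fun r : ℝ =>
      ∫⁻ y in Set.Ioi 0, ENNReal.ofReal (y / √(y ^ 2 + r ^ 2)) * H x r y := fun x =>
    (hj x).lintegral_prod_right'
  rw [Measure.volume_eq_prod, lintegral_prod g hG.aemeasurable,
    ← lintegral_const_mul' _ _ (ENNReal.mul_ne_top ENNReal.ofNat_ne_top ENNReal.ofReal_ne_top)]
  refine lintegral_congr fun x => ?_
  have h1 := lintegral_comp_sqrt_sq_add_sq (hm x)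
  have h2 : ∫⁻ r in Set.Ioi 0, ENNReal.ofReal r *
        ∫⁻ y in Set.Ioi 0, ENNReal.ofReal (y / √(y ^ 2 + r ^ 2)) * H x r y =
      ∫⁻ y in Set.Ioi 0, ∫⁻ r in Set.Ioi 0,
        ENNReal.ofReal r * (ENNReal.ofReal (y / √(y ^ 2 + r ^ 2)) * H x r y) := by
    simp_rw [← lintegral_const_mul' _ _ ENNReal.ofReal_ne_top]
    exact lintegral_lintegral_swap (measurable_fst.ennreal_ofReal.mul (hj x)).aemeasurable
  rw [h2] at h1
  rw [mul_assoc, ← h1, ← lintegral_const_mul' _ _ ENNReal.ofNat_ne_top, Measure.volume_eq_prod,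
    lintegral_prod (fun w => g (x, w)) (hGx x).aemeasurable]
  refine lintegral_congr fun p => ?_
  rw [← setLIntegral_comp_sqrt_sq_sub_sq (Real.sqrt_nonneg _), ← lintegral_indicator
    (s := {s | √(p.1 ^ 2 + p.2 ^ 2) < |s|}) (measurableSet_lt measurable_const measurable_id.abs)]
  rfl

/-- The integrand of the reduced intensity in the coordinates `(λ, r)`, where `b - c = 2r`. -/
def markWeight (k : Type*) [Fintype k] [DecidableEq k] (a τ : ℝ) (B : Set (ℂ × ℝ × ℝ))
    (x r y : ℝ) : ℝ≥0∞ :=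
  B.indicator 1 (hyperbolicMark x r y) *
    (ENNReal.ofReal (Real.exp (-a * (4 * r ^ 2))) * eigenvalueWeight k a τ x y)

theorem measurable_markWeight (a τ : ℝ) {B : Set (ℂ × ℝ × ℝ)} (hB : MeasurableSet B) :
    Measurable fun v : ℝ × ℝ × ℝ => markWeight k a τ B v.1 v.2.1 v.2.2 := by
  have h1 : Measurable fun v : ℝ × ℝ × ℝ =>
      B.indicator (1 : ℂ × ℝ × ℝ → ℝ≥0∞) (hyperbolicMark v.1 v.2.1 v.2.2) :=
    (measurable_one.indicator hB).comp measurable_hyperbolicMark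
  have h2 : Measurable fun v : ℝ × ℝ × ℝ =>
      ENNReal.ofReal (Real.exp (-a * (4 * v.2.1 ^ 2))) := Measurable.ennreal_ofReal (by fun_prop)
  have h3 : Measurable fun v : ℝ × ℝ × ℝ => eigenvalueWeight k a τ v.1 v.2.2 :=
    (measurable_eigenvalueWeight a τ).comp
      (f := fun v : ℝ × ℝ × ℝ => (v.1, v.2.2)) (measurable_fst.prodMk measurable_snd.snd)
  exact h1.mul (h2.mul h3)

theorem exists_reducedIntensity_eq_mul_lintegral_markWeight (k : Type*) [Fintype k] [DecidableEq k]
    (a τ : ℝ) : ∃ c : ℝ≥0∞, c ≠ 0 ∧ c ≠ ∞ ∧ ∀ B, MeasurableSet B → reducedIntensity k a τ B =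
      c * ∫⁻ x, ∫⁻ y in Set.Ioi 0, ∫⁻ r in Set.Ioi 0, ENNReal.ofReal r *
        (ENNReal.ofReal (y / √(y ^ 2 + r ^ 2)) * markWeight k a τ B x r y) := by
  have hhaar : (volume : Measure (ℝ × (ℝ × ℝ) × ℝ)).IsAddHaarMeasure :=
    instIsAddHaarMeasureVolumeProd
  obtain ⟨c, hc0, hctop, -, hc⟩ := exists_lintegral_eq_mul_lintegral_linearEquiv
    (volume : Measure (ℝ × (ℝ × ℝ) × ℝ)) (volume : Measure (Matrix (Fin 2) (Fin 2) ℝ)) planeMatrix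
  refine ⟨c * (2 * ENNReal.ofReal (2 * Real.pi)), mul_ne_zero hc0 (mul_ne_zero two_ne_zero
    (ENNReal.ofReal_pos.mpr (by positivity)).ne'), ENNReal.mul_ne_top hctop
    (ENNReal.mul_ne_top ENNReal.ofNat_ne_top ENNReal.ofReal_ne_top), fun B hB => ?_⟩
  have hlt : ∀ p q s : ℝ, √(p ^ 2 + q ^ 2) < |s| ↔ p ^ 2 + q ^ 2 < s ^ 2 := fun p q s => by
    rw [← Real.sqrt_sq_eq_abs, Real.sqrt_lt_sqrt_iff (by positivity)]
  rw [mul_assoc, ← lintegral_hyperbolic (measurable_markWeight a τ hB), reducedIntensity, hc]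
  congr 1
  refine lintegral_congr fun v => ?_
  obtain ⟨x, ⟨p, q⟩, s⟩ := v
  by_cases h : p ^ 2 + q ^ 2 < s ^ 2
  · rw [Set.indicator_of_mem
      (s := {v : ℝ × (ℝ × ℝ) × ℝ | √(v.2.1.1 ^ 2 + v.2.1.2 ^ 2) < |v.2.2|}) ((hlt p q s).mpr h)]
    simp only [markWeight]
    rw [← weight_planeMatrix a τ h, ← markOf_planeMatrix (k := k) h]
    by_cases hm : markOf (0 : Matrix k (Fin 2) ℝ) (planeMatrix (x, (p, q), s)) ∈ B
    · rw [Set.indicator_of_mem hm, Set.indicator_of_mem, Pi.one_apply, one_mul]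
      refine ⟨?_, hm⟩
      rw [disc_planeMatrix]; linarith
    · rw [Set.indicator_of_notMem hm, Set.indicator_of_notMem, zero_mul]
      exact fun h' => hm h'.2
  · rw [Set.indicator_of_notMem
      (s := {v : ℝ × (ℝ × ℝ) × ℝ | √(v.2.1.1 ^ 2 + v.2.1.2 ^ 2) < |v.2.2|})
      (fun h' => h ((hlt p q s).mp h')), Set.indicator_of_notMem]
    rintro ⟨h', -⟩
    rw [disc_planeMatrix] at h'
    exact h (by linarith)

/-- The reduced intensity in the coordinates `(λ, r)`, where `b - c = 2r`. -/
theorem exists_reducedIntensity_eq_mul (k : Type*) [Fintype k] [DecidableEq k] (a τ : ℝ) :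
    ∃ c : ℝ≥0∞, c ≠ 0 ∧ c ≠ ∞ ∧ ∀ B, MeasurableSet B → reducedIntensity k a τ B =
      c * ∫⁻ z in {z : ℂ | 0 < z.im}, ENNReal.ofReal z.im * eigenvalueWeight k a τ z.re z.im *
        ∫⁻ r in Set.Ioi 0, ENNReal.ofReal (r * Real.exp (-a * (4 * r ^ 2)) / √(z.im ^ 2 + r ^ 2)) *
          B.indicator 1 (hyperbolicMark z.re r z.im) := by
  obtain ⟨c, hc0, hctop, hc⟩ := exists_reducedIntensity_eq_mul_lintegral_markWeight k a τ
  refine ⟨c, hc0, hctop, fun B hB => ?_⟩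
  have him : Measurable fun p : ℂ × ℝ => p.1.im := Complex.measurable_im.comp measurable_fst
  have hF : Measurable fun z : ℂ => ENNReal.ofReal z.im * eigenvalueWeight k a τ z.re z.im *
        ∫⁻ r in Set.Ioi 0, ENNReal.ofReal (r * Real.exp (-a * (4 * r ^ 2)) / √(z.im ^ 2 + r ^ 2)) *
          B.indicator 1 (hyperbolicMark z.re r z.im) := by
    refine (Complex.measurable_im.ennreal_ofReal.mul ((measurable_eigenvalueWeight a τ).comp
      (Complex.measurable_re.prodMk Complex.measurable_im))).mul ?_
    refine Measurable.lintegral_prod_right' (f := fun p : ℂ × ℝ =>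
      ENNReal.ofReal (p.2 * Real.exp (-a * (4 * p.2 ^ 2)) / √(p.1.im ^ 2 + p.2 ^ 2)) *
        B.indicator 1 (hyperbolicMark p.1.re p.2 p.1.im)) (Measurable.mul
          (Measurable.ennreal_ofReal (by fun_prop)) ((measurable_one.indicator hB).comp
            (measurable_hyperbolicMark.comp ((Complex.measurable_re.comp measurable_fst).prodMk
              (measurable_snd.prodMk him)))))
  have hU : MeasurableSet {z : ℂ | 0 < z.im} :=
    measurableSet_lt measurable_const Complex.measurable_im
  rw [hc B hB, ← lintegral_indicator hU, lintegral_complex (hF.indicator hU)]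
  congr 1
  refine lintegral_congr fun x => ?_
  rw [← lintegral_indicator measurableSet_Ioi]
  refine lintegral_congr fun y => ?_
  by_cases hy : 0 < y
  · rw [Set.indicator_of_mem (Set.mem_Ioi.mpr hy), Set.indicator_of_mem (s := {z : ℂ | 0 < z.im})
      (a := ⟨x, y⟩) hy, ← lintegral_const_mul]
    · refine setLIntegral_congr_fun measurableSet_Ioi fun r hr => ?_
      have hr0 : 0 < r := hr
      have e2 : ENNReal.ofReal r * (ENNReal.ofReal (y / √(y ^ 2 + r ^ 2)) *
          ENNReal.ofReal (Real.exp (-a * (4 * r ^ 2)))) = ENNReal.ofReal y *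
          ENNReal.ofReal (r * Real.exp (-a * (4 * r ^ 2)) / √(y ^ 2 + r ^ 2)) := by
        rw [← ENNReal.ofReal_mul (by positivity), ← ENNReal.ofReal_mul (by positivity),
          ← ENNReal.ofReal_mul (by positivity)]
        congr 1
        ring
      simp only [markWeight]
      calc _ = ENNReal.ofReal r * (ENNReal.ofReal (y / √(y ^ 2 + r ^ 2)) *
          ENNReal.ofReal (Real.exp (-a * (4 * r ^ 2)))) * eigenvalueWeight k a τ x y *
          B.indicator 1 (hyperbolicMark x r y) := by ring
        _ = _ := by rw [e2]; ring
    · exact Measurable.mul (Measurable.ennreal_ofReal (by fun_prop))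
        ((measurable_one.indicator hB).comp (measurable_hyperbolicMark.comp
          (measurable_const.prodMk (measurable_id.prodMk measurable_const))))
  · rw [Set.indicator_of_notMem (s := Set.Ioi 0) hy,
      Set.indicator_of_notMem (s := {z : ℂ | 0 < z.im}) (a := ⟨x, y⟩) hy]

end Coordinates

/-! ### The conditional laws -/

section ConditionalLaw

theorem erfc_pos (x : ℝ) : 0 < erfc x := by
  have h : Integrable fun t : ℝ => Real.exp (-t ^ 2) := by
    simpa using integrable_exp_neg_mul_sq (b := 1) one_pos
  have : NeZero (volume.restrict (Set.Ioi x)) := ⟨by simp⟩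
  exact mul_pos (div_pos two_pos (Real.sqrt_pos.mpr Real.pi_pos))
    (integral_exp_pos h.integrableOn)

theorem normConst_pos {τ : ℝ} (hτ : 0 < 1 - τ ^ 2) (y : ℝ) : 0 < normConst τ y := by
  have := erfc_pos (√(2 / (1 - τ ^ 2)) * y)
  unfold normConst
  positivity

/-- The substitution `s = √(2 σ) t` turns the lower limit `2 y` into `√(2 / σ) y`. -/
theorem setLIntegral_Ioi_gaussian {σ : ℝ} (hσ : 0 < σ) (y : ℝ) :
    ∫⁻ s in Set.Ioi (2 * y), ENNReal.ofReal (Real.exp (-(s ^ 2 - (2 * y) ^ 2) / (2 * σ))) =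
      ENNReal.ofReal (√(Real.pi * σ / 2) * Real.exp (2 * y ^ 2 / σ) * erfc (√(2 / σ) * y)) := by
  have h2σ : (0 : ℝ) < 2 * σ := by positivity
  have hb : 0 < (√(2 * σ))⁻¹ := inv_pos.mpr (Real.sqrt_pos.mpr h2σ)
  have hb2 : (√(2 * σ))⁻¹ ^ 2 = (2 * σ)⁻¹ := by rw [inv_pow, Real.sq_sqrt h2σ.le]
  have hfun : ∀ s : ℝ, Real.exp (-(s ^ 2 - (2 * y) ^ 2) / (2 * σ)) =
      Real.exp (2 * y ^ 2 / σ) * Real.exp (-((√(2 * σ))⁻¹ * s) ^ 2) := by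
    intro s
    rw [← Real.exp_add, mul_pow (√(2 * σ))⁻¹, hb2]
    congr 1
    field_simp
    ring
  have hint : Integrable fun s : ℝ => Real.exp (-((√(2 * σ))⁻¹ * s) ^ 2) := by
    have := integrable_exp_neg_mul_sq (b := (2 * σ)⁻¹) (by positivity)
    refine this.congr (Filter.Eventually.of_forall fun s => ?_)
    simp only
    rw [mul_pow, hb2, neg_mul]
  simp_rw [hfun]
  rw [← ofReal_integral_eq_lintegral_ofReal (hint.const_mul _).integrableOn
    (Filter.Eventually.of_forall fun s => by positivity), integral_const_mul,
    integral_comp_mul_left_Ioi (fun t => Real.exp (-t ^ 2)) _ hb, inv_inv, smul_eq_mul]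
  have h1 : (√(2 * σ))⁻¹ * (2 * y) = √(2 / σ) * y := by
    have : √(2 / σ) = (√(2 * σ))⁻¹ * 2 := by
      rw [Real.sqrt_eq_iff_mul_self_eq (by positivity) (by positivity)]
      rw [← pow_two, mul_pow, hb2]
      field_simp
    rw [this]; ring
  have h2 : √(2 * σ) = √(Real.pi * σ / 2) * (2 / √Real.pi) := by
    rw [Real.sqrt_eq_iff_mul_self_eq (by positivity) (by positivity), ← pow_two, mul_pow, div_pow,
      Real.sq_sqrt (by positivity), Real.sq_sqrt Real.pi_pos.le]
    field_simp
  rw [h1, h2, erfc]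
  congr 1
  ring

/-- Under `s = √(δ² + 4 y²)` the factor `δ / √(δ² + 4 y²)` is absorbed into `ds`, and a Gaussian
tail beyond `2 y` remains. -/
theorem lintegral_deltaDensity {τ y : ℝ} (hτ : 0 < 1 - τ ^ 2) (hy : 0 < y) :
    ∫⁻ δ, ENNReal.ofReal (deltaDensity τ y δ) = 1 := by
  have hZ := normConst_pos hτ y
  have h1 : ∀ δ, ENNReal.ofReal (deltaDensity τ y δ) = ENNReal.ofReal (normConst τ y)⁻¹ *
      (Set.Ioi 0).indicator (fun δ => ENNReal.ofReal (δ / √(δ ^ 2 + (2 * y) ^ 2)) *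
        ENNReal.ofReal (Real.exp (-δ ^ 2 / (2 * (1 - τ ^ 2))))) δ := by
    intro δ
    by_cases hδ : 0 < δ
    · rw [Set.indicator_of_mem (Set.mem_Ioi.mpr hδ), deltaDensity, if_pos hδ,
        ← ENNReal.ofReal_mul (by positivity), ← ENNReal.ofReal_mul (by positivity), mul_pow]
      rw [show (2 : ℝ) ^ 2 = 4 by norm_num, one_div]
      congr 1
      ring
    · rw [Set.indicator_of_notMem (s := Set.Ioi 0) hδ, deltaDensity, if_neg hδ,
        ENNReal.ofReal_zero, mul_zero]
  simp_rw [h1]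
  rw [lintegral_const_mul' _ _ ENNReal.ofReal_ne_top, lintegral_indicator measurableSet_Ioi,
    ← setLIntegral_Ioi_comp_sqrt_sq_sub_sq (by positivity : 0 ≤ 2 * y) fun δ =>
      ENNReal.ofReal (Real.exp (-δ ^ 2 / (2 * (1 - τ ^ 2))))]
  have h2 : ∫⁻ s in Set.Ioi (2 * y),
      ENNReal.ofReal (Real.exp (-√(s ^ 2 - (2 * y) ^ 2) ^ 2 / (2 * (1 - τ ^ 2)))) =
      ∫⁻ s in Set.Ioi (2 * y), ENNReal.ofReal
        (Real.exp (-(s ^ 2 - (2 * y) ^ 2) / (2 * (1 - τ ^ 2)))) := by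
    refine setLIntegral_congr_fun measurableSet_Ioi fun s hs => ?_
    have hs : 2 * y < s := hs
    rw [Real.sq_sqrt (by nlinarith)]
  rw [h2, setLIntegral_Ioi_gaussian hτ, ← ENNReal.ofReal_mul (by positivity), ← normConst,
    inv_mul_cancel₀ hZ.ne', ENNReal.ofReal_one]

theorem isProbabilityMeasure_deltaKernel {τ y : ℝ} (hτ : 0 < 1 - τ ^ 2) (hy : 0 < y) :
    IsProbabilityMeasure (deltaKernel τ y) := by
  refine ⟨?_⟩
  rw [deltaKernel_apply, withDensity_apply _ MeasurableSet.univ, Measure.restrict_univ,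
    lintegral_deltaDensity hτ hy]

instance instIsSFiniteKernelDeltaKernel (τ : ℝ) : IsSFiniteKernel (deltaKernel τ) :=
  Kernel.IsSFiniteKernel.withDensity _ fun _ _ => ENNReal.ofReal_ne_top

/-! ### Rescaling by `√N` and disintegration -/

/-- The pair `(b, c)` with `2 √(bc) = 2 y` and `b - c = δ`. -/
def schurPair (y δ : ℝ) : ℝ × ℝ :=
  ((√(δ ^ 2 + 4 * y ^ 2) + δ) / 2, (√(δ ^ 2 + 4 * y ^ 2) - δ) / 2)

theorem measurable_schurPair : Measurable (Function.uncurry schurPair) := by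
  unfold Function.uncurry schurPair
  fun_prop

theorem schurPair_sub (y δ : ℝ) : (schurPair y δ).1 - (schurPair y δ).2 = δ := by
  simp only [schurPair]; ring

theorem hyperbolicMark_eq {M : ℝ} (hM : 0 < M) (z : ℂ) (δ : ℝ) :
    hyperbolicMark z.re (δ / (2 * M)) z.im =
      (z, M⁻¹ * (schurPair (M * z.im) δ).1, M⁻¹ * (schurPair (M * z.im) δ).2) := by
  have h : √(z.im ^ 2 + (δ / (2 * M)) ^ 2) = M⁻¹ * (√(δ ^ 2 + 4 * (M * z.im) ^ 2) / 2) := by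
    have : z.im ^ 2 + (δ / (2 * M)) ^ 2 = (δ ^ 2 + 4 * (M * z.im) ^ 2) / (2 * M) ^ 2 := by
      field_simp; ring
    rw [this, Real.sqrt_div (by positivity), Real.sqrt_sq (by positivity)]
    field_simp
  rw [hyperbolicMark, h]
  refine Prod.ext rfl (Prod.ext ?_ ?_) <;> simp only [schurPair] <;> field_simp

/-- The mark with eigenvalue `z` and `√N (b - c) = δ`. -/
def scaledMark (n : ℕ) (p : ℂ × ℝ) : ℂ × ℝ × ℝ :=
  (p.1, (√((n + 2 : ℕ) : ℝ))⁻¹ * (schurPair (scaledIm n p.1) p.2).1,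
    (√((n + 2 : ℕ) : ℝ))⁻¹ * (schurPair (scaledIm n p.1) p.2).2)

theorem measurable_schurPair_scaledIm (n : ℕ) :
    Measurable fun p : ℂ × ℝ => schurPair (scaledIm n p.1) p.2 :=
  measurable_schurPair.comp (((measurable_scaledIm n).comp measurable_fst).prodMk measurable_snd)

theorem measurable_scaledMark (n : ℕ) : Measurable (scaledMark n) :=
  measurable_fst.prodMk (((measurable_schurPair_scaledIm n).fst.const_mul _).prodMk
    ((measurable_schurPair_scaledIm n).snd.const_mul _))

theorem setLIntegral_Ioi_comp_div {M : ℝ} (hM : 0 < M) (g : ℝ → ℝ≥0∞) :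
    ∫⁻ r in Set.Ioi 0, g r = ENNReal.ofReal M⁻¹ * ∫⁻ δ in Set.Ioi 0, g (δ / M) := by
  have himage : (fun δ : ℝ => δ / M) '' Set.Ioi 0 = Set.Ioi 0 := by
    ext r
    refine ⟨?_, fun hr => ⟨r * M, mul_pos hr hM, mul_div_cancel_right₀ r hM.ne'⟩⟩
    rintro ⟨δ, hδ, rfl⟩
    exact div_pos hδ hM
  have h := lintegral_image_eq_lintegral_abs_deriv_mul (s := Set.Ioi (0 : ℝ)) (f := fun δ => δ / M)
    (f' := fun _ => M⁻¹) measurableSet_Ioi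
    (fun δ _ => by simpa using ((hasDerivAt_id δ).div_const M).hasDerivWithinAt)
    (fun δ _ ε _ h => (div_left_inj' hM.ne').mp h) g
  rw [himage] at h
  rw [h, abs_of_pos (inv_pos.mpr hM), lintegral_const_mul' _ _ ENNReal.ofReal_ne_top]

theorem measurable_lintegral_deltaKernel_indicator (τ : ℝ) (n : ℕ) {B : Set (ℂ × ℝ × ℝ)}
    (hB : MeasurableSet B) :
    Measurable fun z : ℂ => deltaKernel τ (scaledIm n z) {δ | scaledMark n (z, δ) ∈ B} :=
  Kernel.measurable_kernel_prodMk_left (κ := (deltaKernel τ).comap _ (measurable_scaledIm n))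
    (measurable_scaledMark n hB)

theorem measurable_normConst (τ : ℝ) : Measurable (normConst τ) := by
  have he : Measurable erfc := antitone_erfc.measurable
  unfold normConst
  exact (measurable_const.mul (by fun_prop)).mul (he.comp (by fun_prop))

/-- Here `M = √N`, and `a = M² / (2 (1 - τ²))`. With `r = δ / (2 M)` the exponent `4 a r²` is `δ² /
(2 (1 - τ²))`, and the factors `2 M` cancel between `r` and the square root, so `M` survives only in
the scaled imaginary part. -/
theorem deltaDensity_rescaled {τ M : ℝ} (hτ : 0 < 1 - τ ^ 2) (hM : 0 < M) {y δ : ℝ} (hy : 0 < y)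
    (hδ : 0 < δ) :
    δ / (2 * M) * Real.exp (-(M ^ 2 / (2 * (1 - τ ^ 2))) * (4 * (δ / (2 * M)) ^ 2)) /
      √(y ^ 2 + (δ / (2 * M)) ^ 2) = normConst τ (M * y) * deltaDensity τ (M * y) δ := by
  have hZ := normConst_pos hτ (M * y)
  have e1 : y ^ 2 + (δ / (2 * M)) ^ 2 = (δ ^ 2 + 4 * (M * y) ^ 2) / (2 * M) ^ 2 := by
    field_simp; ring
  have e2 : -(M ^ 2 / (2 * (1 - τ ^ 2))) * (4 * (δ / (2 * M)) ^ 2) =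
      -δ ^ 2 / (2 * (1 - τ ^ 2)) := by
    field_simp
    norm_num
  have hpos : 0 < √(δ ^ 2 + 4 * (M * y) ^ 2) := Real.sqrt_pos.mpr (by positivity)
  rw [e1, e2, Real.sqrt_div (by positivity), Real.sqrt_sq (by positivity), deltaDensity, if_pos hδ]
  field_simp

theorem setLIntegral_hyperbolicMark {τ a : ℝ} (hτ : 0 < 1 - τ ^ 2) (n : ℕ)
    (ha : a = (n + 2 : ℕ) / (2 * (1 - τ ^ 2))) {B : Set (ℂ × ℝ × ℝ)} (hB : MeasurableSet B) {z : ℂ}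
    (hz : 0 < z.im) :
    ∫⁻ r in Set.Ioi 0, ENNReal.ofReal (r * Real.exp (-a * (4 * r ^ 2)) / √(z.im ^ 2 + r ^ 2)) *
        B.indicator 1 (hyperbolicMark z.re r z.im) =
      ENNReal.ofReal (2 * √((n + 2 : ℕ) : ℝ))⁻¹ * ENNReal.ofReal (normConst τ (scaledIm n z)) *
        deltaKernel τ (scaledIm n z) {δ | scaledMark n (z, δ) ∈ B} := by
  have hM : 0 < √((n + 2 : ℕ) : ℝ) := Real.sqrt_pos.mpr (by positivity)
  have hM2 : √((n + 2 : ℕ) : ℝ) ^ 2 = (n + 2 : ℕ) := Real.sq_sqrt (by positivity)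
  have hmark : ∀ δ, hyperbolicMark z.re (δ / (2 * √((n + 2 : ℕ) : ℝ))) z.im =
    scaledMark n (z, δ) := fun δ => hyperbolicMark_eq hM z δ
  have hdens := fun (δ : ℝ) (hδ : 0 < δ) => deltaDensity_rescaled hτ hM (δ := δ) hz hδ
  have hY : √((n + 2 : ℕ) : ℝ) * z.im = scaledIm n z := rfl
  rw [hM2, ← ha, hY] at hdens
  generalize √((n + 2 : ℕ) : ℝ) = M at hM hmark hdens ⊢
  have hS : MeasurableSet {δ | scaledMark n (z, δ) ∈ B} :=
    (measurable_scaledMark n).comp (measurable_const.prodMk measurable_id) hB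
  have hZ := normConst_pos hτ (scaledIm n z)
  rw [setLIntegral_Ioi_comp_div (M := 2 * M) (by positivity), deltaKernel_apply,
    withDensity_apply _ hS, mul_assoc, ← lintegral_const_mul' (ENNReal.ofReal (normConst _ _)) _
    ENNReal.ofReal_ne_top, ← lintegral_indicator hS, ← lintegral_indicator measurableSet_Ioi]
  congr 1
  refine lintegral_congr fun δ => ?_
  have hmem : B.indicator (1 : ℂ × ℝ × ℝ → ℝ≥0∞) (scaledMark n (z, δ)) =
    {δ | scaledMark n (z, δ) ∈ B}.indicator 1 δ := rfl
  by_cases hδ : 0 < δ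
  · rw [Set.indicator_of_mem (Set.mem_Ioi.mpr hδ), hmark, hmem, hdens δ hδ,
      ENNReal.ofReal_mul hZ.le]
    by_cases hm : δ ∈ {δ | scaledMark n (z, δ) ∈ B}
    · rw [Set.indicator_of_mem hm, Set.indicator_of_mem hm, Pi.one_apply, mul_one]
    · rw [Set.indicator_of_notMem hm, Set.indicator_of_notMem hm, mul_zero]
  · have h0 : ENNReal.ofReal (deltaDensity τ (scaledIm n z) δ) = 0 := by
      rw [deltaDensity, if_neg hδ, ENNReal.ofReal_zero]
    rw [Set.indicator_of_notMem (s := Set.Ioi 0) hδ]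
    exact (Set.indicator_apply_eq_zero.mpr fun _ => by rw [h0, mul_zero]).symm

/-- The intensity of the marked eigenvalues disintegrates along the eigenvalue. -/
theorem exists_markedIntensity_eq {τ : ℝ} (h0 : -1 < τ) (h1 : τ < 1) (n : ℕ) :
    ∃ D : ℂ → ℝ≥0∞, Measurable D ∧ (∀ z, 0 < z.im → D z ≠ 0) ∧
      markedIntensity τ n = (((volume.restrict {z : ℂ | 0 < z.im}).withDensity D) ⊗ₘ
        (deltaKernel τ).comap (scaledIm n) (measurable_scaledIm n)).map (scaledMark n) := by
  have hτ : 0 < 1 - τ ^ 2 := by nlinarith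
  obtain ⟨K, hK0, hKtop, hK⟩ := exists_markedIntensity_eq_mul h0 h1 n
  obtain ⟨a, ha⟩ : ∃ a : ℝ, a = (n + 2 : ℕ) / (2 * (1 - τ ^ 2)) := ⟨_, rfl⟩
  rw [← ha] at hK
  obtain ⟨c, hc0, hctop, hc⟩ := exists_reducedIntensity_eq_mul (Fin n) a τ
  have hU : MeasurableSet {z : ℂ | 0 < z.im} :=
    measurableSet_lt measurable_const Complex.measurable_im
  -- The density of the eigenvalue collects everything that does not depend on `δ`: the constants,
  -- the Jacobian factor `Im z`, the eigenvalue weight, the scaling `1 / (2 √N)` of `r`, and the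
  -- normalising constant split off from the kernel.
  have hD : Measurable fun z : ℂ => K * c * (ENNReal.ofReal z.im *
      eigenvalueWeight (Fin n) a τ z.re z.im * (ENNReal.ofReal (2 * √((n + 2 : ℕ) : ℝ))⁻¹ *
        ENNReal.ofReal (normConst τ (scaledIm n z)))) :=
    (((Complex.measurable_im.ennreal_ofReal.mul ((measurable_eigenvalueWeight a τ).comp
      (Complex.measurable_re.prodMk Complex.measurable_im))).mul
      (((measurable_normConst τ).comp
        (measurable_scaledIm n)).ennreal_ofReal.const_mul _))).const_mul _
  refine ⟨_, hD, fun z hz => ?_, ?_⟩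
  · refine mul_ne_zero (mul_ne_zero hK0 hc0) (mul_ne_zero (mul_ne_zero ?_
      (eigenvalueWeight_ne_zero a τ _ hz.ne')) (mul_ne_zero ?_ ?_))
    · exact (ENNReal.ofReal_pos.mpr hz).ne'
    · have hM : 0 < √((n + 2 : ℕ) : ℝ) := Real.sqrt_pos.mpr (by positivity)
      exact (ENNReal.ofReal_pos.mpr (inv_pos.mpr (mul_pos two_pos hM))).ne'
    · exact (ENNReal.ofReal_pos.mpr (normConst_pos hτ _)).ne'
  ext B hB
  have hmeas := measurable_lintegral_deltaKernel_indicator τ n hB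
  have hrhs := lintegral_withDensity_eq_lintegral_mul (volume.restrict {z : ℂ | 0 < z.im}) hD hmeas
  rw [Measure.map_apply (measurable_scaledMark n) hB,
    Measure.compProd_apply (measurable_scaledMark n hB)]
  refine Eq.trans ?_ hrhs.symm
  rw [hK B hB, hc B hB, ← mul_assoc, ← lintegral_const_mul' _ _ (ENNReal.mul_ne_top hKtop hctop)]
  refine setLIntegral_congr_fun hU fun z hz => ?_
  rw [setLIntegral_hyperbolicMark hτ n ha hB hz, Pi.mul_apply]
  ring

/-- The intensity of the eigenvalues. -/
theorem exists_map_fst_markedIntensity_eq {τ : ℝ} (h0 : -1 < τ) (h1 : τ < 1) (n : ℕ) :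
    ∃ D : ℂ → ℝ≥0∞, Measurable D ∧ (∀ z, 0 < z.im → D z ≠ 0) ∧
      (markedIntensity τ n = (((volume.restrict {z : ℂ | 0 < z.im}).withDensity D) ⊗ₘ
        (deltaKernel τ).comap (scaledIm n) (measurable_scaledIm n)).map (scaledMark n)) ∧
      (markedIntensity τ n).map Prod.fst =
        (volume.restrict {z : ℂ | 0 < z.im}).withDensity D := by
  obtain ⟨D, hD, hD0, hP⟩ := exists_markedIntensity_eq h0 h1 n
  refine ⟨D, hD, hD0, hP, ?_⟩
  have hU : MeasurableSet {z : ℂ | 0 < z.im} :=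
    measurableSet_lt measurable_const Complex.measurable_im
  have hm := measurable_fst.comp (measurable_scaledMark n)
  rw [hP, Measure.map_map measurable_fst (measurable_scaledMark n)]
  ext s hs
  rw [Measure.map_apply hm hs, Measure.compProd_apply (hm hs), ← lintegral_indicator_one hs]
  have hpos : ∀ᵐ z ∂(volume.restrict {z : ℂ | 0 < z.im}).withDensity D, 0 < z.im :=
    (withDensity_absolutelyContinuous _ _).ae_le (ae_restrict_mem hU)
  refine lintegral_congr_ae (hpos.mono fun z hz => ?_)
  have hprob : deltaKernel τ (scaledIm n z) Set.univ = 1 :=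
    (isProbabilityMeasure_deltaKernel (by nlinarith)
      (mul_pos (Real.sqrt_pos.mpr (by positivity)) hz)).measure_univ
  change deltaKernel τ (scaledIm n z) {_δ | z ∈ s} = _
  by_cases hzs : z ∈ s
  · simp [hzs, hprob]
  · simp [hzs]

/-- The conditional law of a function of the mark, given the eigenvalue. -/
theorem hasCondDistrib_of_comp_scaledMark {τ : ℝ} (h0 : -1 < τ) (h1 : τ < 1) (n : ℕ)
    {Y : Type*} [MeasurableSpace Y] {f : ℂ × ℝ × ℝ → Y} (hf : Measurable f)
    {κ : Kernel ℝ Y} [IsSFiniteKernel κ]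
    (hκ : ∀ z : ℂ, 0 < z.im →
      κ (scaledIm n z) = (deltaKernel τ (scaledIm n z)).map fun δ => f (scaledMark n (z, δ))) :
    HasCondDistrib f Prod.fst (κ.comap (scaledIm n) (measurable_scaledIm n))
      (markedIntensity τ n) := by
  obtain ⟨D, -, -, hP, hfst⟩ := exists_map_fst_markedIntensity_eq h0 h1 n
  have hU : MeasurableSet {z : ℂ | 0 < z.im} :=
    measurableSet_lt measurable_const Complex.measurable_im
  refine ⟨(measurable_fst.prodMk hf).aemeasurable, ?_⟩
  rw [hfst]
  conv_lhs => rw [hP]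
  rw [Measure.map_map (measurable_fst.prodMk hf) (measurable_scaledMark n)]
  have hm := (measurable_fst.prodMk hf).comp (measurable_scaledMark n)
  ext s hs
  rw [Measure.map_apply hm hs, Measure.compProd_apply (hm hs), Measure.compProd_apply hs]
  have hpos : ∀ᵐ z ∂(volume.restrict {z : ℂ | 0 < z.im}).withDensity D, 0 < z.im :=
    (withDensity_absolutelyContinuous _ _).ae_le (ae_restrict_mem hU)
  refine lintegral_congr_ae (hpos.mono fun z hz => ?_)
  change deltaKernel τ (scaledIm n z) _ = κ (scaledIm n z) _
  have hfz : Measurable fun δ => f (scaledMark n (z, δ)) :=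
    hf.comp ((measurable_scaledMark n).comp (measurable_const.prodMk measurable_id))
  rw [hκ z hz, Measure.map_apply hfz (measurable_prodMk_left hs)]
  rfl

/-- The density of the eigenvalue vanishes nowhere on the open upper half-plane. -/
theorem absolutelyContinuous_map_fst_markedIntensity {τ : ℝ} (h0 : -1 < τ) (h1 : τ < 1) (n : ℕ) :
    (volume.restrict {z : ℂ | 0 < z.im}) ≪ (markedIntensity τ n).map Prod.fst := by
  obtain ⟨D, hD, hD0, hP⟩ := exists_map_fst_markedIntensity_eq h0 h1 n
  have hU : MeasurableSet {z : ℂ | 0 < z.im} :=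
    measurableSet_lt measurable_const Complex.measurable_im
  rw [hP.2]
  exact withDensity_absolutelyContinuous' hD.aemeasurable
    ((ae_restrict_mem hU).mono fun z hz => hD0 z hz)

/-- The conditional law of `(√N b, √N c)` given `λ = x + i y / √N`. -/
def schurKernel (τ : ℝ) : Kernel ℝ (ℝ × ℝ) :=
  Kernel.piecewise (measurableSet_Ioi (a := (0 : ℝ)))
    ((Kernel.id ×ₖ deltaKernel τ).map (Function.uncurry schurPair))
    -- Only `y > 0` occurs. For `y < 0` the density is not normalised, so an arbitrary probability
    -- measure is used off the positive axis to obtain a Markov kernel.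
    (Kernel.const ℝ (Measure.dirac 0))

theorem schurKernel_apply (τ : ℝ) {y : ℝ} (hy : 0 < y) :
    schurKernel τ y = (deltaKernel τ y).map (schurPair y) := by
  rw [schurKernel, Kernel.piecewise_apply, if_pos (Set.mem_Ioi.mpr hy),
    Kernel.map_apply _ measurable_schurPair, Kernel.prod_apply, Kernel.id_apply,
    Measure.dirac_prod, Measure.map_map measurable_schurPair measurable_prodMk_left]
  rfl

theorem isMarkovKernel_schurKernel {τ : ℝ} (hτ : 0 < 1 - τ ^ 2) :
    IsMarkovKernel (schurKernel τ) := by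
  refine ⟨fun y => ?_⟩
  by_cases hy : 0 < y
  · rw [schurKernel_apply τ hy]
    have := isProbabilityMeasure_deltaKernel hτ hy
    exact Measure.isProbabilityMeasure_map
      (measurable_schurPair.comp measurable_prodMk_left).aemeasurable
  · rw [schurKernel, Kernel.piecewise_apply,
      if_neg (Set.notMem_Ioi.mpr (not_lt.mp hy)), Kernel.const_apply]
    infer_instance

theorem hasCondDistrib_delta {τ : ℝ} (h0 : -1 < τ) (h1 : τ < 1) (n : ℕ) :
    HasCondDistrib (fun p : ℂ × ℝ × ℝ => √((n + 2 : ℕ) : ℝ) * (p.2.1 - p.2.2)) Prod.fst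
      ((deltaKernel τ).comap (scaledIm n) (measurable_scaledIm n)) (markedIntensity τ n) := by
  have hM : √((n + 2 : ℕ) : ℝ) ≠ 0 := (Real.sqrt_pos.mpr (by positivity)).ne'
  refine hasCondDistrib_of_comp_scaledMark h0 h1 n (by fun_prop) fun z _ => ?_
  have h : (fun δ => √((n + 2 : ℕ) : ℝ) * ((scaledMark n (z, δ)).2.1 - (scaledMark n (z, δ)).2.2)) =
      id := by
    funext δ
    rw [scaledMark, ← mul_sub, schurPair_sub, ← mul_assoc, mul_inv_cancel₀ hM, one_mul, id]
  rw [h, Measure.map_id]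

theorem hasCondDistrib_schurPair {τ : ℝ} (h0 : -1 < τ) (h1 : τ < 1) (n : ℕ) :
    HasCondDistrib
      (fun p : ℂ × ℝ × ℝ => (√((n + 2 : ℕ) : ℝ) * p.2.1, √((n + 2 : ℕ) : ℝ) * p.2.2)) Prod.fst
      ((schurKernel τ).comap (scaledIm n) (measurable_scaledIm n)) (markedIntensity τ n) := by
  have hM : 0 < √((n + 2 : ℕ) : ℝ) := Real.sqrt_pos.mpr (by positivity)
  have := isMarkovKernel_schurKernel (τ := τ) (by nlinarith)
  refine hasCondDistrib_of_comp_scaledMark h0 h1 n (by fun_prop) fun z hz => ?_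
  rw [schurKernel_apply τ (show 0 < scaledIm n z from mul_pos hM hz)]
  congr 1
  funext δ
  rw [scaledMark, mul_inv_cancel_left₀ hM.ne', mul_inv_cancel_left₀ hM.ne']

end ConditionalLaw

end EllipticGinibre

end

open EllipticGinibre in
theorem lemma5p1 (τ : ℝ) (hτ0 : 0 ≤ τ) (hτ1 : τ < 1) :
    -- `ρ_{y,τ}` is a probability density, for the explicit `Z_{y,τ}`
    (∀ y : ℝ, 0 < y → IsProbabilityMeasure (deltaKernel τ y)) ∧
    -- the intensity is well defined, and it charges every part of the upper half-plane,
    -- so that conditioning on `λ` makes sense for almost every `λ` there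
    (∀ n : ℕ, AEMeasurable markedSpectrum (ensembleLaw τ (n + 2)) ∧
      IsFiniteMeasure (markedIntensity τ n) ∧
      (volume.restrict {z : ℂ | 0 < z.im}) ≪ (markedIntensity τ n).map Prod.fst) ∧
    -- `δ = √N (b - c)` has density `ρ_{y,τ}` conditionally on `λ = x + i y / √N`
    (∀ n : ℕ, HasCondDistrib
      (fun p : ℂ × ℝ × ℝ => √((n + 2 : ℕ) : ℝ) * (p.2.1 - p.2.2)) Prod.fst
      ((deltaKernel τ).comap (scaledIm n) (measurable_scaledIm n)) (markedIntensity τ n)) ∧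
    -- the joint law of `(√N b, √N c)` conditionally on `λ = x + i y / √N` does not depend on `N`
    (∃ κ : Kernel ℝ (ℝ × ℝ), IsMarkovKernel κ ∧
      ∀ n : ℕ, HasCondDistrib
        (fun p : ℂ × ℝ × ℝ => (√((n + 2 : ℕ) : ℝ) * p.2.1, √((n + 2 : ℕ) : ℝ) * p.2.2)) Prod.fst
        (κ.comap (scaledIm n) (measurable_scaledIm n)) (markedIntensity τ n)) := by
  have h0 : -1 < τ := by linarith
  have hτ : 0 < 1 - τ ^ 2 := by nlinarith
  exact ⟨fun y hy => isProbabilityMeasure_deltaKernel hτ hy,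
    fun n => ⟨aemeasurable_markedSpectrum h0 hτ1 n, isFiniteMeasure_markedIntensity h0 hτ1 n,
      absolutelyContinuous_map_fst_markedIntensity h0 hτ1 n⟩,
    hasCondDistrib_delta h0 hτ1,
    schurKernel τ, isMarkovKernel_schurKernel hτ, hasCondDistrib_schurPair h0 hτ1⟩
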